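/- **Conventions.** Vectors are columns in $V=\mathbb C^n$; matrices act on them from the left. Empty products are $1$. For compositions $\alpha,\beta,\gamma$ of $n$ let $S(\alpha,\beta,\gamma)\subset(\mathbb C^n)^3$ be the set of $(x,y,z)$ such that $x$ is constant on the consecutive blocks of $\alpha$ with different values $a_1,a_2,\dots$ on different blocks, $y$ likewise for $\beta$ with values $b_1,b_2,\dots$, $z$ likewise for $\gamma$ with values $c_1,c_2,\dots$, and the trace condition $\sum_i x_i=\sum_i(y_i+z_i)$ holds. Consider the following four cases (here $(1^n)=(1,\dots,1)$), with explicit $n\times n$ matrices $B$, $C$, and $A=B+C$. All entries not listed are $0$. **Hypergeometric family.** $(\alpha,\beta,\gamma)=((1,m-1),(1^m),(1^m))$, $m\ge2$, $n=m$. $B_{ii}=b_i$, $B_{ij}=b_i+c_{m+1-i}-a_2$ for $i<j$; $C_{ii}=c_{m+1-i}$, $C_{ij}=b_i+c_{m+1-i}-a_2$ for $i>j$. Put $$l_i=\frac{\prod_{k=i+1}^m(b_i-b_k)}{\prod_{k=1}^{i-1}(b_i-b_k)}\cdot\frac{\prod_{k=m+2-i}^m(b_i+c_k-a_2)}{\prod_{k=1}^{m+1-i}(b_i+c_k-a_2)}\qquad(1\le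 i\le m).$$ In the next two families put $p_i^{jk}=c_i+b_j-a_k$ and $q_{ij}=c_i+c_j+b_2+b_3-a_1-a_2$. **Even family.** $(\alpha,\beta,\gamma)=((m,m),(1,m-1,m),(1^{2m}))$, $m\ge2$, $n=2m$. The diagonal of $B$ is $y$, that is $b_1$, then $b_2$ ($m-1$ times), then $b_3$ ($m$ times); $C_{ii}=c_{2m+1-i}$; and $$B_{1,1+j}=(-1)^{m+1-j}\frac{\prod_{k=j+1}^m q_{k,2m-j}}{\prod_{k=m+1}^{2m-1-j}(c_k-c_{2m-j})}\quad(1\le j\le m-1),$$ $$B_{1,m+j}=(-1)^{m-j}p^{31}_{m+1-j}\frac{\prod_{k=m+j}^{2m-1}q_{m+1-j,k}}{\prod_{k=1}^{m-j}(c_k-c_{m+1-j})}\quad(1\le j\le m),$$ $$B_{1+i,m+j}=(-1)^{m-j}p^{31}_{m+1-j}\frac{\prod_{1\le k\le i,\,k\ne m+1-j}q_{k,2m-i}\ \prod_{m+j\le k\le 2m-1,\,k\ne2m-i}q_{m+1-j,k}}{\prod_{k=2m+1-i}^{2m-1}(c_{2m-i}-c_k)\ \prod_{k=1}^{m-j}(c_k-c_{m+1-j})}\quad(1\le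 i\le m-1,\ 1\le j\le m),$$ $$C_{1+i,1}=-\frac{\prod_{k=1}^i q_{k,2m-i}}{\prod_{k=2m+1-i}^{2m-1}(c_{2m-i}-c_k)}\quad(1\le i\le m-1),$$ $$C_{m+i,1}=-p^{32}_{m+1-i}\frac{\prod_{k=m+1}^{m-1+i}q_{m+1-i,k}}{\prod_{k=m+2-i}^m(c_{m+1-i}-c_k)}\quad(1\le i\le m),$$ $$C_{m+i,1+j}=(-1)^{m+1-j}p^{32}_{m+1-i}\frac{\prod_{m+1\le k\le m-1+i,\,k\ne2m-j}q_{m+1-i,k}\ \prod_{j+1\le k\le m,\,k\ne m+1-i}q_{k,2m-j}}{\prod_{k=m+2-i}^m(c_{m+1-i}-c_k)\ \prod_{k=m+1}^{2m-1-j}(c_k-c_{2m-j})}\quad(1\le i\le m,\ 1\le j\le m-1).$$ Put, for $1\le i\le 2m$, $$l_i=\frac{\prod_{k=i+1}^{2m}(c_i-c_k)}{\prod_{k=1}^{i-1}(c_i-c_k)}\cdot\frac{\prod_{2m+1-i\le k\le2m,\,k\ne i}q_{ik}}{\prod_{1\le k\le2m-i,\,k\ne i}q_{ik}}\cdot\begin{cases}p^{31}_i/p^{32}_i,&i\le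 m,\\ p^{31}_i\,p^{32}_i,&i>m.\end{cases}$$ **Odd family.** $(\alpha,\beta,\gamma)=((m+1,m),(1,m,m),(1^{2m+1}))$, $m\ge2$, $n=2m+1$. The diagonal of $B$ is $y$, that is $b_1$, then $b_2$ ($m$ times), then $b_3$ ($m$ times); $C_{ii}=c_{2m+2-i}$; and, for $1\le i,j\le m$, $$B_{1,1+j}=(-1)^{m-j}p^{21}_{2m+1-j}\frac{\prod_{k=j+1}^m q_{k,2m+1-j}}{\prod_{k=m+1}^{2m-j}(c_k-c_{2m+1-j})},\qquad B_{1,m+1+j}=(-1)^{m-j}p^{31}_{m+1-j}\frac{\prod_{k=m+1+j}^{2m}q_{m+1-j,k}}{\prod_{k=1}^{m-j}(c_k-c_{m+1-j})},$$ $$B_{1+i,m+1+j}=(-1)^{m-j}p^{31}_{m+1-j}\frac{\prod_{1\le k\le i,\,k\ne m+1-j}q_{k,2m+1-i}\ \prod_{m+1+j\le k\le2m,\,k\ne2m+1-i}q_{m+1-j,k}}{\prod_{k=2m+2-i}^{2m}(c_{2m+1-i}-c_k)\ \prod_{k=1}^{m-j}(c_k-c_{m+1-j})},$$ $$C_{1+i,1}=-\frac{\prod_{k=1}^i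 q_{k,2m+1-i}}{\prod_{k=2m+2-i}^{2m}(c_{2m+1-i}-c_k)},\qquad C_{m+1+i,1}=-\frac{\prod_{k=m+1}^{m+i}q_{m+1-i,k}}{\prod_{k=m+2-i}^m(c_{m+1-i}-c_k)},$$ $$C_{m+1+i,1+j}=(-1)^{m-j}p^{21}_{2m+1-j}\frac{\prod_{m+1\le k\le m+i,\,k\ne2m+1-j}q_{m+1-i,k}\ \prod_{j+1\le k\le m,\,k\ne m+1-i}q_{k,2m+1-j}}{\prod_{k=m+2-i}^m(c_{m+1-i}-c_k)\ \prod_{k=m+1}^{2m-j}(c_k-c_{2m+1-j})}.$$ Put, for $1\le i\le2m+1$, $$l_i=\frac{\prod_{k=i+1}^{2m+1}(c_i-c_k)}{\prod_{k=1}^{i-1}(c_i-c_k)}\cdot\frac{\prod_{2m+2-i\le k\le2m+1,\,k\ne i}q_{ik}}{\prod_{1\le k\le2m+1-i,\,k\ne i}q_{ik}}\cdot\begin{cases}p^{31}_i/p^{21}_i,&i\le m,\\ p^{31}_i\,p^{21}_i,&i>m.\end{cases}$$ **Extra case.** $(\alpha,\beta,\gamma)=((4,2),(2,2,2),(1^6))$,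 $n=6$. Put $p_{ij}=b_i+c_j-a_1$, $q_{ijk}=c_i+c_j+c_k-\frac12\sum_{l=1}^6c_l$, $d_{ij}=c_i-c_j$, and $$B=\begin{pmatrix}b_1&0&-\frac{p_{16}q_{245}}{d_{34}}&p_{16}&\frac{p_{16}q_{245}}{d_{12}}&p_{16}\\ 0&b_1&\frac{p_{15}q_{235}q_{246}}{d_{34}d_{56}}&-\frac{p_{15}q_{236}}{d_{56}}&-\frac{p_{15}q_{236}q_{246}}{d_{12}d_{56}}&-\frac{p_{15}q_{235}}{d_{56}}\\ 0&0&b_2&0&-\frac{p_{24}q_{236}}{d_{12}}&p_{24}\\ 0&0&0&b_2&-\frac{p_{23}q_{245}q_{246}}{d_{12}d_{34}}&\frac{p_{23}q_{235}}{d_{34}}\\ 0&0&0&0&b_3&0\\ 0&0&0&0&0&b_3\end{pmatrix},$$ $$C=\begin{pmatrix}c_6&0&0&0&0&0\\ 0&c_5&0&0&0&0\\ -\frac{p_{24}q_{236}}{d_{56}}&-p_{24}&c_4&0&0&0\\ -\frac{p_{23}q_{235}q_{246}}{d_{34}d_{56}}&-\frac{p_{23}q_{245}}{d_{34}}&0&c_3&0&0\\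 -\frac{p_{32}q_{235}}{d_{56}}&-p_{32}&\frac{p_{32}q_{235}}{d_{34}}&-p_{32}&c_2&0\\ \frac{p_{31}q_{236}q_{246}}{d_{12}d_{56}}&\frac{p_{31}q_{245}}{d_{12}}&\frac{p_{31}q_{245}q_{246}}{d_{12}d_{34}}&-\frac{p_{31}q_{236}}{d_{12}}&0&c_1\end{pmatrix},$$ $$l_1=-\frac{d_{12}d_{13}d_{14}d_{15}d_{16}}{p_{11}p_{21}p_{31}},\qquad l_2=\frac{d_{23}d_{24}d_{25}d_{26}}{d_{21}\,p_{12}p_{22}p_{32}}\cdot\frac{q_{134}q_{135}q_{136}q_{145}}{q_{146}q_{156}},$$ $$l_3=\frac{d_{34}d_{35}d_{36}\,p_{33}}{d_{31}d_{32}\,p_{13}p_{23}}\cdot\frac{q_{124}q_{125}q_{126}q_{145}}{q_{146}q_{156}},\qquad l_4=\frac{d_{45}d_{46}\,p_{34}}{d_{41}d_{42}d_{43}\,p_{14}p_{24}}\cdot\frac{q_{123}q_{125}q_{126}q_{135}q_{136}}{q_{156}},$$ $$l_5=\frac{d_{56}\,p_{25}p_{35}}{d_{51}d_{52}d_{53}d_{54}\,p_{15}}\cdot\frac{q_{123}q_{124}q_{126}q_{134}q_{136}}{q_{146}},\qquad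 l_6=\frac{p_{26}p_{36}}{d_{61}d_{62}d_{63}d_{64}d_{65}\,p_{16}}\cdot q_{123}q_{124}q_{125}q_{134}q_{135}q_{145}.$$ **Theorem.** In each of the four cases write $S=S(\alpha,\beta,\gamma)$, let $S'\subset S$ be the set where no linear form in the denominator of any displayed $l_i$ vanishes, and $S''\subset S'$ the set where moreover no linear form in the numerator of any displayed $l_i$ vanishes. Then: 1. $S''\subset S'\subset S$, both $S'$ and $S''$ are open in $S$, and each is obtained from $S$ by removing finitely many hyperplanes (zero levels of linear forms on $(\mathbb C^n)^3$, none of which is identically zero on $S$). 2. For every $(x,y,z)\in S$ the matrices $A$, $B$, $C$ are diagonalizable, with eigenvalues, counted with multiplicity, $x$, $y$, $z$ respectively. Moreover there is exactly one basis $v_1,\dots,v_n$ of $V$ such that: in the hypergeometric family, $Bv_i=b_iv_i$, the $i$-th coordinate of $v_i$ is $1$, and all later coordinates are $0$; in the other cases, $Cv_i=c_iv_i$, the $(n+1-i)$-th coordinate of $v_i$ is $1$, and all earlier coordinates are $0$. 3. If $(x,y,z)\in S'$, then the bilinear form on $V$ determined by $\langle v_i,v_j\rangle=\delta_{ij}\,l_i$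 is symmetric and non-zero, and $A$, $B$ and $C$ are self-adjoint with respect to it. 4. If $(x,y,z)\in S''$, then this form is non-degenerate. -/

import Mathlib

open scoped Matrix

noncomputable section

/-- The triples of spectral types in Simpson's list. -/
inductive SimpsonType where
  | hypergeometric (m : ℕ) (hm : 2 ≤ m)
  | even (m : ℕ) (hm : 2 ≤ m)
  | odd (m : ℕ) (hm : 2 ≤ m)
  | extra

/-- Triples of vectors `(x, y, z) ∈ (ℂⁿ)³`; `x`, `y`, `z` list the eigenvalues of `A`, `B`, `C`. -/
abbrev TripleSpace (n : ℕ) : Type := (Fin n → ℂ) × (Fin n → ℂ) × (Fin n → ℂ)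

namespace SimpsonType

/-- The size `n` of the matrices. -/
def dim : SimpsonType → ℕ
  | hypergeometric m _ => m
  | even m _ => 2 * m
  | odd m _ => 2 * m + 1
  | extra => 6

/-- The spectral type of `A`. -/
def typeA : (t : SimpsonType) → Composition t.dim
  | hypergeometric m hm =>
      { blocks := [1, m - 1]
        blocks_pos := by intro i hi; simp at hi; omega
        blocks_sum := by simp [dim]; omega }
  | even m hm =>
      { blocks := [m, m]
        blocks_pos := by intro i hi; simp at hi; omega
        blocks_sum := by simp [dim]; omega }
  | odd m hm =>
      { blocks := [m + 1, m]
        blocks_pos := by intro i hi; simp at hi; omega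
        blocks_sum := by simp [dim]; omega }
  | extra =>
      { blocks := [4, 2]
        blocks_pos := by intro i hi; simp at hi; omega
        blocks_sum := by simp [dim] }

/-- The spectral type of `B`. -/
def typeB : (t : SimpsonType) → Composition t.dim
  | hypergeometric m _ => Composition.ones m
  | even m hm =>
      { blocks := [1, m - 1, m]
        blocks_pos := by intro i hi; simp at hi; omega
        blocks_sum := by simp [dim]; omega }
  | odd m hm =>
      { blocks := [1, m, m]
        blocks_pos := by intro i hi; simp at hi; omega
        blocks_sum := by simp [dim]; omega }
  | extra =>
      { blocks := [2, 2, 2]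
        blocks_pos := by intro i hi; simp at hi; omega
        blocks_sum := by simp [dim] }

/-- The spectral type of `C`: all eigenvalues are distinct. -/
def typeC (t : SimpsonType) : Composition t.dim := Composition.ones t.dim

end SimpsonType

/-- The vector `x` has spectral type `α`: it is constant on each block of `α`, and its values on
different blocks are different. -/
def HasSpectralType {n : ℕ} (α : Composition n) (x : Fin n → ℂ) : Prop :=
  ∀ i j, x i = x j ↔ α.index i = α.index j

/-- The set `S(α, β, γ)`: triples of vectors of the given spectral types that satisfy the trace
condition. -/
def spectraSet {n : ℕ} (α β γ : Composition n) : Set (TripleSpace n) :=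
  {s | HasSpectralType α s.1 ∧ HasSpectralType β s.2.1 ∧ HasSpectralType γ s.2.2 ∧
    ∑ i, s.1 i = ∑ i, (s.2.1 i + s.2.2 i)}

/-- The coordinate `x_k` with `k` counted from `1` (and `0` outside `1 ≤ k ≤ n`). -/
def coord {n : ℕ} (x : Fin n → ℂ) (k : ℕ) : ℂ :=
  if h : 1 ≤ k ∧ k ≤ n then x ⟨k - 1, by omega⟩ else 0

/-- The value of `x` on the `k`-th block of `α`, with `k` counted from `1`: the `k`-th distinct
eigenvalue. -/
def blockValue {n : ℕ} (α : Composition n) (x : Fin n → ℂ) (k : ℕ) : ℂ :=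
  coord x (α.sizeUpTo (k - 1) + 1)

/-- The square matrix whose entries are given by a function of indices counted from `1`. -/
def oneBased (n : ℕ) (f : ℕ → ℕ → ℂ) : Matrix (Fin n) (Fin n) ℂ :=
  Matrix.of fun i j => f (i + 1) (j + 1)

/-! ### Explicit entries

In this part `a`, `b`, `c` are the distinct eigenvalues `a_1, a_2`, `b_1, b_2, …`, `c_1, c_2, …`
and all indices are counted from `1`. -/

namespace Hypergeometric

/-- Entries of `B`. -/
def entryB (m : ℕ) (a b c : ℕ → ℂ) (i j : ℕ) : ℂ :=
  if i < j then b i + c (m + 1 - i) - a 2 else if i = j then b i else 0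

/-- Entries of `C`. -/
def entryC (m : ℕ) (a b c : ℕ → ℂ) (i j : ℕ) : ℂ :=
  if j < i then b i + c (m + 1 - i) - a 2 else if i = j then c (m + 1 - i) else 0

/-- Numerator of `⟨v_i, v_i⟩`. -/
def num (m : ℕ) (a b c : ℕ → ℂ) (i : ℕ) : ℂ :=
  (∏ k ∈ Finset.Icc (i + 1) m, (b i - b k)) *
    ∏ k ∈ Finset.Icc (m + 2 - i) m, (b i + c k - a 2)

/-- Denominator of `⟨v_i, v_i⟩`. -/
def den (m : ℕ) (a b c : ℕ → ℂ) (i : ℕ) : ℂ :=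
  (∏ k ∈ Finset.Icc 1 (i - 1), (b i - b k)) *
    ∏ k ∈ Finset.Icc 1 (m + 1 - i), (b i + c k - a 2)

end Hypergeometric

/-- `p_i^{jk} = c_i + b_j - a_k` (even and odd families). -/
def pForm (a b c : ℕ → ℂ) (i j k : ℕ) : ℂ := c i + b j - a k

/-- `q_{ij} = c_i + c_j + b_2 + b_3 - a_1 - a_2` (even and odd families). -/
def qForm (a b c : ℕ → ℂ) (i j : ℕ) : ℂ := c i + c j + b 2 + b 3 - a 1 - a 2

namespace EvenFamily

/-- `B_{1,1+j}` for `1 ≤ j ≤ m - 1`. -/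
def B12 (m : ℕ) (a b c : ℕ → ℂ) (j : ℕ) : ℂ :=
  (-1) ^ (m + 1 - j) * (∏ k ∈ Finset.Icc (j + 1) m, qForm a b c k (2 * m - j)) /
    ∏ k ∈ Finset.Icc (m + 1) (2 * m - 1 - j), (c k - c (2 * m - j))

/-- `B_{1,m+j}` for `1 ≤ j ≤ m`. -/
def B13 (m : ℕ) (a b c : ℕ → ℂ) (j : ℕ) : ℂ :=
  (-1) ^ (m - j) * pForm a b c (m + 1 - j) 3 1 *
      (∏ k ∈ Finset.Icc (m + j) (2 * m - 1), qForm a b c (m + 1 - j) k) /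
    ∏ k ∈ Finset.Icc 1 (m - j), (c k - c (m + 1 - j))

/-- `B_{1+i,m+j}` for `1 ≤ i ≤ m - 1`, `1 ≤ j ≤ m`. -/
def B23 (m : ℕ) (a b c : ℕ → ℂ) (i j : ℕ) : ℂ :=
  (-1) ^ (m - j) * pForm a b c (m + 1 - j) 3 1 *
      ((∏ k ∈ (Finset.Icc 1 i).erase (m + 1 - j), qForm a b c k (2 * m - i)) *
        ∏ k ∈ (Finset.Icc (m + j) (2 * m - 1)).erase (2 * m - i), qForm a b c (m + 1 - j) k) /
    ((∏ k ∈ Finset.Icc (2 * m + 1 - i) (2 * m - 1), (c (2 * m - i) - c k)) *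
      ∏ k ∈ Finset.Icc 1 (m - j), (c k - c (m + 1 - j)))

/-- `C_{1+i,1}` for `1 ≤ i ≤ m - 1`. -/
def C21 (m : ℕ) (a b c : ℕ → ℂ) (i : ℕ) : ℂ :=
  -((∏ k ∈ Finset.Icc 1 i, qForm a b c k (2 * m - i)) /
    ∏ k ∈ Finset.Icc (2 * m + 1 - i) (2 * m - 1), (c (2 * m - i) - c k))

/-- `C_{m+i,1}` for `1 ≤ i ≤ m`. -/
def C31 (m : ℕ) (a b c : ℕ → ℂ) (i : ℕ) : ℂ :=
  -(pForm a b c (m + 1 - i) 3 2 *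
      (∏ k ∈ Finset.Icc (m + 1) (m - 1 + i), qForm a b c (m + 1 - i) k) /
    ∏ k ∈ Finset.Icc (m + 2 - i) m, (c (m + 1 - i) - c k))

/-- `C_{m+i,1+j}` for `1 ≤ i ≤ m`, `1 ≤ j ≤ m - 1`. -/
def C32 (m : ℕ) (a b c : ℕ → ℂ) (i j : ℕ) : ℂ :=
  (-1) ^ (m + 1 - j) * pForm a b c (m + 1 - i) 3 2 *
      ((∏ k ∈ (Finset.Icc (m + 1) (m - 1 + i)).erase (2 * m - j), qForm a b c (m + 1 - i) k) *
        ∏ k ∈ (Finset.Icc (j + 1) m).erase (m + 1 - i), qForm a b c k (2 * m - j)) /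
    ((∏ k ∈ Finset.Icc (m + 2 - i) m, (c (m + 1 - i) - c k)) *
      ∏ k ∈ Finset.Icc (m + 1) (2 * m - 1 - j), (c k - c (2 * m - j)))

/-- Entries of `B`; the blocks have sizes `1, m - 1, m`. -/
def entryB (m : ℕ) (a b c : ℕ → ℂ) (i j : ℕ) : ℂ :=
  if i = 1 then
    if j = 1 then b 1
    else if j ≤ m then B12 m a b c (j - 1)
    else B13 m a b c (j - m)
  else if i ≤ m then
    if j ≤ m then (if i = j then b 2 else 0)
    else B23 m a b c (i - 1) (j - m)
  else (if i = j then b 3 else 0)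

/-- Entries of `C`; the blocks have sizes `1, m - 1, m`. -/
def entryC (m : ℕ) (a b c : ℕ → ℂ) (i j : ℕ) : ℂ :=
  if i = j then c (2 * m + 1 - i)
  else if i = 1 then 0
  else if i ≤ m then
    if j = 1 then C21 m a b c (i - 1) else 0
  else
    if j = 1 then C31 m a b c (i - m)
    else if j ≤ m then C32 m a b c (i - m) (j - 1)
    else 0

/-- Numerator of `⟨v_i, v_i⟩`. -/
def num (m : ℕ) (a b c : ℕ → ℂ) (i : ℕ) : ℂ :=
  (∏ k ∈ Finset.Icc (i + 1) (2 * m), (c i - c k)) *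
    (∏ k ∈ (Finset.Icc (2 * m + 1 - i) (2 * m)).erase i, qForm a b c i k) *
    if i ≤ m then pForm a b c i 3 1 else pForm a b c i 3 1 * pForm a b c i 3 2

/-- Denominator of `⟨v_i, v_i⟩`. -/
def den (m : ℕ) (a b c : ℕ → ℂ) (i : ℕ) : ℂ :=
  (∏ k ∈ Finset.Icc 1 (i - 1), (c i - c k)) *
    (∏ k ∈ (Finset.Icc 1 (2 * m - i)).erase i, qForm a b c i k) *
    if i ≤ m then pForm a b c i 3 2 else 1

end EvenFamily

namespace OddFamily

/-- `B_{1,1+j}` for `1 ≤ j ≤ m`. -/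
def B12 (m : ℕ) (a b c : ℕ → ℂ) (j : ℕ) : ℂ :=
  (-1) ^ (m - j) * pForm a b c (2 * m + 1 - j) 2 1 *
      (∏ k ∈ Finset.Icc (j + 1) m, qForm a b c k (2 * m + 1 - j)) /
    ∏ k ∈ Finset.Icc (m + 1) (2 * m - j), (c k - c (2 * m + 1 - j))

/-- `B_{1,m+1+j}` for `1 ≤ j ≤ m`. -/
def B13 (m : ℕ) (a b c : ℕ → ℂ) (j : ℕ) : ℂ :=
  (-1) ^ (m - j) * pForm a b c (m + 1 - j) 3 1 *
      (∏ k ∈ Finset.Icc (m + 1 + j) (2 * m), qForm a b c (m + 1 - j) k) /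
    ∏ k ∈ Finset.Icc 1 (m - j), (c k - c (m + 1 - j))

/-- `B_{1+i,m+1+j}` for `1 ≤ i ≤ m`, `1 ≤ j ≤ m`. -/
def B23 (m : ℕ) (a b c : ℕ → ℂ) (i j : ℕ) : ℂ :=
  (-1) ^ (m - j) * pForm a b c (m + 1 - j) 3 1 *
      ((∏ k ∈ (Finset.Icc 1 i).erase (m + 1 - j), qForm a b c k (2 * m + 1 - i)) *
        ∏ k ∈ (Finset.Icc (m + 1 + j) (2 * m)).erase (2 * m + 1 - i),
          qForm a b c (m + 1 - j) k) /
    ((∏ k ∈ Finset.Icc (2 * m + 2 - i) (2 * m), (c (2 * m + 1 - i) - c k)) *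
      ∏ k ∈ Finset.Icc 1 (m - j), (c k - c (m + 1 - j)))

/-- `C_{1+i,1}` for `1 ≤ i ≤ m`. -/
def C21 (m : ℕ) (a b c : ℕ → ℂ) (i : ℕ) : ℂ :=
  -((∏ k ∈ Finset.Icc 1 i, qForm a b c k (2 * m + 1 - i)) /
    ∏ k ∈ Finset.Icc (2 * m + 2 - i) (2 * m), (c (2 * m + 1 - i) - c k))

/-- `C_{m+1+i,1}` for `1 ≤ i ≤ m`. -/
def C31 (m : ℕ) (a b c : ℕ → ℂ) (i : ℕ) : ℂ :=
  -((∏ k ∈ Finset.Icc (m + 1) (m + i), qForm a b c (m + 1 - i) k) /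
    ∏ k ∈ Finset.Icc (m + 2 - i) m, (c (m + 1 - i) - c k))

/-- `C_{m+1+i,1+j}` for `1 ≤ i ≤ m`, `1 ≤ j ≤ m`. -/
def C32 (m : ℕ) (a b c : ℕ → ℂ) (i j : ℕ) : ℂ :=
  (-1) ^ (m - j) * pForm a b c (2 * m + 1 - j) 2 1 *
      ((∏ k ∈ (Finset.Icc (m + 1) (m + i)).erase (2 * m + 1 - j), qForm a b c (m + 1 - i) k) *
        ∏ k ∈ (Finset.Icc (j + 1) m).erase (m + 1 - i), qForm a b c k (2 * m + 1 - j)) /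
    ((∏ k ∈ Finset.Icc (m + 2 - i) m, (c (m + 1 - i) - c k)) *
      ∏ k ∈ Finset.Icc (m + 1) (2 * m - j), (c k - c (2 * m + 1 - j)))

/-- Entries of `B`; the blocks have sizes `1, m, m`. -/
def entryB (m : ℕ) (a b c : ℕ → ℂ) (i j : ℕ) : ℂ :=
  if i = 1 then
    if j = 1 then b 1
    else if j ≤ m + 1 then B12 m a b c (j - 1)
    else B13 m a b c (j - (m + 1))
  else if i ≤ m + 1 then
    if j ≤ m + 1 then (if i = j then b 2 else 0)
    else B23 m a b c (i - 1) (j - (m + 1))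
  else (if i = j then b 3 else 0)

/-- Entries of `C`; the blocks have sizes `1, m, m`. -/
def entryC (m : ℕ) (a b c : ℕ → ℂ) (i j : ℕ) : ℂ :=
  if i = j then c (2 * m + 2 - i)
  else if i = 1 then 0
  else if i ≤ m + 1 then
    if j = 1 then C21 m a b c (i - 1) else 0
  else
    if j = 1 then C31 m a b c (i - (m + 1))
    else if j ≤ m + 1 then C32 m a b c (i - (m + 1)) (j - 1)
    else 0

/-- Numerator of `⟨v_i, v_i⟩`. -/
def num (m : ℕ) (a b c : ℕ → ℂ) (i : ℕ) : ℂ :=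
  (∏ k ∈ Finset.Icc (i + 1) (2 * m + 1), (c i - c k)) *
    (∏ k ∈ (Finset.Icc (2 * m + 2 - i) (2 * m + 1)).erase i, qForm a b c i k) *
    if i ≤ m then pForm a b c i 3 1 else pForm a b c i 3 1 * pForm a b c i 2 1

/-- Denominator of `⟨v_i, v_i⟩`. -/
def den (m : ℕ) (a b c : ℕ → ℂ) (i : ℕ) : ℂ :=
  (∏ k ∈ Finset.Icc 1 (i - 1), (c i - c k)) *
    (∏ k ∈ (Finset.Icc 1 (2 * m + 1 - i)).erase i, qForm a b c i k) *
    if i ≤ m then pForm a b c i 2 1 else 1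

end OddFamily

namespace ExtraCase

/-- `p_{ij} = b_i + c_j - a_1`. -/
def p (a b c : ℕ → ℂ) (i j : ℕ) : ℂ := b i + c j - a 1

/-- `q_{ijk} = c_i + c_j + c_k - (c_1 + ⋯ + c_6) / 2`. -/
def q (c : ℕ → ℂ) (i j k : ℕ) : ℂ := c i + c j + c k - (1 / 2) * ∑ l ∈ Finset.Icc 1 6, c l

/-- The matrix `B`. -/
def matB (a b c : ℕ → ℂ) : Matrix (Fin 6) (Fin 6) ℂ :=
  let p := p a b c
  let q := q c
  !![b 1, 0,
      -(p 1 6 * q 2 4 5) / (c 3 - c 4), p 1 6,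
      (p 1 6 * q 2 4 5) / (c 1 - c 2), p 1 6;
     0, b 1,
      (p 1 5 * q 2 3 5 * q 2 4 6) / ((c 3 - c 4) * (c 5 - c 6)),
      -(p 1 5 * q 2 3 6) / (c 5 - c 6),
      -(p 1 5 * q 2 3 6 * q 2 4 6) / ((c 1 - c 2) * (c 5 - c 6)),
      -(p 1 5 * q 2 3 5) / (c 5 - c 6);
     0, 0, b 2, 0,
      -(p 2 4 * q 2 3 6) / (c 1 - c 2), p 2 4;
     0, 0, 0, b 2,
      -(p 2 3 * q 2 4 5 * q 2 4 6) / ((c 1 - c 2) * (c 3 - c 4)),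
      (p 2 3 * q 2 3 5) / (c 3 - c 4);
     0, 0, 0, 0, b 3, 0;
     0, 0, 0, 0, 0, b 3]

/-- The matrix `C`. -/
def matC (a b c : ℕ → ℂ) : Matrix (Fin 6) (Fin 6) ℂ :=
  let p := p a b c
  let q := q c
  !![c 6, 0, 0, 0, 0, 0;
     0, c 5, 0, 0, 0, 0;
     -(p 2 4 * q 2 3 6) / (c 5 - c 6), -p 2 4, c 4, 0, 0, 0;
     -(p 2 3 * q 2 3 5 * q 2 4 6) / ((c 3 - c 4) * (c 5 - c 6)),
      -(p 2 3 * q 2 4 5) / (c 3 - c 4), 0, c 3, 0, 0;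
     -(p 3 2 * q 2 3 5) / (c 5 - c 6), -p 3 2,
      (p 3 2 * q 2 3 5) / (c 3 - c 4), -p 3 2, c 2, 0;
     (p 3 1 * q 2 3 6 * q 2 4 6) / ((c 1 - c 2) * (c 5 - c 6)),
      (p 3 1 * q 2 4 5) / (c 1 - c 2),
      (p 3 1 * q 2 4 5 * q 2 4 6) / ((c 1 - c 2) * (c 3 - c 4)),
      -(p 3 1 * q 2 3 6) / (c 1 - c 2), 0, c 1]

/-- Numerators of `⟨v_1, v_1⟩, …, ⟨v_6, v_6⟩`. -/
def num (a b c : ℕ → ℂ) : Fin 6 → ℂ :=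
  let p := p a b c
  let q := q c
  ![-((c 1 - c 2) * (c 1 - c 3) * (c 1 - c 4) * (c 1 - c 5) * (c 1 - c 6)),
    (c 2 - c 3) * (c 2 - c 4) * (c 2 - c 5) * (c 2 - c 6) *
      (q 1 3 4 * q 1 3 5 * q 1 3 6 * q 1 4 5),
    (c 3 - c 4) * (c 3 - c 5) * (c 3 - c 6) * p 3 3 *
      (q 1 2 4 * q 1 2 5 * q 1 2 6 * q 1 4 5),
    (c 4 - c 5) * (c 4 - c 6) * p 3 4 *
      (q 1 2 3 * q 1 2 5 * q 1 2 6 * q 1 3 5 * q 1 3 6),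
    (c 5 - c 6) * p 2 5 * p 3 5 *
      (q 1 2 3 * q 1 2 4 * q 1 2 6 * q 1 3 4 * q 1 3 6),
    p 2 6 * p 3 6 *
      (q 1 2 3 * q 1 2 4 * q 1 2 5 * q 1 3 4 * q 1 3 5 * q 1 4 5)]

/-- Denominators of `⟨v_1, v_1⟩, …, ⟨v_6, v_6⟩`. -/
def den (a b c : ℕ → ℂ) : Fin 6 → ℂ :=
  let p := p a b c
  let q := q c
  ![p 1 1 * p 2 1 * p 3 1,
    (c 2 - c 1) * p 1 2 * p 2 2 * p 3 2 * (q 1 4 6 * q 1 5 6),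
    (c 3 - c 1) * (c 3 - c 2) * p 1 3 * p 2 3 * (q 1 4 6 * q 1 5 6),
    (c 4 - c 1) * (c 4 - c 2) * (c 4 - c 3) * p 1 4 * p 2 4 * q 1 5 6,
    (c 5 - c 1) * (c 5 - c 2) * (c 5 - c 3) * (c 5 - c 4) * p 1 5 * q 1 4 6,
    (c 6 - c 1) * (c 6 - c 2) * (c 6 - c 3) * (c 6 - c 4) * (c 6 - c 5) * p 1 6]

end ExtraCase

namespace SimpsonType

/-- The set `S(α, β, γ)` for a triple of Simpson's list. -/
def S (t : SimpsonType) : Set (TripleSpace t.dim) := spectraSet t.typeA t.typeB t.typeC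

/-- The distinct eigenvalues `a_1, a_2` of `A`. -/
def eigA (t : SimpsonType) (s : TripleSpace t.dim) : ℕ → ℂ := blockValue t.typeA s.1

/-- The distinct eigenvalues `b_1, b_2, …` of `B`. -/
def eigB (t : SimpsonType) (s : TripleSpace t.dim) : ℕ → ℂ := blockValue t.typeB s.2.1

/-- The distinct eigenvalues `c_1, c_2, …` of `C`. -/
def eigC (t : SimpsonType) (s : TripleSpace t.dim) : ℕ → ℂ := blockValue t.typeC s.2.2

/-- The matrix `B` as a function of the distinct eigenvalues. -/
def explicitB : (t : SimpsonType) → (a b c : ℕ → ℂ) → Matrix (Fin t.dim) (Fin t.dim) ℂ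
  | hypergeometric m _, a, b, c => oneBased m (Hypergeometric.entryB m a b c)
  | even m _, a, b, c => oneBased (2 * m) (EvenFamily.entryB m a b c)
  | odd m _, a, b, c => oneBased (2 * m + 1) (OddFamily.entryB m a b c)
  | extra, a, b, c => ExtraCase.matB a b c

/-- The matrix `C` as a function of the distinct eigenvalues. -/
def explicitC : (t : SimpsonType) → (a b c : ℕ → ℂ) → Matrix (Fin t.dim) (Fin t.dim) ℂ
  | hypergeometric m _, a, b, c => oneBased m (Hypergeometric.entryC m a b c)
  | even m _, a, b, c => oneBased (2 * m) (EvenFamily.entryC m a b c)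
  | odd m _, a, b, c => oneBased (2 * m + 1) (OddFamily.entryC m a b c)
  | extra, a, b, c => ExtraCase.matC a b c

/-- The numerators of the numbers `⟨v_i, v_i⟩` as functions of the distinct eigenvalues. -/
def explicitNum : (t : SimpsonType) → (a b c : ℕ → ℂ) → Fin t.dim → ℂ
  | hypergeometric m _, a, b, c => fun i : Fin m => Hypergeometric.num m a b c (i + 1)
  | even m _, a, b, c => fun i : Fin (2 * m) => EvenFamily.num m a b c (i + 1)
  | odd m _, a, b, c => fun i : Fin (2 * m + 1) => OddFamily.num m a b c (i + 1)
  | extra, a, b, c => ExtraCase.num a b c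

/-- The denominators of the numbers `⟨v_i, v_i⟩` as functions of the distinct eigenvalues. -/
def explicitDen : (t : SimpsonType) → (a b c : ℕ → ℂ) → Fin t.dim → ℂ
  | hypergeometric m _, a, b, c => fun i : Fin m => Hypergeometric.den m a b c (i + 1)
  | even m _, a, b, c => fun i : Fin (2 * m) => EvenFamily.den m a b c (i + 1)
  | odd m _, a, b, c => fun i : Fin (2 * m + 1) => OddFamily.den m a b c (i + 1)
  | extra, a, b, c => ExtraCase.den a b c

/-- The matrix `B`. -/
def matB (t : SimpsonType) (s : TripleSpace t.dim) : Matrix (Fin t.dim) (Fin t.dim) ℂ :=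
  t.explicitB (t.eigA s) (t.eigB s) (t.eigC s)

/-- The matrix `C`. -/
def matC (t : SimpsonType) (s : TripleSpace t.dim) : Matrix (Fin t.dim) (Fin t.dim) ℂ :=
  t.explicitC (t.eigA s) (t.eigB s) (t.eigC s)

/-- The matrix `A = B + C`. -/
def matA (t : SimpsonType) (s : TripleSpace t.dim) : Matrix (Fin t.dim) (Fin t.dim) ℂ :=
  t.matB s + t.matC s

/-- Numerators of the numbers `⟨v_i, v_i⟩`. -/
def num (t : SimpsonType) (s : TripleSpace t.dim) : Fin t.dim → ℂ :=
  t.explicitNum (t.eigA s) (t.eigB s) (t.eigC s)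

/-- Denominators of the numbers `⟨v_i, v_i⟩`. -/
def den (t : SimpsonType) (s : TripleSpace t.dim) : Fin t.dim → ℂ :=
  t.explicitDen (t.eigA s) (t.eigB s) (t.eigC s)

/-- The set `S'`: no linear form in a denominator of some `⟨v_i, v_i⟩` vanishes. -/
def S' (t : SimpsonType) : Set (TripleSpace t.dim) := {s | s ∈ t.S ∧ ∀ i, t.den s i ≠ 0}

/-- The set `S''`: moreover, no linear form in a numerator of some `⟨v_i, v_i⟩` vanishes. -/
def S'' (t : SimpsonType) : Set (TripleSpace t.dim) := {s | s ∈ t.S' ∧ ∀ i, t.num s i ≠ 0}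

/-- The basis `v_1, …, v_n`. In the hypergeometric family `v_i = (*, …, *, 1, 0, …, 0)`, with `1` in
place `i`, is the eigenvector of `B` with the eigenvalue `b_i`; otherwise
`v_i = (0, …, 0, 1, *, …, *)`, with `1` in place `n + 1 - i`, is the eigenvector of `C` with the
eigenvalue `c_i`. -/
def IsEigenbasis : (t : SimpsonType) → TripleSpace t.dim →
    Module.Basis (Fin t.dim) ℂ (Fin t.dim → ℂ) → Prop
  | hypergeometric m hm, s, v =>
      ∀ i, (hypergeometric m hm).matB s *ᵥ v i = s.2.1 i • v i ∧ v i i = 1 ∧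
        ∀ j, i < j → v i j = 0
  | t, s, v =>
      ∀ i, t.matC s *ᵥ v i = s.2.2 i • v i ∧ v i i.rev = 1 ∧ ∀ j, j < i.rev → v i j = 0

end SimpsonType

/-- The matrix `M` is diagonalizable and its eigenvalues, listed with multiplicities, are
`x 0, x 1, …`. -/
def DiagonalizableWithSpectrum {n : ℕ} (M : Matrix (Fin n) (Fin n) ℂ) (x : Fin n → ℂ) : Prop :=
  ∃ P : Matrix (Fin n) (Fin n) ℂ, IsUnit P ∧ M * P = P * Matrix.diagonal x

/-- The set `T` is obtained from `S` by removing finitely many hyperplanes: the zero levels of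
linear forms, none of which is identically zero on `S`. -/
def RemovesHyperplanes {E : Type*} [AddCommGroup E] [Module ℂ E] (S T : Set E) : Prop :=
  ∃ F : Finset (Module.Dual ℂ E), (∀ f ∈ F, ∃ s ∈ S, f s ≠ 0) ∧
    T = {s | s ∈ S ∧ ∀ f ∈ F, f s ≠ 0}

/-- The set `T` is an open subset of `S` (in the topology of `S`). -/
def IsOpenIn {E : Type*} [TopologicalSpace E] (S T : Set E) : Prop :=
  ∃ U : Set E, IsOpen U ∧ T = S ∩ U

end

/-! `B` is upper and `C` lower triangular, so their spectra and eigenvectors can be written down.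
Two things need an argument: that `A = B + C` has the prescribed spectrum, and that the diagonal
form makes all three matrices self-adjoint. For the spectrum it suffices that `(A - a_1)(A - a_2) =
0` with `a_1 ≠ a_2`; the multiplicities then follow from the trace condition
(`DiagonalizableWithSpectrum.of_quadratic`). For the form, let `V` have the eigenbasis as columns
and let `W` be its inverse; a matrix `M` is self-adjoint if and only if `l_i (W M V)_{ij} = l_j (W M
V)_{ji}`. One of `B`, `C` is diagonal in the eigenbasis, so one further matrix has to be checked,
and its off-diagonal part is governed by a matrix of rank one or two.

Hypergeometric family: `A - a_2` has constant rows, hence is a product `r 1ᵀ`. In the eigenbasis of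
`B` it becomes `(W r)(1ᵀ V)`, and both factors are explicit products, because triangular matrices
with constant rows lead to first-order recursions (`ConstantRows`). The numbers `l_i` are the
quotients `(1ᵀ V)_i / (W r)_i` (`Hypergeometric.num_mul_headSum`).

Even and odd families: both are members of one family of block matrices with Cauchy entries `F_x G_y
/ (u_x + w_y + σ)`, whose coefficients are residues of a rational function. The quadratic relation
for `A` reduces to Lagrange interpolation sums (`IsResidue`, `CauchyData.IsGeneric.quadratic`).
Moreover `(B - b_2)(B - b_3)` has a single non-zero row `η`. Together the two relations yield an
equation for `A C + C A`, linear in `A` (`CauchyData.IsGeneric.anticommutator`). In the eigenbasis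
of `C` it says that the `(i, j)` entry of `A`, multiplied by `c_i + c_j + σ`, is minus the product
of the last coordinate of the `i`-th left eigenvector and the `j`-th entry of `η V`, for `i ≠ j`.
Hence `l_i` is the quotient of the latter by the former, and partial fractions turn both into
products. This argument divides by the forms `q_{ij}`. Along the line `c_k + t`, `b_1 - n t` the
trace and the differences of the `c_k` stay fixed while `q_{ij}` moves by `2 t`, so the general case
follows by continuity at `t = 0`.

Extra case: `A - a_1 = diagonal w * P`, where `P` depends only on the `c_k` and factors through each
of the three diagonal blocks, so it has rank two. A two-by-two symmetric matrix then plays the role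
that the scalar quotient plays in rank one (`ThreeBlocks.conj_symm`).

The sets `S'` and `S''` are complements of zero sets of products of linear forms; one explicit point
of `S` where no factor vanishes shows that none of the forms is identically zero on `S`. -/

noncomputable section

/-! ### Diagonalization, eigenvectors of graded triangular matrices, invariant forms. -/

variable {n : ℕ} {ι : Type*} [Fintype ι] [DecidableEq ι]

theorem DiagonalizableWithSpectrum.of_basis {M : Matrix (Fin n) (Fin n) ℂ} {x : Fin n → ℂ}
    (b : Module.Basis (Fin n) ℂ (Fin n → ℂ)) (h : ∀ i, M *ᵥ b i = x i • b i) :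
    DiagonalizableWithSpectrum M x := by
  refine ⟨(Pi.basisFun ℂ (Fin n)).toMatrix b, ?_, ?_⟩
  · have := (Pi.basisFun ℂ (Fin n)).invertibleToMatrix b
    exact isUnit_of_invertible _
  · ext i j
    have := congrFun (h j) i
    simp only [Matrix.mulVec, dotProduct, Pi.smul_apply, smul_eq_mul] at this
    rw [Matrix.mul_diagonal]
    simp only [Matrix.mul_apply]
    simp only [Module.Basis.toMatrix_apply, Pi.basisFun_repr]
    rw [this, mul_comm]

theorem DiagonalizableWithSpectrum.of_inverse {M V W : Matrix (Fin n) (Fin n) ℂ} {x : Fin n → ℂ}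
    (hWV : W * V = 1) (h : M * V = V * Matrix.diagonal x) :
    DiagonalizableWithSpectrum M x :=
  ⟨V, (Matrix.isUnit_iff_isUnit_det _).2 (Matrix.isUnit_det_of_left_inverse hWV), h⟩

/-- `E = (M - a') / (a - a')` is idempotent, and its range and kernel are the eigenspaces for `a`
and `a'`. The trace of an idempotent is its rank, so the trace hypothesis makes the dimension of the
range equal to the number of indices with `x i = a`. -/
theorem DiagonalizableWithSpectrum.of_quadratic {M : Matrix (Fin n) (Fin n) ℂ} {x : Fin n → ℂ}
    {a a' : ℂ} (haa : a ≠ a') (hx : ∀ i, x i = a ∨ x i = a') (htr : M.trace = ∑ i, x i)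
    (hM : (M - a • (1 : Matrix (Fin n) (Fin n) ℂ)) * (M - a' • (1 : Matrix (Fin n) (Fin n) ℂ)) = 0) :
    DiagonalizableWithSpectrum M x := by
  classical
  have hd : a - a' ≠ 0 := sub_ne_zero.2 haa
  set E : Matrix (Fin n) (Fin n) ℂ := (a - a')⁻¹ • (M - a' • 1) with hE
  have hM2 : M * M = (a + a') • M - (a * a') • 1 := by
    have : M * M - (a + a') • M + (a * a') • (1 : Matrix (Fin n) (Fin n) ℂ) = 0 := by
      rw [← hM]
      simp only [sub_mul, mul_sub, Matrix.smul_mul, Matrix.mul_smul, mul_one, one_mul, smul_smul,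
        add_smul]
      module
    rw [← sub_eq_zero, ← this]
    abel
  have hME : M * E = a • E := by
    simp only [hE, Matrix.mul_smul, mul_sub, hM2, mul_one]
    simp only [smul_sub, smul_smul, add_smul]
    module
  have hEM : M = a' • 1 + (a - a') • E := by
    rw [hE, smul_smul, mul_inv_cancel₀ hd]
    module
  have hEE : E * E = E := by
    have h1 : (a - a') • (E * E) = (a - a') • E := by
      have : M * E = a' • E + (a - a') • (E * E) := by
        conv_lhs => rw [hEM]
        simp [add_mul]
      rw [hME] at this
      rw [sub_smul a a' E, this]
      abel
    exact smul_right_injective _ hd h1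
  set f := Matrix.toLin' E with hf
  have hid : IsIdempotentElem f := by
    change f * f = f
    rw [hf, Module.End.mul_eq_comp, ← Matrix.toLin'_mul, hEE]
  have hcompl := LinearMap.IsIdempotentElem.isCompl hid
  have htrf := (LinearMap.IsIdempotentElem.isProj_range f hid).trace
  rw [hf, Matrix.trace_toLin'_eq] at htrf
  set s := Finset.univ.filter (fun i => x i = a) with hs
  have hsum : ∑ i, x i = n * a' + (a - a') * s.card := by
    have : ∀ i, x i = a' + (a - a') * (if x i = a then 1 else 0) := by
      intro i
      rcases hx i with h | h
      · rw [h]; simp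
      · rw [h]; simp [haa.symm]
    rw [Finset.sum_congr rfl (fun i _ => this i), Finset.sum_add_distrib, ← Finset.mul_sum]
    simp [hs]
  -- Both traces have the form `n a' + (a - a') * _`, with the rank of `E` in one and the
  -- cardinality of `s` in the other.
  have hcard : Module.finrank ℂ (LinearMap.range f) = s.card := by
    have h1 : M.trace = n * a' + (a - a') * E.trace := by
      conv_lhs => rw [hEM]
      simp [Matrix.trace_add, Matrix.trace_smul, mul_comm]
    rw [htr, hsum, htrf] at h1
    exact_mod_cast (mul_left_cancel₀ hd (add_left_cancel h1)).symm
  have hcard' : Module.finrank ℂ (LinearMap.ker f) + s.card = n := by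
    have := Submodule.finrank_add_eq_of_isCompl hcompl
    rw [hcard] at this
    simpa [add_comm] using this
  have e1 : Fin (Module.finrank ℂ (LinearMap.range f)) ≃ {i // x i = a} :=
    Fintype.equivOfCardEq (by rw [Fintype.card_fin, hcard, Fintype.card_subtype])
  have e2 : Fin (Module.finrank ℂ (LinearMap.ker f)) ≃ {i // ¬ x i = a} :=
    Fintype.equivOfCardEq (by
      rw [Fintype.card_fin, Fintype.card_subtype_compl, Fintype.card_subtype, Fintype.card_fin]
      exact Nat.eq_sub_of_add_eq (by convert hcard'))
  -- A basis of the range together with one of the kernel, numbered so that `b i` lies in the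
  -- eigenspace of `x i`.
  let b := ((((Module.finBasis ℂ (LinearMap.range f)).reindex e1).prod
    ((Module.finBasis ℂ (LinearMap.ker f)).reindex e2)).map
    (Submodule.prodEquivOfIsCompl _ _ hcompl)).reindex (Equiv.sumCompl (fun i => x i = a))
  refine DiagonalizableWithSpectrum.of_basis b fun i => ?_
  have key : ∀ v, M *ᵥ v = a' • v + (a - a') • f v := by
    intro v
    conv_lhs => rw [hEM]
    rw [Matrix.add_mulVec, Matrix.smul_mulVec, Matrix.smul_mulVec, Matrix.one_mulVec, hf,
      Matrix.toLin'_apply]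
  obtain ⟨j, rfl⟩ := (Equiv.sumCompl (fun i => x i = a)).surjective i
  rcases j with j | j
  · have hb : f (b (Equiv.sumCompl (fun i => x i = a) (Sum.inl j))) =
        b (Equiv.sumCompl (fun i => x i = a) (Sum.inl j)) := by
      apply (LinearMap.IsIdempotentElem.mem_range_iff hid).1
      simp [b]
    rw [key, hb, Equiv.sumCompl_apply_inl, j.2]
    module
  · have hb : f (b (Equiv.sumCompl (fun i => x i = a) (Sum.inr j))) = 0 := by
      rw [← LinearMap.mem_ker]
      simp only [b, Module.Basis.reindex_apply, Equiv.symm_apply_apply, Module.Basis.map_apply,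
        Module.Basis.prod_apply, Sum.elim_inr, Function.comp, LinearMap.coe_inr,
        Submodule.coe_prodEquivOfIsCompl', ZeroMemClass.coe_zero, zero_add]
      exact Subtype.coe_prop _
    rw [key, hb, Equiv.sumCompl_apply_inr, (hx j.1).resolve_left j.2]
    simp

theorem DiagonalizableWithSpectrum.trace_eq {M : Matrix (Fin n) (Fin n) ℂ} {x : Fin n → ℂ}
    (h : DiagonalizableWithSpectrum M x) : M.trace = ∑ i, x i := by
  obtain ⟨P, hP, h⟩ := h
  obtain ⟨Q, hQ⟩ := hP.exists_left_inv
  have : M = P * (Matrix.diagonal x * Q) := by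
    rw [← Matrix.mul_assoc, ← h, Matrix.mul_assoc, mul_eq_one_comm.1 hQ, mul_one]
  rw [this, Matrix.trace_mul_comm, Matrix.mul_assoc, hQ, mul_one, Matrix.trace_diagonal]

/-- Right eigenvectors of `diagonal x + N`, where `N` is strictly triangular for a grading with
three levels. -/
def rightEigenvectors (x : ι → ℂ) (N : Matrix ι ι ℂ) : Matrix ι ι ℂ :=
  Matrix.of fun i j => (if i = j then 1 else 0) + N i j / (x j - x i) +
    ∑ k, N i k * N k j / ((x j - x i) * (x j - x k))

/-- Left eigenvectors of `diagonal x + N`, where `N` is strictly triangular for a grading with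
three levels. -/
def leftEigenvectors (x : ι → ℂ) (N : Matrix ι ι ℂ) : Matrix ι ι ℂ :=
  Matrix.of fun i j => (if i = j then 1 else 0) + N i j / (x i - x j) +
    ∑ k, N i k * N k j / ((x i - x k) * (x i - x j))

theorem rightEigenvectors_apply_eq_ite {x : ι → ℂ} {N : Matrix ι ι ℂ} {lev : ι → ℕ}
    (hN : ∀ i j, ¬ lev i < lev j → N i j = 0) {i j : ι} (h : ¬ lev i < lev j) :
    rightEigenvectors x N i j = if i = j then 1 else 0 := by
  have : ∀ k, N i k * N k j = 0 := by
    intro k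
    by_cases h1 : lev i < lev k
    · rw [hN k j (by omega), mul_zero]
    · rw [hN i k h1, zero_mul]
  simp [rightEigenvectors, hN i j h, this]

theorem leftEigenvectors_apply_eq_ite {x : ι → ℂ} {N : Matrix ι ι ℂ} {lev : ι → ℕ}
    (hN : ∀ i j, ¬ lev i < lev j → N i j = 0) {i j : ι} (h : ¬ lev i < lev j) :
    leftEigenvectors x N i j = if i = j then 1 else 0 := by
  have : ∀ k, N i k * N k j = 0 := by
    intro k
    by_cases h1 : lev i < lev k
    · rw [hN k j (by omega), mul_zero]
    · rw [hN i k h1, zero_mul]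
  simp [leftEigenvectors, hN i j h, this]

/-- Three strict increases of the level would need four levels. -/
theorem mul_mul_eq_zero_of_three_levels {κ : Type*} {N : Matrix κ κ ℂ} {lev : κ → ℕ}
    (hN : ∀ i j, ¬ lev i < lev j → N i j = 0) (hlev : ∀ i, lev i ≤ 2) (i j k l : κ) :
    N i j * (N j k * N k l) = 0 := by
  by_cases h1 : lev i < lev j
  · by_cases h2 : lev j < lev k
    · have := hlev k
      have := hlev l
      rw [hN k l (by omega)]; simp
    · rw [hN j k h2]; simp
  · rw [hN i j h1]; simp

/-- `rightEigenvectors` is the perturbation series of the eigenvectors, a sum over paths through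
`N`. Paths of length three do not exist, so the series stops after the second order. Eigenvalues may
coincide within a level, since `N` does not connect indices of the same level. -/
theorem mul_rightEigenvectors {x : ι → ℂ} {N : Matrix ι ι ℂ} {lev : ι → ℕ}
    (hN : ∀ i j, ¬ lev i < lev j → N i j = 0) (hlev : ∀ i, lev i ≤ 2)
    (hx : ∀ i j, lev i < lev j → x i ≠ x j) :
    (Matrix.diagonal x + N) * rightEigenvectors x N =
      rightEigenvectors x N * Matrix.diagonal x := by
  ext i j
  rw [add_mul, Matrix.add_apply, Matrix.diagonal_mul, Matrix.mul_diagonal, Matrix.mul_apply]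
  by_cases h : lev i < lev j
  · have h1 : x j - x i ≠ 0 := sub_ne_zero.2 (hx i j h).symm
    have hij : i ≠ j := by rintro rfl; omega
    have h3 : ∀ k, N i k * rightEigenvectors x N k j =
        (if k = j then N i j else 0) + N i k * N k j / (x j - x k) := by
      intro k
      simp only [rightEigenvectors, Matrix.of_apply, mul_add, Finset.mul_sum]
      rw [Finset.sum_eq_zero (fun l _ => ?_)]
      · split_ifs with h
        · subst h; ring
        · ring
      · rw [← mul_div_assoc, mul_mul_eq_zero_of_three_levels hN hlev, zero_div]
    simp only [h3, Finset.sum_add_distrib]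
    simp only [rightEigenvectors, Matrix.of_apply, if_neg hij, Finset.sum_ite_eq',
      Finset.mem_univ, if_true, zero_add]
    have h4 : ∑ k, N i k * N k j / ((x j - x i) * (x j - x k)) =
        (∑ k, N i k * N k j / (x j - x k)) / (x j - x i) := by
      rw [Finset.sum_div]
      refine Finset.sum_congr rfl fun k _ => ?_
      rw [div_div, mul_comm (x j - x k)]
    rw [h4]
    field_simp
    ring
  · rw [rightEigenvectors_apply_eq_ite hN h, Finset.sum_eq_zero, add_zero]
    · split_ifs with h
      · subst h; ring
      · ring
    · intro k _
      by_cases h1 : lev i < lev k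
      · rw [rightEigenvectors_apply_eq_ite hN (by omega), if_neg (by rintro rfl; omega), mul_zero]
      · rw [hN i k h1, zero_mul]

theorem leftEigenvectors_mul {x : ι → ℂ} {N : Matrix ι ι ℂ} {lev : ι → ℕ}
    (hN : ∀ i j, ¬ lev i < lev j → N i j = 0) (hlev : ∀ i, lev i ≤ 2)
    (hx : ∀ i j, lev i < lev j → x i ≠ x j) :
    leftEigenvectors x N * (Matrix.diagonal x + N) =
      Matrix.diagonal x * leftEigenvectors x N := by
  -- Transposition exchanges left and right eigenvectors and reverses the grading, hence the levels
  -- `2 - lev i` below.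
  have key : leftEigenvectors x N = (rightEigenvectors x Nᵀ)ᵀ := by
    ext i j
    simp only [leftEigenvectors, rightEigenvectors, Matrix.of_apply, Matrix.transpose_apply,
      eq_comm (a := i)]
    congr 1
    refine Finset.sum_congr rfl fun k _ => ?_
    rw [mul_comm (N i k), mul_comm (x i - x k)]
  have h := mul_rightEigenvectors (x := x) (N := Nᵀ) (lev := fun i => 2 - lev i)
    (fun i j hij => hN j i (by have := hlev i; have := hlev j; omega)) (fun i => by omega)
    (fun i j hij => (hx j i (by have := hlev i; have := hlev j; omega)).symm)
  have h2 := congrArg Matrix.transpose h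
  rwa [Matrix.transpose_mul, Matrix.transpose_mul, Matrix.transpose_add, Matrix.diagonal_transpose,
    Matrix.transpose_transpose, ← key] at h2

/-- `W * V` commutes with `diagonal x`, so it has no entries between different eigenvalues, in
particular none where the level rises. At the remaining entries both factors look like the identity.
-/
theorem leftEigenvectors_mul_rightEigenvectors {x : ι → ℂ} {N : Matrix ι ι ℂ} {lev : ι → ℕ}
    (hN : ∀ i j, ¬ lev i < lev j → N i j = 0) (hlev : ∀ i, lev i ≤ 2)
    (hx : ∀ i j, lev i < lev j → x i ≠ x j) :
    leftEigenvectors x N * rightEigenvectors x N = 1 := by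
  set W := leftEigenvectors x N with hW
  set V := rightEigenvectors x N with hV
  ext i j
  by_cases h : lev i < lev j
  · have h1 : x i * (W * V) i j = (W * V) i j * x j := by
      rw [← Matrix.diagonal_mul, ← Matrix.mul_diagonal, ← Matrix.mul_assoc, Matrix.mul_assoc W,
        ← mul_rightEigenvectors hN hlev hx, ← Matrix.mul_assoc, leftEigenvectors_mul hN hlev hx]
    have h2 : (x i - x j) * (W * V) i j = 0 := by rw [sub_mul, h1]; ring
    rw [(mul_eq_zero.1 h2).resolve_left (sub_ne_zero.2 (hx i j h)), Matrix.one_apply_ne]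
    rintro rfl; omega
  · rw [Matrix.mul_apply, Matrix.one_apply, Finset.sum_eq_single i]
    · rw [hW, hV, leftEigenvectors_apply_eq_ite hN (lt_irrefl _),
        rightEigenvectors_apply_eq_ite hN h]
      simp
    · intro k _ hk
      by_cases h1 : lev i < lev k
      · rw [hV, rightEigenvectors_apply_eq_ite hN (by omega), if_neg (by rintro rfl; omega),
          mul_zero]
      · rw [hW, leftEigenvectors_apply_eq_ite hN h1, if_neg hk.symm, zero_mul]
    · simp

/-- The basis formed by the columns of an invertible matrix. -/
def columnBasis (V W : Matrix (Fin n) (Fin n) ℂ) (h : W * V = 1) :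
    Module.Basis (Fin n) ℂ (Fin n → ℂ) :=
  (Pi.basisFun ℂ (Fin n)).map (Matrix.toLin'OfInv h (mul_eq_one_comm.1 h))

theorem columnBasis_apply (V W : Matrix (Fin n) (Fin n) ℂ) (h : W * V = 1) (i : Fin n) :
    columnBasis V W h i = V.col i := by
  simp [columnBasis, Matrix.toLin'OfInv]

/-- In the basis `v` the Gram matrix is `diagonal l` and the operator `M` has the matrix `W * M *
V`. Self-adjointness is therefore the symmetry of `diagonal l * (W * M * V)`, which the hypotheses
state entry by entry. -/
theorem exists_bilinForm_of_symmetric {A B C V W : Matrix (Fin n) (Fin n) ℂ} (hWV : W * V = 1)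
    (v : Module.Basis (Fin n) ℂ (Fin n → ℂ)) (hv : ∀ i, v i = V.col i) (l : Fin n → ℂ)
    (hA : ∀ i j, l i * (W * A * V) i j = l j * (W * A * V) j i)
    (hB : ∀ i j, l i * (W * B * V) i j = l j * (W * B * V) j i)
    (hC : ∀ i j, l i * (W * C * V) i j = l j * (W * C * V) j i) :
    ∃ Φ : LinearMap.BilinForm ℂ (Fin n → ℂ),
      (∀ i j, Φ (v i) (v j) = if i = j then l i else 0) ∧ Φ.IsSymm ∧
      LinearMap.IsSelfAdjoint Φ (Matrix.toLin' A) ∧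
      LinearMap.IsSelfAdjoint Φ (Matrix.toLin' B) ∧
      LinearMap.IsSelfAdjoint Φ (Matrix.toLin' C) ∧
      ((∃ i, l i ≠ 0) → Φ ≠ 0) ∧ ((∀ i, l i ≠ 0) → Φ.Nondegenerate) := by
  set Φ := Matrix.toBilin v (Matrix.diagonal l) with hΦ
  have hΦv : ∀ i j, Φ (v i) (v j) = if i = j then l i else 0 := by
    intro i j
    rw [← LinearMap.BilinForm.toMatrix_apply v, hΦ, LinearMap.BilinForm.toMatrix_toBilin,
      Matrix.diagonal_apply]
  have hadj : ∀ M : Matrix (Fin n) (Fin n) ℂ,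
      (∀ i j, l i * (W * M * V) i j = l j * (W * M * V) j i) →
      LinearMap.IsSelfAdjoint Φ (Matrix.toLin' M) := by
    intro M hM
    have hMv : ∀ i, Matrix.toLin' M (v i) = ∑ k, (W * M * V) k i • v k := by
      intro i
      have hVW : V * W = 1 := mul_eq_one_comm.1 hWV
      ext p
      have h1 : (V * (W * M * V)) p i = (M * V) p i := by
        rw [Matrix.mul_assoc W, ← Matrix.mul_assoc, hVW, one_mul]
      rw [hv, Matrix.toLin'_apply, Finset.sum_apply]
      simp only [hv, Pi.smul_apply, Matrix.col_apply, smul_eq_mul]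
      rw [Matrix.mul_apply] at h1
      simp only [mul_comm (V p _)] at h1
      rw [h1]
      rfl
    have : LinearMap.comp Φ (Matrix.toLin' M) = LinearMap.compl₂ Φ (Matrix.toLin' M) := by
      refine v.ext fun i => v.ext fun j => ?_
      rw [LinearMap.comp_apply, LinearMap.compl₂_apply, hMv, hMv]
      simp only [map_sum, LinearMap.sum_apply, map_smul, LinearMap.smul_apply, hΦv, smul_eq_mul,
        mul_ite, mul_zero, Finset.sum_ite_eq, Finset.sum_ite_eq', Finset.mem_univ, if_true]
      rw [mul_comm, ← hM i j, mul_comm]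
    intro x y
    exact LinearMap.congr_fun₂ this x y
  refine ⟨Φ, hΦv, ?_, hadj A hA, hadj B hB, hadj C hC, ?_, ?_⟩
  · rw [hΦ, Matrix.isSymm_toBilin_iff_isSymm]
    exact Matrix.diagonal_transpose l
  · rintro ⟨i, hi⟩ h0
    apply hi
    rw [← (hΦv i i).trans (if_pos rfl), h0]
    simp
  · intro h
    rw [LinearMap.BilinForm.nondegenerate_iff_det_ne_zero v, hΦ,
      LinearMap.BilinForm.toMatrix_toBilin, Matrix.det_diagonal]
    exact Finset.prod_ne_zero_iff.2 fun i _ => h i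

/-- Eigenvectors for pairwise different eigenvalues are determined by one normalized coordinate. -/
theorem eigenvector_unique {M : Matrix (Fin n) (Fin n) ℂ} {x : Fin n → ℂ}
    (hx : Function.Injective x) (v : Module.Basis (Fin n) ℂ (Fin n → ℂ))
    (hv : ∀ i, M *ᵥ v i = x i • v i) {i : Fin n} {w : Fin n → ℂ} (hw : M *ᵥ w = x i • w)
    {p : Fin n} (hvp : v i p = 1) (hwp : w p = 1) : w = v i := by
  have h1 : ∀ j, j ≠ i → v.repr w j = 0 := by
    intro j hj
    have h2 : v.repr (M *ᵥ w) j = x j * v.repr w j := by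
      conv_lhs => rw [← v.sum_repr w]
      simp only [← Matrix.mulVecLin_apply, map_sum, map_smul]
      simp only [Matrix.mulVecLin_apply, hv, map_smul, Finsupp.coe_finsetSum, Finset.sum_apply,
        Finsupp.smul_apply, Module.Basis.repr_self, smul_eq_mul]
      rw [Finset.sum_eq_single j]
      · simp [mul_comm]
      · intro k _ hk
        simp [hk]
      · simp
    rw [hw, map_smul, Finsupp.smul_apply, smul_eq_mul] at h2
    have h3 : (x i - x j) * v.repr w j = 0 := by rw [sub_mul, h2]; ring
    exact (mul_eq_zero.1 h3).resolve_left (sub_ne_zero.2 fun h => hj (hx h).symm)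
  have h4 : w = v.repr w i • v i := by
    conv_lhs => rw [← v.sum_repr w]
    exact Finset.sum_eq_single i (fun j _ hj => by rw [h1 j hj, zero_smul]) (by simp)
  have h5 := congrFun h4 p
  rw [hwp, Pi.smul_apply, hvp, smul_eq_mul, mul_one] at h5
  rw [h4, ← h5, one_smul]

end

noncomputable section

/-! ### Hyperplane complements -/

section Hyperplanes

variable {E : Type*} [AddCommGroup E] [Module ℂ E]

/-- The function is the restriction of a linear functional. -/
def IsLinearForm (g : E → ℂ) : Prop := ∃ f : Module.Dual ℂ E, ∀ s, g s = f s

theorem IsLinearForm.add {g h : E → ℂ} (hg : IsLinearForm g) (hh : IsLinearForm h) :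
    IsLinearForm fun s => g s + h s := by
  obtain ⟨f, hf⟩ := hg
  obtain ⟨f', hf'⟩ := hh
  exact ⟨f + f', fun s => by simp [hf, hf']⟩

theorem IsLinearForm.sub {g h : E → ℂ} (hg : IsLinearForm g) (hh : IsLinearForm h) :
    IsLinearForm fun s => g s - h s := by
  obtain ⟨f, hf⟩ := hg
  obtain ⟨f', hf'⟩ := hh
  exact ⟨f - f', fun s => by simp [hf, hf']⟩

theorem IsLinearForm.const_mul {g : E → ℂ} (hg : IsLinearForm g) (r : ℂ) :
    IsLinearForm fun s => r * g s := by
  obtain ⟨f, hf⟩ := hg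
  exact ⟨r • f, fun s => by simp [hf]⟩

theorem IsLinearForm.sum {κ : Type*} (T : Finset κ) {g : κ → E → ℂ}
    (hg : ∀ k, IsLinearForm (g k)) : IsLinearForm fun s => ∑ k ∈ T, g k s := by
  choose f hf using hg
  exact ⟨∑ k ∈ T, f k, fun s => by simp [hf]⟩

/-- The zero set of the function is a finite union of zero sets of linear functionals. -/
def VanishesOnHyperplanes (g : E → ℂ) : Prop :=
  ∃ F : Finset (Module.Dual ℂ E), ∀ s, g s = 0 ↔ ∃ f ∈ F, f s = 0

theorem IsLinearForm.vanishesOnHyperplanes {g : E → ℂ} (hg : IsLinearForm g) :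
    VanishesOnHyperplanes g := by
  obtain ⟨f, hf⟩ := hg
  exact ⟨{f}, fun s => by simp [hf]⟩

theorem VanishesOnHyperplanes.mul {g h : E → ℂ} (hg : VanishesOnHyperplanes g)
    (hh : VanishesOnHyperplanes h) : VanishesOnHyperplanes fun s => g s * h s := by
  classical
  obtain ⟨F, hF⟩ := hg
  obtain ⟨F', hF'⟩ := hh
  exact ⟨F ∪ F', fun s => by simp [hF, hF', or_and_right, exists_or]⟩

theorem VanishesOnHyperplanes.neg {g : E → ℂ} (hg : VanishesOnHyperplanes g) :
    VanishesOnHyperplanes fun s => -g s := by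
  obtain ⟨F, hF⟩ := hg
  exact ⟨F, fun s => by simp [hF]⟩

theorem VanishesOnHyperplanes.one : VanishesOnHyperplanes fun _ : E => 1 :=
  ⟨∅, fun s => by simp⟩

theorem VanishesOnHyperplanes.prod {κ : Type*} (T : Finset κ) {g : κ → E → ℂ}
    (hg : ∀ k, VanishesOnHyperplanes (g k)) :
    VanishesOnHyperplanes fun s => ∏ k ∈ T, g k s := by
  classical
  choose F hF using hg
  exact ⟨T.biUnion F, fun s => by simp only [Finset.prod_eq_zero_iff, hF, Finset.mem_biUnion]; tauto⟩

/-- A single point `s₀` at which no `g k` vanishes witnesses for all the linear forms at once that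
they are not identically zero on `S`. -/
theorem removesHyperplanes_of_vanishesOnHyperplanes {κ : Type*} [Fintype κ] {S : Set E}
    {g : κ → E → ℂ} (hg : ∀ k, VanishesOnHyperplanes (g k)) {s₀ : E} (hs₀ : s₀ ∈ S)
    (h₀ : ∀ k, g k s₀ ≠ 0) : RemovesHyperplanes S {s | s ∈ S ∧ ∀ k, g k s ≠ 0} := by
  classical
  choose F hF using hg
  refine ⟨Finset.univ.biUnion F, ?_, ?_⟩
  · intro f hf
    obtain ⟨k, -, hk⟩ := Finset.mem_biUnion.1 hf
    exact ⟨s₀, hs₀, fun h => h₀ k ((hF k s₀).2 ⟨f, hk, h⟩)⟩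
  · ext s
    simp only [Set.mem_ofPred_eq, Finset.mem_biUnion, Finset.mem_univ, true_and, ne_eq, hF]
    refine and_congr_right fun _ => ⟨fun h f ⟨k, hk⟩ h' => h k ⟨f, hk, h'⟩,
      fun h k ⟨f, hk, h'⟩ => h f ⟨k, hk⟩ h'⟩

theorem RemovesHyperplanes.isOpenIn {n : ℕ} {S T : Set (TripleSpace n)}
    (h : RemovesHyperplanes S T) : IsOpenIn S T := by
  obtain ⟨F, -, rfl⟩ := h
  refine ⟨⋂ f ∈ F, {s | f s ≠ 0}, ?_, ?_⟩
  · refine isOpen_biInter_finset fun f _ => ?_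
    exact isOpen_ne_fun (LinearMap.continuous_of_finiteDimensional f) continuous_const
  · ext s
    simp

/-- Outside `1 ≤ k ≤ n` the coordinate is the zero form, which is linear too; so no bounds on the
index have to be carried along. -/
theorem isLinearForm_coord {n : ℕ} {f : E →ₗ[ℂ] (Fin n → ℂ)} (k : ℕ) :
    IsLinearForm fun s => coord (f s) k := by
  by_cases h : 1 ≤ k ∧ k ≤ n
  · exact ⟨LinearMap.proj ⟨k - 1, by omega⟩ ∘ₗ f, fun s => by simp [coord, h]⟩
  · exact ⟨0, fun s => by simp [coord, h]⟩

end Hyperplanes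

theorem SimpsonType.isLinearForm_eigA (t : SimpsonType) (k : ℕ) :
    IsLinearForm fun s => t.eigA s k :=
  isLinearForm_coord (f := LinearMap.fst ℂ (Fin t.dim → ℂ) ((Fin t.dim → ℂ) × (Fin t.dim → ℂ)))
    (t.typeA.sizeUpTo (k - 1) + 1)

theorem SimpsonType.isLinearForm_eigB (t : SimpsonType) (k : ℕ) :
    IsLinearForm fun s => t.eigB s k :=
  isLinearForm_coord (f := LinearMap.fst ℂ (Fin t.dim → ℂ) (Fin t.dim → ℂ) ∘ₗ
    LinearMap.snd ℂ (Fin t.dim → ℂ) ((Fin t.dim → ℂ) × (Fin t.dim → ℂ)))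
    (t.typeB.sizeUpTo (k - 1) + 1)

theorem SimpsonType.isLinearForm_eigC (t : SimpsonType) (k : ℕ) :
    IsLinearForm fun s => t.eigC s k :=
  isLinearForm_coord (f := LinearMap.snd ℂ (Fin t.dim → ℂ) (Fin t.dim → ℂ) ∘ₗ
    LinearMap.snd ℂ (Fin t.dim → ℂ) ((Fin t.dim → ℂ) × (Fin t.dim → ℂ)))
    (t.typeC.sizeUpTo (k - 1) + 1)

/-! ### Spectral types -/

section SpectralTypes

variable {n : ℕ} {α : Composition n} {x : Fin n → ℂ}

theorem Composition.index_eq_of_sizeUpTo {k : ℕ} {i : Fin n} (h1 : α.sizeUpTo k ≤ i)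
    (h2 : (i : ℕ) < α.sizeUpTo (k + 1)) : (α.index i : ℕ) = k := by
  have h3 := α.lt_sizeUpTo_index_succ i
  have h4 := α.sizeUpTo_index_le i
  rcases lt_trichotomy (α.index i : ℕ) k with h | h | h
  · have := α.monotone_sizeUpTo (show ((α.index i).succ : ℕ) ≤ k by simp; omega)
    omega
  · exact h
  · have := α.monotone_sizeUpTo (show k + 1 ≤ (α.index i : ℕ) by omega)
    omega

theorem blockValue_comp_index (f : ℕ → ℂ) {k : ℕ} (hk : k < α.length) :
    blockValue α (fun i => f (α.index i)) (k + 1) = f k := by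
  have h1 := α.sizeUpTo_strict_mono hk
  have h2 := α.sizeUpTo_le (k + 1)
  rw [blockValue, coord, dif_pos (by simp; omega)]
  congr 1
  apply Composition.index_eq_of_sizeUpTo <;> simp [h1]

theorem hasSpectralType_comp_index {f : ℕ → ℂ} (hf : Set.InjOn f (Set.Iio α.length)) :
    HasSpectralType α (fun i => f (α.index i)) := fun i j =>
  (hf.eq_iff (α.index i).2 (α.index j).2).trans Fin.ext_iff.symm

theorem HasSpectralType.eq_comp_index (h : HasSpectralType α x) :
    x = fun i => blockValue α x (α.index i + 1) := by
  funext i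
  have h1 := α.sizeUpTo_strict_mono (α.index i).2
  have h2 := α.sizeUpTo_le (α.index i + 1)
  rw [blockValue, coord, dif_pos (by simp; omega), h]
  refine Fin.ext ?_
  symm
  apply Composition.index_eq_of_sizeUpTo <;> simp [h1]

theorem HasSpectralType.blockValue_ne (h : HasSpectralType α x) {k l : ℕ} (hk : k < α.length)
    (hl : l < α.length) (hkl : k ≠ l) : blockValue α x (k + 1) ≠ blockValue α x (l + 1) := by
  have aux : ∀ {k : ℕ} (hk : k < α.length), ∃ i, (α.index i : ℕ) = k := fun {k} hk =>
    ⟨⟨α.sizeUpTo k, by have := α.sizeUpTo_strict_mono hk; have := α.sizeUpTo_le (k + 1); omega⟩,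
      Composition.index_eq_of_sizeUpTo le_rfl (α.sizeUpTo_strict_mono hk)⟩
  obtain ⟨i, rfl⟩ := aux hk
  obtain ⟨j, rfl⟩ := aux hl
  have h1 : x i = blockValue α x (α.index i + 1) := congrFun h.eq_comp_index i
  have h2 : x j = blockValue α x (α.index j + 1) := congrFun h.eq_comp_index j
  rw [← h1, ← h2, Ne, h]
  exact fun h => hkl (by rw [h])

theorem sum_comp_index (f : ℕ → ℂ) :
    ∑ i, f (α.index i) = ∑ k ∈ Finset.range α.length, (α.blocks.getD k 0 : ℂ) * f k := by
  rw [Finset.sum_range, ← α.blocksFinEquiv.sum_comp, Fintype.sum_sigma]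
  refine Finset.sum_congr rfl fun k _ => ?_
  have : ∀ j, (α.index (α.blocksFinEquiv ⟨k, j⟩) : ℕ) = k := fun j => by
    exact congrArg Fin.val (α.index_embedding k j)
  simp only [this, Finset.sum_const, Finset.card_univ, Fintype.card_fin, nsmul_eq_mul]
  congr 2
  have hk : (k : ℕ) < α.blocks.length := k.2
  rw [List.getD_eq_getElem _ _ hk]
  rfl

theorem index_ones (i : Fin n) : ((Composition.ones n).index i : ℕ) = i := by
  apply Composition.index_eq_of_sizeUpTo <;> simp [Composition.ones_sizeUpTo]

theorem blockValue_ones (i : Fin n) : blockValue (Composition.ones n) x (i + 1) = x i := by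
  simp [blockValue, coord, Composition.ones_sizeUpTo]

theorem hasSpectralType_ones_iff :
    HasSpectralType (Composition.ones n) x ↔ Function.Injective x := by
  simp only [HasSpectralType, Fin.ext_iff, index_ones, Function.Injective]
  exact ⟨fun h i j hij => (h i j).1 hij, fun h i j => ⟨fun hij => h hij, fun hij => by
    rw [Fin.ext hij]⟩⟩

theorem sum_fin_succ_eq_sum_Icc (g : ℕ → ℂ) : ∑ i : Fin n, g (i + 1) = ∑ k ∈ Finset.Icc 1 n, g k := by
  rw [← Finset.sum_range fun i => g (i + 1), Finset.range_eq_Ico, Finset.sum_Ico_add' g 0 n 1]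
  exact Finset.sum_congr (by ext; simp) fun _ _ => rfl

theorem sum_eq_sum_blockValue_ones :
    ∑ i, x i = ∑ k ∈ Finset.Icc 1 n, blockValue (Composition.ones n) x k := by
  rw [← sum_fin_succ_eq_sum_Icc]
  exact Finset.sum_congr rfl fun i _ => (blockValue_ones i).symm

end SpectralTypes

end

/-! ### Eigenvalues and trace condition for the four types. -/

noncomputable section

namespace SimpsonType

/-- Source of the points that witness the non-vanishing of linear forms on `S`. The distinct
eigenvalues are listed from `0` here but from `1` in `eigA`, `eigB`, `eigC`; `blocks.getD k 0` is
the multiplicity of the `k`-th one. -/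
theorem exists_mem_S (t : SimpsonType) (a b c : ℕ → ℂ)
    (ha : Set.InjOn a (Set.Iio t.typeA.length)) (hb : Set.InjOn b (Set.Iio t.typeB.length))
    (hc : Set.InjOn c (Set.Iio t.dim))
    (htr : ∑ k ∈ Finset.range t.typeA.length, (t.typeA.blocks.getD k 0 : ℂ) * a k =
      ∑ k ∈ Finset.range t.typeB.length, (t.typeB.blocks.getD k 0 : ℂ) * b k +
        ∑ k ∈ Finset.range t.dim, c k) :
    ∃ s ∈ t.S, (∀ k < t.typeA.length, t.eigA s (k + 1) = a k) ∧
      (∀ k < t.typeB.length, t.eigB s (k + 1) = b k) ∧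
      ∀ k < t.dim, t.eigC s (k + 1) = c k := by
  have hlen : t.typeC.length = t.dim := Composition.ones_length _
  refine ⟨(fun i => a (t.typeA.index i), fun i => b (t.typeB.index i),
    fun i => c (t.typeC.index i)), ⟨hasSpectralType_comp_index ha, hasSpectralType_comp_index hb,
    hasSpectralType_comp_index (by rwa [hlen]), ?_⟩, fun k hk => blockValue_comp_index a hk,
    fun k hk => blockValue_comp_index b hk, fun k hk => blockValue_comp_index c (by rwa [hlen])⟩
  rw [Finset.sum_add_distrib, sum_comp_index, sum_comp_index, htr]
  congr 1
  rw [Finset.sum_range]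
  exact Finset.sum_congr rfl fun i _ => congrArg c (index_ones i).symm

theorem trace_of_mem_S {t : SimpsonType} {s : TripleSpace t.dim} (hs : s ∈ t.S) :
    ∑ k ∈ Finset.range t.typeA.length, (t.typeA.blocks.getD k 0 : ℂ) * t.eigA s (k + 1) =
      ∑ k ∈ Finset.range t.typeB.length, (t.typeB.blocks.getD k 0 : ℂ) * t.eigB s (k + 1) +
        ∑ k ∈ Finset.Icc 1 t.dim, t.eigC s k := by
  obtain ⟨hA, hB, -, htr⟩ := hs
  rw [← sum_comp_index (fun k => t.eigA s (k + 1)), ← sum_comp_index (fun k => t.eigB s (k + 1)),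
    eigA, eigB, eigC, typeC, ← sum_eq_sum_blockValue_ones, ← Finset.sum_add_distrib]
  rw [hA.eq_comp_index, hB.eq_comp_index] at htr
  convert htr using 2

theorem specC_of_mem_S {t : SimpsonType} {s : TripleSpace t.dim} (i : Fin t.dim) :
    s.2.2 i = t.eigC s (i + 1) := (blockValue_ones i).symm

theorem eigC_injOn {t : SimpsonType} {s : TripleSpace t.dim} (hs : s ∈ t.S) :
    Set.InjOn (t.eigC s) (Finset.Icc 1 t.dim) := by
  have h := hasSpectralType_ones_iff.1 hs.2.2.1
  intro i hi j hj hij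
  simp only [Finset.coe_Icc, Set.mem_Icc] at hi hj
  have h1 := h (a₁ := ⟨i - 1, by omega⟩) (a₂ := ⟨j - 1, by omega⟩) (by
    rw [specC_of_mem_S, specC_of_mem_S]
    simpa [Nat.sub_add_cancel hi.1, Nat.sub_add_cancel hj.1] using hij)
  simp only [Fin.mk.injEq] at h1
  omega

theorem specA_of_mem_S {t : SimpsonType} {s : TripleSpace t.dim} (hs : s ∈ t.S) {k : ℕ}
    {i : Fin t.dim} (h1 : t.typeA.sizeUpTo k ≤ i) (h2 : (i : ℕ) < t.typeA.sizeUpTo (k + 1)) :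
    s.1 i = t.eigA s (k + 1) := by
  have := congrFun hs.1.eq_comp_index i
  rwa [Composition.index_eq_of_sizeUpTo h1 h2] at this

theorem specB_of_mem_S {t : SimpsonType} {s : TripleSpace t.dim} (hs : s ∈ t.S) {k : ℕ}
    {i : Fin t.dim} (h1 : t.typeB.sizeUpTo k ≤ i) (h2 : (i : ℕ) < t.typeB.sizeUpTo (k + 1)) :
    s.2.1 i = t.eigB s (k + 1) := by
  have := congrFun hs.2.1.eq_comp_index i
  rwa [Composition.index_eq_of_sizeUpTo h1 h2] at this

theorem specA_even {m : ℕ} {hm : 2 ≤ m} {s : TripleSpace (even m hm).dim} (hs : s ∈ (even m hm).S)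
    (i : Fin (2 * m)) :
    s.1 i = if (i : ℕ) < m then (even m hm).eigA s 1 else (even m hm).eigA s 2 := by
  split_ifs with h
  · exact specA_of_mem_S hs (k := 0) (by simp) (by simpa [Composition.sizeUpTo, typeA] using h)
  · refine specA_of_mem_S hs (k := 1) (by simpa [Composition.sizeUpTo, typeA] using h) ?_
    have := i.2
    simp [Composition.sizeUpTo, typeA]; omega

theorem specB_even {m : ℕ} {hm : 2 ≤ m} {s : TripleSpace (even m hm).dim} (hs : s ∈ (even m hm).S)
    (i : Fin (2 * m)) :
    s.2.1 i = if (i : ℕ) = 0 then (even m hm).eigB s 1 else if (i : ℕ) < m then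
      (even m hm).eigB s 2 else (even m hm).eigB s 3 := by
  have := i.2
  split_ifs with h h'
  · exact specB_of_mem_S hs (k := 0) (by simp) (by simp [Composition.sizeUpTo, typeB]; omega)
  · exact specB_of_mem_S hs (k := 1) (by simp [Composition.sizeUpTo, typeB]; omega)
      (by simp [Composition.sizeUpTo, typeB]; omega)
  · exact specB_of_mem_S hs (k := 2) (by simp [Composition.sizeUpTo, typeB]; omega)
      (by simp [Composition.sizeUpTo, typeB]; omega)

theorem trace_even {m : ℕ} {hm : 2 ≤ m} {s : TripleSpace (even m hm).dim}
    (hs : s ∈ (even m hm).S) :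
    m * (even m hm).eigA s 1 + m * (even m hm).eigA s 2 =
      (even m hm).eigB s 1 + (m - 1) * (even m hm).eigB s 2 + m * (even m hm).eigB s 3 +
        ∑ k ∈ Finset.Icc 1 (2 * m), (even m hm).eigC s k := by
  have h := trace_of_mem_S hs
  have hA : (even m hm).typeA.length = 2 := rfl
  have hB : (even m hm).typeB.length = 3 := rfl
  rw [hA, hB] at h
  have h1 : ((m - 1 : ℕ) : ℂ) = m - 1 := by push_cast [show 1 ≤ m by omega]; rfl
  simpa [Finset.sum_range_succ, typeA, typeB, dim, h1] using h

theorem specA_odd {m : ℕ} {hm : 2 ≤ m} {s : TripleSpace (odd m hm).dim} (hs : s ∈ (odd m hm).S)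
    (i : Fin (2 * m + 1)) :
    s.1 i = if (i : ℕ) < m + 1 then (odd m hm).eigA s 1 else (odd m hm).eigA s 2 := by
  split_ifs with h
  · exact specA_of_mem_S hs (k := 0) (by simp) (by simpa [Composition.sizeUpTo, typeA] using h)
  · refine specA_of_mem_S hs (k := 1) (by simp [Composition.sizeUpTo, typeA]; omega) ?_
    have := i.2
    simp [Composition.sizeUpTo, typeA]; omega

theorem specB_odd {m : ℕ} {hm : 2 ≤ m} {s : TripleSpace (odd m hm).dim} (hs : s ∈ (odd m hm).S)
    (i : Fin (2 * m + 1)) :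
    s.2.1 i = if (i : ℕ) = 0 then (odd m hm).eigB s 1 else if (i : ℕ) < m + 1 then
      (odd m hm).eigB s 2 else (odd m hm).eigB s 3 := by
  have := i.2
  split_ifs with h h'
  · exact specB_of_mem_S hs (k := 0) (by simp) (lt_of_eq_of_lt h (by simp [Composition.sizeUpTo, typeB]))
  · exact specB_of_mem_S hs (k := 1) (by simp [Composition.sizeUpTo, typeB]; omega)
      (by simp [Composition.sizeUpTo, typeB]; omega)
  · exact specB_of_mem_S hs (k := 2) (by simp [Composition.sizeUpTo, typeB]; omega)
      (by simp [Composition.sizeUpTo, typeB]; omega)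

theorem trace_odd {m : ℕ} {hm : 2 ≤ m} {s : TripleSpace (odd m hm).dim}
    (hs : s ∈ (odd m hm).S) :
    (m + 1) * (odd m hm).eigA s 1 + m * (odd m hm).eigA s 2 =
      (odd m hm).eigB s 1 + m * (odd m hm).eigB s 2 + m * (odd m hm).eigB s 3 +
        ∑ k ∈ Finset.Icc 1 (2 * m + 1), (odd m hm).eigC s k := by
  have h := trace_of_mem_S hs
  have hA : (odd m hm).typeA.length = 2 := rfl
  have hB : (odd m hm).typeB.length = 3 := rfl
  rw [hA, hB] at h
  simpa [Finset.sum_range_succ, typeA, typeB, dim] using h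

theorem specA_extra {s : TripleSpace extra.dim} (hs : s ∈ extra.S) (i : Fin 6) :
    s.1 i = if (i : ℕ) < 4 then extra.eigA s 1 else extra.eigA s 2 := by
  split_ifs with h
  · exact specA_of_mem_S hs (k := 0) (by simp) (by simpa [Composition.sizeUpTo, typeA] using h)
  · refine specA_of_mem_S hs (k := 1) (by simp [Composition.sizeUpTo, typeA]; omega) ?_
    have := i.2
    simp [Composition.sizeUpTo, typeA]

theorem specB_extra {s : TripleSpace extra.dim} (hs : s ∈ extra.S) (i : Fin 6) :
    s.2.1 i = if (i : ℕ) < 2 then extra.eigB s 1 else if (i : ℕ) < 4 then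
      extra.eigB s 2 else extra.eigB s 3 := by
  have := i.2
  split_ifs with h h'
  · exact specB_of_mem_S hs (k := 0) (by simp) (by simp [Composition.sizeUpTo, typeB]; omega)
  · exact specB_of_mem_S hs (k := 1) (by simp [Composition.sizeUpTo, typeB]; omega)
      (by simp [Composition.sizeUpTo, typeB]; omega)
  · exact specB_of_mem_S hs (k := 2) (by simp [Composition.sizeUpTo, typeB]; omega)
      (by simp [Composition.sizeUpTo, typeB])

theorem trace_extra {s : TripleSpace extra.dim} (hs : s ∈ extra.S) :
    4 * extra.eigA s 1 + 2 * extra.eigA s 2 =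
      2 * extra.eigB s 1 + 2 * extra.eigB s 2 + 2 * extra.eigB s 3 +
        ∑ k ∈ Finset.Icc 1 6, extra.eigC s k := by
  have h := trace_of_mem_S hs
  have hA : extra.typeA.length = 2 := rfl
  have hB : extra.typeB.length = 3 := rfl
  rw [hA, hB] at h
  simpa [Finset.sum_range_succ, typeA, typeB, dim] using h

theorem specA_hypergeometric {m : ℕ} {hm : 2 ≤ m} {s : TripleSpace (hypergeometric m hm).dim}
    (hs : s ∈ (hypergeometric m hm).S) (i : Fin m) :
    s.1 i = if (i : ℕ) < 1 then (hypergeometric m hm).eigA s 1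
      else (hypergeometric m hm).eigA s 2 := by
  split_ifs with h
  · exact specA_of_mem_S hs (k := 0) (by simp) (by simpa [Composition.sizeUpTo, typeA] using h)
  · refine specA_of_mem_S hs (k := 1) (by simp [Composition.sizeUpTo, typeA]; omega) ?_
    have := i.2
    simp [Composition.sizeUpTo, typeA]; omega

theorem specB_hypergeometric {m : ℕ} {hm : 2 ≤ m} {s : TripleSpace (hypergeometric m hm).dim}
    (i : Fin m) : s.2.1 i = (hypergeometric m hm).eigB s (i + 1) := (blockValue_ones i).symm

theorem trace_hypergeometric {m : ℕ} {hm : 2 ≤ m} {s : TripleSpace (hypergeometric m hm).dim}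
    (hs : s ∈ (hypergeometric m hm).S) :
    (hypergeometric m hm).eigA s 1 + (m - 1) * (hypergeometric m hm).eigA s 2 =
      ∑ k ∈ Finset.Icc 1 m, (hypergeometric m hm).eigB s k +
        ∑ k ∈ Finset.Icc 1 m, (hypergeometric m hm).eigC s k := by
  have h := hs.2.2.2
  have hA : (hypergeometric m hm).typeA.length = 2 := rfl
  have h1 : ((m - 1 : ℕ) : ℂ) = m - 1 := by push_cast [show 1 ≤ m by omega]; rfl
  have h2 : ∑ i, s.1 i = _ := (congrArg (fun x : Fin m → ℂ => ∑ i, x i) hs.1.eq_comp_index).trans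
    (sum_comp_index (fun k => (hypergeometric m hm).eigA s (k + 1)))
  rw [Finset.sum_add_distrib, sum_eq_sum_blockValue_ones (x := s.2.1),
    sum_eq_sum_blockValue_ones (x := s.2.2), h2, hA] at h
  simpa [Finset.sum_range_succ, typeA, dim, h1, eigB, eigC, typeB, typeC] using h

theorem eigA_ne {t : SimpsonType} {s : TripleSpace t.dim} (hs : s ∈ t.S) :
    t.eigA s 1 ≠ t.eigA s 2 := by
  refine HasSpectralType.blockValue_ne hs.1 (k := 0) (l := 1) ?_ ?_ (by omega) <;>
  cases t <;> simp [Composition.length, typeA]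

theorem eigB_injOn {t : SimpsonType} {s : TripleSpace t.dim} (hs : s ∈ t.S) :
    Set.InjOn (t.eigB s) (Finset.Icc 1 t.typeB.length) := by
  intro k hk l hl h
  simp only [Finset.coe_Icc, Set.mem_Icc] at hk hl
  obtain ⟨k, rfl⟩ := Nat.exists_eq_add_of_le' hk.1
  obtain ⟨l, rfl⟩ := Nat.exists_eq_add_of_le' hl.1
  by_contra h'
  exact hs.2.1.blockValue_ne (k := k) (l := l) (by omega) (by omega) (by omega) h

end SimpsonType

end

noncomputable section

section Reindexing

variable {n : ℕ} {ι : Type*} [Fintype ι] [DecidableEq ι]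

/-- `e` sends an index to its coordinate, `f` to the number of its eigenvector. The two are kept
apart because the eigenvalues of `C` are numbered against the order of the diagonal. -/
theorem mul_submatrix_of_submatrix_mul (e f : ι ≃ Fin n) {M : Matrix (Fin n) (Fin n) ℂ}
    {V : Matrix ι ι ℂ} {x : ι → ℂ} (h : M.submatrix e e * V = V * Matrix.diagonal x) :
    M * V.submatrix e.symm f.symm =
      V.submatrix e.symm f.symm * Matrix.diagonal fun i => x (f.symm i) := by
  have h1 := congrArg (fun N : Matrix ι ι ℂ => N.submatrix e.symm f.symm) h
  simp only [← Matrix.submatrix_mul_equiv (e₂ := e.symm), Matrix.submatrix_submatrix,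
    Function.comp_def, Equiv.apply_symm_apply] at h1
  refine Eq.trans h1 ?_
  rw [Matrix.submatrix_mul_equiv, ← Matrix.submatrix_mul_equiv (e₂ := f.symm),
    Matrix.submatrix_diagonal_equiv]
  rfl

theorem submatrix_mul_eq_one (e f : ι ≃ Fin n) {V W : Matrix ι ι ℂ} (h : W * V = 1) :
    W.submatrix f.symm e.symm * V.submatrix e.symm f.symm = 1 := by
  rw [Matrix.submatrix_mul_equiv, h, Matrix.submatrix_one_equiv]

theorem DiagonalizableWithSpectrum.of_submatrix (e f : ι ≃ Fin n) {M : Matrix (Fin n) (Fin n) ℂ}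
    {V W : Matrix ι ι ℂ} {x : ι → ℂ} (hWV : W * V = 1)
    (h : M.submatrix e e * V = V * Matrix.diagonal x) :
    DiagonalizableWithSpectrum M fun i => x (f.symm i) :=
  .of_inverse (submatrix_mul_eq_one e f hWV) (mul_submatrix_of_submatrix_mul e f h)

theorem mulVec_eq_smul_of_mul_eq {M V : Matrix (Fin n) (Fin n) ℂ} {x : Fin n → ℂ}
    (h : M * V = V * Matrix.diagonal x) (i : Fin n) : M *ᵥ V.col i = x i • V.col i := by
  ext j
  have h1 := congrFun (congrFun h j) i
  rw [Matrix.mul_diagonal, mul_comm] at h1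
  exact h1

end Reindexing

/-! ### Triangular matrices with constant rows above the diagonal -/

namespace ConstantRows

variable {n : ℕ}

/-- The upper triangular matrix with diagonal `x` and constant rows above the diagonal. -/
def mat (n : ℕ) (x r : ℕ → ℂ) : Matrix (Fin n) (Fin n) ℂ :=
  Matrix.of fun i j => if (i : ℕ) < j then r i else if (i : ℕ) = j then x i else 0

/-- The sum of the coordinates, from the `i`-th on, of the `j`-th right eigenvector. -/
def tailSum (x r : ℕ → ℂ) (i j : ℕ) : ℂ := ∏ l ∈ Finset.Ico i j, (1 + r l / (x j - x l))

/-- The product of the `i`-th left eigenvector with `r`, up to the `j`-th coordinate. -/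
def headSum (x r : ℕ → ℂ) (i j : ℕ) : ℂ :=
  r i * ∏ l ∈ Finset.Ico (i + 1) j, (1 + r l / (x i - x l))

/-- Right eigenvectors. -/
def right (x r : ℕ → ℂ) (i j : ℕ) : ℂ :=
  if i < j then r i / (x j - x i) * tailSum x r (i + 1) j else if i = j then 1 else 0

/-- Left eigenvectors. -/
def left (x r : ℕ → ℂ) (i j : ℕ) : ℂ :=
  if i < j then headSum x r i j / (x i - x j) else if i = j then 1 else 0

/-- Because the rows are constant, the eigenvector equation is `(x j - x i) v_i = r i * T_{i+1}`
with the tail sums `T_i = v_i + T_{i+1}`. Hence `T_i = (1 + r i / (x j - x i)) T_{i+1}` with `T_j =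
1`, which explains the product formula. -/
theorem sum_right (x r : ℕ → ℂ) {i j : ℕ} (hij : i ≤ j) :
    ∑ k ∈ Finset.Ico i (j + 1), right x r k j = tailSum x r i j := by
  induction hij using Nat.decreasingInduction with
  | self => simp [right, tailSum]
  | of_succ k hk ih =>
    rw [Finset.sum_eq_sum_Ico_succ_bot (by omega), ih, right, if_pos hk, tailSum, tailSum,
      Finset.prod_eq_prod_Ico_succ_bot hk]
    ring

/-- The dual recursion: the partial sums `H_j` satisfy `H_{j+1} = (1 + r j / (x i - x j)) H_j`,
starting from `H_{i+1} = r i`. -/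
theorem sum_left_mul (x r : ℕ → ℂ) {i j : ℕ} (hij : i + 1 ≤ j) :
    ∑ k ∈ Finset.Ico i j, left x r i k * r k = headSum x r i j := by
  induction j, hij using Nat.le_induction with
  | base => simp [left, headSum]
  | succ k hk ih =>
    rw [Finset.sum_Ico_succ_top (by omega), ih, left, if_pos (by omega), headSum, headSum,
      Finset.prod_Ico_succ_top (by omega)]
    ring

theorem sum_fin_eq_sum_Ico {f : ℕ → ℂ} {i j : ℕ} (hj : j ≤ n)
    (hf : ∀ k, ¬ (i ≤ k ∧ k < j) → f k = 0) :
    ∑ k : Fin n, f k = ∑ k ∈ Finset.Ico i j, f k := by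
  rw [← Finset.sum_range f]
  symm
  apply Finset.sum_subset
  · intro k hk
    simp only [Finset.mem_Ico, Finset.mem_range] at hk ⊢
    omega
  · intro k _ hk
    exact hf k (by simpa using hk)

/-- The matrix of right eigenvectors. -/
def rightMat (n : ℕ) (x r : ℕ → ℂ) : Matrix (Fin n) (Fin n) ℂ := Matrix.of fun i j => right x r i j

/-- The matrix of left eigenvectors. -/
def leftMat (n : ℕ) (x r : ℕ → ℂ) : Matrix (Fin n) (Fin n) ℂ := Matrix.of fun i j => left x r i j

theorem sum_rightMat (x r : ℕ → ℂ) (j : Fin n) :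
    ∑ k, rightMat n x r k j = tailSum x r 0 j := by
  rw [← sum_right x r (Nat.zero_le j)]
  refine sum_fin_eq_sum_Ico (f := fun k => right x r k j) j.2 fun k hk => ?_
  rw [right, if_neg (by omega), if_neg (by omega)]

theorem leftMat_mulVec (x r : ℕ → ℂ) (i : Fin n) :
    ∑ k, leftMat n x r i k * r k = headSum x r i n := by
  rw [← sum_left_mul x r i.2]
  have h := Finset.sum_subset (s₁ := Finset.Ico (i : ℕ) n) (s₂ := Finset.range n)
    (f := fun k => left x r i k * r k)
    (fun k hk => by simp only [Finset.mem_Ico, Finset.mem_range] at hk ⊢; omega)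
    (fun k hk hk' => by
      simp only [Finset.mem_Ico, Finset.mem_range] at hk hk'
      rw [left, if_neg (by omega), if_neg (by omega), zero_mul])
  rw [h, Finset.sum_range]
  rfl

theorem rightMat_apply_self (x r : ℕ → ℂ) (i : Fin n) : rightMat n x r i i = 1 := by
  simp [rightMat, right]

theorem rightMat_apply_of_lt (x r : ℕ → ℂ) {i j : Fin n} (h : j < i) :
    rightMat n x r i j = 0 := by
  have := Fin.lt_def.1 h
  rw [rightMat, Matrix.of_apply, right, if_neg (by omega), if_neg (by omega)]

theorem mat_mul_rightMat {x : ℕ → ℂ} (hx : Set.InjOn x (Set.Iio n)) (r : ℕ → ℂ) :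
    mat n x r * rightMat n x r = rightMat n x r * Matrix.diagonal fun i : Fin n => x i := by
  ext i j
  rw [Matrix.mul_diagonal, Matrix.mul_apply]
  -- The diagonal entry is split off; what remains is `r i` times the sum of the later coordinates
  -- of the eigenvector.
  have h1 : ∑ k, mat n x r i k * rightMat n x r k j =
      x i * right x r i j + ∑ k : Fin n, (if (i : ℕ) < k then r i * right x r k j else 0) := by
    rw [← Finset.sum_erase_add _ _ (Finset.mem_univ i),
      ← Finset.sum_erase_add (Finset.univ : Finset (Fin n)) (fun k : Fin n =>
        if (i : ℕ) < k then r i * right x r k j else 0) (Finset.mem_univ i)]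
    simp only [mat, rightMat, Matrix.of_apply, lt_irrefl, if_false, if_true, add_zero]
    rw [add_comm]
    congr 1
    refine Finset.sum_congr rfl fun k hk => ?_
    have : (i : ℕ) ≠ k := fun h => (Finset.mem_erase.1 hk).1 (Fin.ext h.symm)
    rw [if_neg this]
    split_ifs <;> simp
  rw [h1]
  by_cases hij : (i : ℕ) < j
  · rw [sum_fin_eq_sum_Ico (f := fun k => if (i : ℕ) < k then r i * right x r k j else 0)
      (i := i + 1) (j := j + 1) j.2]
    · rw [Finset.sum_congr rfl (g := fun k => r i * right x r k j), ← Finset.mul_sum,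
        sum_right x r hij]
      · have h2 : x j - x i ≠ 0 := sub_ne_zero.2 fun h => by
          have := hx j.2 i.2 h
          omega
        simp only [rightMat, Matrix.of_apply, right, if_pos hij]
        field_simp
        ring
      · intro k hk
        rw [if_pos (by simp at hk; omega)]
    · intro k hk
      split_ifs with h
      · rw [right, if_neg (by omega), if_neg (by omega), mul_zero]
      · rfl
  · rw [Finset.sum_eq_zero, add_zero]
    · simp only [rightMat, Matrix.of_apply, right, if_neg hij]
      split_ifs with h
      · rw [h]; ring
      · simp
    · intro k _
      split_ifs with h
      · rw [right, if_neg (by omega), if_neg (by omega), mul_zero]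
      · rfl

theorem leftMat_mul_mat {x : ℕ → ℂ} (hx : Set.InjOn x (Set.Iio n)) (r : ℕ → ℂ) :
    leftMat n x r * mat n x r = (Matrix.diagonal fun i : Fin n => x i) * leftMat n x r := by
  ext i j
  rw [Matrix.diagonal_mul, Matrix.mul_apply]
  have h1 : ∑ k, leftMat n x r i k * mat n x r k j =
      left x r i j * x j + ∑ k : Fin n, (if (k : ℕ) < j then left x r i k * r k else 0) := by
    rw [← Finset.sum_erase_add _ _ (Finset.mem_univ j),
      ← Finset.sum_erase_add (Finset.univ : Finset (Fin n)) (fun k : Fin n =>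
        if (k : ℕ) < j then left x r i k * r k else 0) (Finset.mem_univ j)]
    simp only [mat, leftMat, Matrix.of_apply, lt_irrefl, if_false, if_true, add_zero]
    rw [add_comm]
    congr 1
    refine Finset.sum_congr rfl fun k hk => ?_
    have : (k : ℕ) ≠ j := fun h => (Finset.mem_erase.1 hk).1 (Fin.ext h)
    rw [if_neg this]
    split_ifs <;> simp
  rw [h1]
  by_cases hij : (i : ℕ) < j
  · rw [sum_fin_eq_sum_Ico (f := fun k => if k < (j : ℕ) then left x r i k * r k else 0)
      (i := i) (j := j) j.2.le]
    · rw [Finset.sum_congr rfl (g := fun k => left x r i k * r k), sum_left_mul x r hij]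
      · have h2 : x i - x j ≠ 0 := sub_ne_zero.2 fun h => by
          have := hx i.2 j.2 h
          omega
        simp only [leftMat, Matrix.of_apply, left, if_pos hij]
        field_simp
        ring
      · intro k hk
        rw [if_pos (by simp at hk; omega)]
    · intro k hk
      split_ifs with h
      · rw [left, if_neg (by omega), if_neg (by omega), zero_mul]
      · rfl
  · rw [Finset.sum_eq_zero, add_zero]
    · simp only [leftMat, Matrix.of_apply, left, if_neg hij]
      split_ifs with h
      · rw [h]; ring
      · simp
    · intro k _
      split_ifs with h
      · rw [left, if_neg (by omega), if_neg (by omega), zero_mul]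
      · rfl

/-- Left and right eigenvectors for different eigenvalues are orthogonal, and both matrices are
upper triangular with ones on the diagonal. -/
theorem leftMat_mul_rightMat {x : ℕ → ℂ} (hx : Set.InjOn x (Set.Iio n)) (r : ℕ → ℂ) :
    leftMat n x r * rightMat n x r = 1 := by
  set W := leftMat n x r with hW
  set V := rightMat n x r with hV
  ext i j
  by_cases hij : i = j
  · subst hij
    rw [Matrix.mul_apply, Matrix.one_apply_eq, Finset.sum_eq_single i]
    · simp [hW, hV, leftMat, rightMat, left, right]
    · intro k _ hk
      have : (k : ℕ) ≠ i := fun h => hk (Fin.ext h)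
      simp only [hW, hV, leftMat, rightMat, Matrix.of_apply, left, right]
      rcases lt_or_gt_of_ne this with h | h
      · rw [if_neg (by omega), if_neg (by omega), zero_mul]
      · rw [mul_comm, if_neg (by omega), if_neg (by omega), zero_mul]
    · simp
  · have h1 : x i * (W * V) i j = (W * V) i j * x j := by
      have h2 : (leftMat n x r * mat n x r * V) i j =
          ((Matrix.diagonal fun i : Fin n => x i) * leftMat n x r * V) i j := by
        rw [leftMat_mul_mat hx]
      rw [Matrix.mul_assoc, mat_mul_rightMat hx, Matrix.mul_assoc, Matrix.diagonal_mul,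
        ← Matrix.mul_assoc, Matrix.mul_diagonal] at h2
      exact h2.symm
    have h2 : (x i - x j) * (W * V) i j = 0 := by rw [sub_mul, h1]; ring
    rw [Matrix.one_apply_ne hij]
    exact (mul_eq_zero.1 h2).resolve_left (sub_ne_zero.2 fun h => hij (Fin.ext (hx i.2 j.2 h)))

end ConstantRows

end

/-! ### The hypergeometric family. -/

noncomputable section

namespace SimpsonType

/-- The matrices attached to `s` have the prescribed spectra, and there is a unique normalized
eigenbasis; the form that is diagonal in this basis makes them self-adjoint. -/
def Realizes (t : SimpsonType) (s : TripleSpace t.dim) : Prop :=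
  (DiagonalizableWithSpectrum (t.matA s) s.1 ∧
    DiagonalizableWithSpectrum (t.matB s) s.2.1 ∧
    DiagonalizableWithSpectrum (t.matC s) s.2.2) ∧
  ∃ v : Module.Basis (Fin t.dim) ℂ (Fin t.dim → ℂ),
    t.IsEigenbasis s v ∧ (∀ w, t.IsEigenbasis s w → w = v) ∧
    (s ∈ t.S' → ∃ Φ : LinearMap.BilinForm ℂ (Fin t.dim → ℂ),
      (∀ i j, Φ (v i) (v j) = if i = j then t.num s i / t.den s i else 0) ∧
      Φ.IsSymm ∧ Φ ≠ 0 ∧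
      LinearMap.IsSelfAdjoint Φ (Matrix.toLin' (t.matA s)) ∧
      LinearMap.IsSelfAdjoint Φ (Matrix.toLin' (t.matB s)) ∧
      LinearMap.IsSelfAdjoint Φ (Matrix.toLin' (t.matC s)) ∧
      (s ∈ t.S'' → Φ.Nondegenerate))

/-- The symmetry condition is additive in the matrix, so it is required only for `B` and `C`. -/
theorem realizes_of_eigenvectors {t : SimpsonType} {s : TripleSpace t.dim}
    (hA : DiagonalizableWithSpectrum (t.matA s) s.1)
    (hB : DiagonalizableWithSpectrum (t.matB s) s.2.1)
    (hC : DiagonalizableWithSpectrum (t.matC s) s.2.2)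
    {V W : Matrix (Fin t.dim) (Fin t.dim) ℂ} (hWV : W * V = 1)
    (hv : ∀ v : Module.Basis (Fin t.dim) ℂ (Fin t.dim → ℂ), (∀ i, v i = V.col i) →
      t.IsEigenbasis s v)
    (hu : ∀ v w, t.IsEigenbasis s v → t.IsEigenbasis s w → w = v)
    (hBs : s ∈ t.S' → ∀ i j, t.num s i / t.den s i * (W * t.matB s * V) i j =
      t.num s j / t.den s j * (W * t.matB s * V) j i)
    (hCs : s ∈ t.S' → ∀ i j, t.num s i / t.den s i * (W * t.matC s * V) i j =
      t.num s j / t.den s j * (W * t.matC s * V) j i)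
    (hne : s ∈ t.S' → ∃ i, t.num s i ≠ 0) : t.Realizes s := by
  refine ⟨⟨hA, hB, hC⟩, columnBasis V W hWV, hv _ (columnBasis_apply V W hWV),
    fun w hw => hu _ _ (hv _ (columnBasis_apply V W hWV)) hw, fun hs' => ?_⟩
  have hBs := hBs hs'
  have hCs := hCs hs'
  obtain ⟨Φ, h1, h2, h3, h4, h5, h6, h7⟩ := exists_bilinForm_of_symmetric (A := t.matA s)
    (B := t.matB s) (C := t.matC s) hWV (columnBasis V W hWV) (columnBasis_apply V W hWV)
    (fun i => t.num s i / t.den s i)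
    (fun i j => by
      rw [matA, mul_add, add_mul, Matrix.add_apply, Matrix.add_apply, mul_add, mul_add, hBs, hCs])
    hBs hCs
  obtain ⟨i, hi⟩ := hne hs'
  exact ⟨Φ, h1, h2, h6 ⟨i, div_ne_zero hi (hs'.2 i)⟩, h3, h4, h5,
    fun hs'' => h7 fun i => div_ne_zero (hs''.2 i) (hs'.2 i)⟩

end SimpsonType

theorem prod_Ico_succ_eq_prod_Icc (f : ℕ → ℂ) (i j : ℕ) :
    ∏ l ∈ Finset.Ico i j, f (l + 1) = ∏ k ∈ Finset.Icc (i + 1) j, f k := by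
  rw [Finset.prod_Ico_add' f i j 1]
  exact Finset.prod_congr (by ext; simp) fun _ _ => rfl

theorem prod_Ico_sub_eq_prod_Icc (f : ℕ → ℂ) {i j m : ℕ} (hj : j ≤ m) :
    ∏ l ∈ Finset.Ico i j, f (m - l) = ∏ k ∈ Finset.Icc (m + 1 - j) (m - i), f k := by
  refine Finset.prod_nbij' (fun l => m - l) (fun l => m - l) ?_ ?_ ?_ ?_ ?_
  all_goals intro l hl
  all_goals simp only [Finset.mem_Ico, Finset.mem_Icc] at hl ⊢
  all_goals omega

theorem sum_fin_sub_eq_sum_Icc {n : ℕ} (g : ℕ → ℂ) :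
    ∑ i : Fin n, g (n - i) = ∑ k ∈ Finset.Icc 1 n, g k := by
  rw [← sum_fin_succ_eq_sum_Icc, ← Equiv.sum_comp Fin.revPerm]
  refine Finset.sum_congr rfl fun i _ => ?_
  congr 1
  simp [Fin.val_rev]
  omega

namespace Hypergeometric

variable {m : ℕ} {a b c : ℕ → ℂ}

/-- The off-diagonal entries in the `l`-th row, with `l` counted from `0`. -/
def row (m : ℕ) (a b c : ℕ → ℂ) (l : ℕ) : ℂ := b (l + 1) + c (m - l) - a 2

theorem oneBased_entryB : oneBased m (entryB m a b c) =
    ConstantRows.mat m (fun l => b (l + 1)) (row m a b c) := by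
  ext i j
  simp only [oneBased, entryB, ConstantRows.mat, Matrix.of_apply, add_lt_add_iff_right,
      add_left_inj, Nat.add_sub_add_right]
  rfl

/-- Reversing the coordinates makes the lower triangular `C` upper triangular, again with constant
rows, so `ConstantRows` covers it as well. -/
theorem oneBased_entryC_submatrix : (oneBased m (entryC m a b c)).submatrix Fin.revPerm Fin.revPerm =
    ConstantRows.mat m (fun l => c (l + 1)) (fun l => row m a b c (m - (l + 1))) := by
  ext i j
  have hi := i.2
  have hj := j.2
  simp only [oneBased, entryC, ConstantRows.mat, Matrix.of_apply, Matrix.submatrix_apply,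
    Fin.revPerm_apply, Fin.val_rev]
  have h1 : m - (i + 1) + 1 = m - i := by omega
  have h2 : m - (j + 1) + 1 = m - j := by omega
  rw [h1, h2]
  have h3 : m + 1 - (m - i) = i + 1 := by omega
  rw [h3]
  have h4 : m - (m - ((i : ℕ) + 1)) = i + 1 := by omega
  simp only [row, h4, h1]
  split_ifs <;> first | rfl | omega

/-- The key to this family: in each row the diagonal entry of `A` exceeds the others by exactly `a
2`, so `A - a 2` has rank at most one. -/
theorem oneBased_entryA : oneBased m (entryB m a b c) + oneBased m (entryC m a b c) =
    a 2 • (1 : Matrix (Fin m) (Fin m) ℂ) + Matrix.of fun (i _ : Fin m) => row m a b c i := by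
  ext i j
  simp only [oneBased, entryB, entryC, add_lt_add_iff_right, row,
    add_left_inj, Nat.add_sub_add_right, Matrix.add_apply, Matrix.smul_apply, Matrix.of_apply,
    Matrix.one_apply, Fin.ext_iff, smul_eq_mul]
  rcases lt_trichotomy (i : ℕ) j with h | h | h
  · rw [if_pos h, if_neg (by omega), if_neg (by omega), if_neg (by omega)]; ring
  · rw [if_neg (by omega), if_pos h, if_neg (by omega), if_pos h, if_pos h]; ring
  · rw [if_neg (by omega), if_neg (by omega), if_pos h, if_neg (by omega)]; ring

theorem sum_row (htr : a 1 + (m - 1) * a 2 = ∑ k ∈ Finset.Icc 1 m, b k + ∑ k ∈ Finset.Icc 1 m, c k) :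
    ∑ i : Fin m, row m a b c i = a 1 - a 2 := by
  have h3 : ∑ i : Fin m, row m a b c i =
      ∑ i : Fin m, b (i + 1) + ∑ i : Fin m, c (m - i) - m * a 2 := by
    simp [row, Finset.sum_add_distrib, Finset.sum_sub_distrib]
  rw [h3, sum_fin_sub_eq_sum_Icc, sum_fin_succ_eq_sum_Icc, ← htr]
  ring

/-- A matrix with constant rows satisfies `R² = τ R`, where `τ` is its trace; the trace condition
gives `τ = a 1 - a 2`. -/
theorem quadratic (htr : a 1 + (m - 1) * a 2 =
      ∑ k ∈ Finset.Icc 1 m, b k + ∑ k ∈ Finset.Icc 1 m, c k) :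
    (oneBased m (entryB m a b c) + oneBased m (entryC m a b c) -
        a 1 • (1 : Matrix (Fin m) (Fin m) ℂ)) *
      (oneBased m (entryB m a b c) + oneBased m (entryC m a b c) -
        a 2 • (1 : Matrix (Fin m) (Fin m) ℂ)) = 0 := by
  have h : (Matrix.of fun (i _ : Fin m) => row m a b c i) *
      (Matrix.of fun (i _ : Fin m) => row m a b c i) =
      (a 1 - a 2) • (Matrix.of fun (i _ : Fin m) => row m a b c i) := by
    ext i j
    simp only [Matrix.mul_apply, Matrix.of_apply, Matrix.smul_apply, smul_eq_mul]
    rw [← Finset.mul_sum, sum_row htr, mul_comm]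
  rw [oneBased_entryA, add_sub_cancel_left, sub_mul, add_mul, h]
  simp only [Matrix.smul_mul, one_mul]
  module

/-- In the eigenbasis of `B` the matrix `A - a 2` becomes the column of head sums times the row of
tail sums. This equation is the proportionality that makes that product symmetric after
multiplication by `l_i`. -/
theorem num_mul_headSum (hb : Set.InjOn b (Finset.Icc 1 m)) {i : ℕ} (hi : i < m)
    (hden : den m a b c (i + 1) ≠ 0) :
    num m a b c (i + 1) / den m a b c (i + 1) *
        ConstantRows.headSum (fun l => b (l + 1)) (row m a b c) i m =
      ConstantRows.tailSum (fun l => b (l + 1)) (row m a b c) 0 i := by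
  have hne : ∀ l < m, l ≠ i → b (i + 1) - b (l + 1) ≠ 0 := fun l hl hli =>
    sub_ne_zero.2 fun h => hli (by
      have := hb (by simp; omega) (by simp; omega) h
      omega)
  -- Adding `b (i + 1) - b (l + 1)` to `row l` replaces `b (l + 1)` by `b (i + 1)`, so each factor
  -- is a quotient of two linear forms.
  have hfac : ∀ l < m, l ≠ i → 1 + row m a b c l / (b (i + 1) - b (l + 1)) =
      (b (i + 1) + c (m - l) - a 2) / (b (i + 1) - b (l + 1)) := fun l hl hli => by
    have := hne l hl hli
    rw [row]
    field_simp
    ring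
  have hhead : ConstantRows.headSum (fun l => b (l + 1)) (row m a b c) i m =
      (∏ l ∈ Finset.Ico i m, (b (i + 1) + c (m - l) - a 2)) /
        ∏ l ∈ Finset.Ico (i + 1) m, (b (i + 1) - b (l + 1)) := by
    -- The leading coefficient `row i` of the head sum is the missing factor `l = i` of the
    -- numerator.
    rw [ConstantRows.headSum, Finset.prod_eq_prod_Ico_succ_bot hi, mul_div_assoc,
      ← Finset.prod_div_distrib]
    congr 1
    refine Finset.prod_congr rfl fun l hl => hfac l ?_ ?_ <;> simp at hl <;> omega
  have htail : ConstantRows.tailSum (fun l => b (l + 1)) (row m a b c) 0 i =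
      (∏ l ∈ Finset.Ico 0 i, (b (i + 1) + c (m - l) - a 2)) /
        ∏ l ∈ Finset.Ico 0 i, (b (i + 1) - b (l + 1)) := by
    rw [ConstantRows.tailSum, ← Finset.prod_div_distrib]
    refine Finset.prod_congr rfl fun l hl => hfac l ?_ ?_ <;> simp at hl <;> omega
  have h1 : ∏ l ∈ Finset.Ico (i + 1) m, (b (i + 1) - b (l + 1)) ≠ 0 :=
    Finset.prod_ne_zero_iff.2 fun l hl => hne l (by simp at hl; omega) (by simp at hl; omega)
  rw [hhead, htail]
  rw [num, den] at *
  rw [prod_Ico_sub_eq_prod_Icc (fun k => b (i + 1) + c k - a 2) le_rfl,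
    prod_Ico_sub_eq_prod_Icc (fun k => b (i + 1) + c k - a 2) hi.le,
    prod_Ico_succ_eq_prod_Icc (fun k => b (i + 1) - b k),
    prod_Ico_succ_eq_prod_Icc (fun k => b (i + 1) - b k)] at *
  rw [show m + 2 - (i + 1) = m + 1 - i by omega, show m + 1 - (i + 1) = m - i by omega,
    show i + 1 - 1 = i by omega] at *
  rw [show m + 1 - m = 1 by omega, show m - 0 = m by omega, show 0 + 1 = 1 from rfl] at *
  have h2 := left_ne_zero_of_mul hden
  have h3 := right_ne_zero_of_mul hden
  field_simp

theorem conj_entryA_apply {V W : Matrix (Fin m) (Fin m) ℂ} (hWV : W * V = 1) (i j : Fin m) :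
    (W * (oneBased m (entryB m a b c) + oneBased m (entryC m a b c)) * V) i j =
      (if i = j then a 2 else 0) + (∑ k, W i k * row m a b c k) * ∑ k, V k j := by
  rw [oneBased_entryA, mul_add, add_mul, Matrix.add_apply, Matrix.mul_smul, mul_one,
    Matrix.smul_mul, hWV]
  congr 1
  · simp [Matrix.one_apply]
  · rw [Matrix.mul_apply, Finset.mul_sum]
    exact Finset.sum_congr rfl fun k _ => by simp [Matrix.mul_apply]

theorem diagonalizable_entryC (hc : Set.InjOn (fun l => c (l + 1)) (Set.Iio m)) :
    DiagonalizableWithSpectrum (oneBased m (entryC m a b c)) fun i => c (i + 1) := by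
  refine DiagonalizableWithSpectrum.of_submatrix Fin.revPerm (Equiv.refl (Fin m))
    (x := fun i => c (i + 1)) (ConstantRows.leftMat_mul_rightMat hc
    (fun l => row m a b c (m - (l + 1)))) ?_
  rw [oneBased_entryC_submatrix]
  exact ConstantRows.mat_mul_rightMat hc _

/-- For the first index the product of the forms `b_1 + c_k - a_2` is empty and only differences of
the `b_k` are left. So the form is non-zero on the whole of `S'`. -/
theorem num_one_ne_zero (hb : Set.InjOn b (Finset.Icc 1 m)) (hm : 2 ≤ m) : num m a b c 1 ≠ 0 := by
  rw [num, Finset.Icc_eq_empty (a := m + 2 - 1) (by omega), Finset.prod_empty, mul_one]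
  refine Finset.prod_ne_zero_iff.2 fun k hk => sub_ne_zero.2 fun h => ?_
  simp only [Finset.mem_Icc] at hk
  have := hb (by simp; omega) (by simp; omega) h
  omega

end Hypergeometric

namespace SimpsonType

theorem isEigenbasis_hypergeometric_unique {m : ℕ} {hm : 2 ≤ m}
    {s : TripleSpace (hypergeometric m hm).dim} (hs : s ∈ (hypergeometric m hm).S)
    {v w : Module.Basis (Fin m) ℂ (Fin m → ℂ)} (hv : (hypergeometric m hm).IsEigenbasis s v)
    (hw : (hypergeometric m hm).IsEigenbasis s w) : w = v := by
  have hinj : Function.Injective s.2.1 := hasSpectralType_ones_iff.1 hs.2.1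
  refine Module.Basis.eq_of_apply_eq fun i => ?_
  exact eigenvector_unique (M := (hypergeometric m hm).matB s) hinj v (fun j => (hv j).1) (hw i).1
    (hv i).2.1 (hw i).2.1

theorem trace_matA {t : SimpsonType} {s : TripleSpace t.dim} (hs : s ∈ t.S)
    (hB : DiagonalizableWithSpectrum (t.matB s) s.2.1)
    (hC : DiagonalizableWithSpectrum (t.matC s) s.2.2) : (t.matA s).trace = ∑ i, s.1 i := by
  rw [hs.2.2.2, Finset.sum_add_distrib, matA, Matrix.trace_add, hB.trace_eq, hC.trace_eq]

theorem realizes_hypergeometric {m : ℕ} {hm : 2 ≤ m} {s : TripleSpace (hypergeometric m hm).dim}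
    (hs : s ∈ (hypergeometric m hm).S) : (hypergeometric m hm).Realizes s := by
  set a := (hypergeometric m hm).eigA s with ha
  set b := (hypergeometric m hm).eigB s with hb
  set c := (hypergeometric m hm).eigC s with hc
  set x : ℕ → ℂ := fun l => b (l + 1) with hxdef
  set r : ℕ → ℂ := Hypergeometric.row m a b c with hrdef
  have hbinj : Set.InjOn b (Finset.Icc 1 m) := by
    have := eigB_injOn hs
    rwa [show (hypergeometric m hm).typeB.length = m from Composition.ones_length m] at this
  have hcinj : Set.InjOn c (Finset.Icc 1 m) := eigC_injOn hs
  have hshift : ∀ {f : ℕ → ℂ}, Set.InjOn f (Finset.Icc 1 m) →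
      Set.InjOn (fun l => f (l + 1)) (Set.Iio m) := by
    intro f hf i hi j hj hij
    simp only [Set.mem_Iio] at hi hj
    have := hf (by simp; omega) (by simp; omega) hij
    omega
  have hx := hshift hbinj
  have hspecB : s.2.1 = fun i : Fin m => x i := funext fun i => specB_hypergeometric i
  have hspecC : s.2.2 = fun i : Fin m => c (i + 1) := funext fun i => specC_of_mem_S i
  have hBV := ConstantRows.mat_mul_rightMat hx r
  have hWV := ConstantRows.leftMat_mul_rightMat hx r
  have hBV' : oneBased m (Hypergeometric.entryB m a b c) * ConstantRows.rightMat m x r =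
      ConstantRows.rightMat m x r * Matrix.diagonal fun i : Fin m => x i := by
    rw [← hBV, Hypergeometric.oneBased_entryB]
  have hB : DiagonalizableWithSpectrum ((hypergeometric m hm).matB s) s.2.1 := by
    rw [hspecB]
    exact .of_inverse hWV hBV'
  have hC : DiagonalizableWithSpectrum ((hypergeometric m hm).matC s) s.2.2 := by
    rw [hspecC]
    exact Hypergeometric.diagonalizable_entryC (hshift hcinj)
  have hBconj : ConstantRows.leftMat m x r * oneBased m (Hypergeometric.entryB m a b c) *
      ConstantRows.rightMat m x r = Matrix.diagonal fun i : Fin m => x i := by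
    rw [Hypergeometric.oneBased_entryB, Matrix.mul_assoc, hBV, ← Matrix.mul_assoc, hWV, one_mul]
  have hBsym : ∀ (l : Fin m → ℂ) (i j : Fin m),
      l i * (ConstantRows.leftMat m x r * oneBased m (Hypergeometric.entryB m a b c) *
        ConstantRows.rightMat m x r) i j =
      l j * (ConstantRows.leftMat m x r * oneBased m (Hypergeometric.entryB m a b c) *
        ConstantRows.rightMat m x r) j i := by
    intro l i j
    rw [hBconj]
    by_cases h : i = j
    · rw [h]
    · rw [Matrix.diagonal_apply_ne _ h, Matrix.diagonal_apply_ne' _ h]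
      ring
  refine realizes_of_eigenvectors (V := ConstantRows.rightMat m x r)
    (W := ConstantRows.leftMat m x r) ?_ hB hC hWV ?_
    (fun v w => isEigenbasis_hypergeometric_unique hs) (fun _ => hBsym _) ?_
    (fun _ => ⟨⟨0, by change 0 < m; omega⟩, Hypergeometric.num_one_ne_zero hbinj hm⟩)
  · refine DiagonalizableWithSpectrum.of_quadratic (eigA_ne hs) (fun i => ?_) (trace_matA hs hB hC)
      (Hypergeometric.quadratic (trace_hypergeometric hs))
    have := specA_hypergeometric hs i
    split_ifs at this
    · exact Or.inl this
    · exact Or.inr this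
  · intro v hv i
    have hv' : ∀ j, v i j = ConstantRows.rightMat m x r j i := fun j => congrFun (hv i) j
    refine ⟨?_, ?_, fun j hj => ?_⟩
    · rw [hv, hspecB]
      exact mulVec_eq_smul_of_mul_eq hBV' i
    · exact (hv' i).trans (ConstantRows.rightMat_apply_self x r i)
    · exact (hv' j).trans (ConstantRows.rightMat_apply_of_lt x r hj)
  · intro hs' i j
    have hl : ∀ k : Fin m, Hypergeometric.num m a b c (k + 1) / Hypergeometric.den m a b c (k + 1) *
        ConstantRows.headSum x r k m = ConstantRows.tailSum x r 0 k := fun k =>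
      Hypergeometric.num_mul_headSum hbinj k.2 (hs'.2 k)
    have hA : ∀ l : Fin m → ℂ, (∀ k, l k * ConstantRows.headSum x r k m =
        ConstantRows.tailSum x r 0 k) → ∀ i j : Fin m, l i * (ConstantRows.leftMat m x r *
        oneBased m (Hypergeometric.entryC m a b c) *
        ConstantRows.rightMat m x r) i j = l j * (ConstantRows.leftMat m x r *
        oneBased m (Hypergeometric.entryC m a b c) * ConstantRows.rightMat m x r) j i := by
      intro l hl i j
      -- Adding the symmetric contribution of `B` replaces `C` by `A`, for which the rank-one
      -- expression is available.
      refine add_left_cancel (a := l i * (ConstantRows.leftMat m x r *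
        oneBased m (Hypergeometric.entryB m a b c) * ConstantRows.rightMat m x r) i j) ?_
      conv_rhs => rw [hBsym]
      rw [← mul_add, ← mul_add, ← Matrix.add_apply, ← Matrix.add_apply, ← add_mul, ← mul_add,
        Hypergeometric.conj_entryA_apply hWV, Hypergeometric.conj_entryA_apply hWV,
        ConstantRows.leftMat_mulVec, ConstantRows.leftMat_mulVec, ConstantRows.sum_rightMat,
        ConstantRows.sum_rightMat, mul_add, mul_add, ← mul_assoc, ← mul_assoc, hl, hl]
      by_cases h : i = j
      · rw [h]
      · rw [if_neg h, if_neg (Ne.symm h)]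
        ring
    exact hA _ hl i j

end SimpsonType

end

noncomputable section

/-! ### Lagrange interpolation sums -/

section Lagrange

open Polynomial

variable {U W : Type*} [Fintype U] [DecidableEq U] [Fintype W] [DecidableEq W]

/-- Subtracting the nodal polynomial `∏ (X - u x)` from `P` does not change the values at the nodes
and lowers the degree below the number of nodes. The sum is then the top Lagrange coefficient of the
difference. -/
theorem sum_eval_div_prod_sub {u : U → ℂ} (hu : Function.Injective u) {P : ℂ[X]} (hP : P.Monic)
    (hdeg : P.natDegree = Fintype.card U) (hU : 0 < Fintype.card U) :
    ∑ x, P.eval (u x) / ∏ y ∈ Finset.univ.erase x, (u x - u y) = P.nextCoeff + ∑ x, u x := by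
  set N := Lagrange.nodal Finset.univ u with hN
  have hNdeg : N.natDegree = Fintype.card U := by simp [hN, Lagrange.natDegree_nodal]
  have hlt : (P - N).degree < (Finset.univ : Finset U).card := by
    have : (P - N).degree < P.degree := by
      refine degree_sub_lt_left ?_ hP.ne_zero ?_
      · rw [degree_eq_natDegree hP.ne_zero, hdeg, hN, Lagrange.degree_nodal, Finset.card_univ]
      · rw [hP.leadingCoeff, Lagrange.nodal_monic.leadingCoeff]
    rwa [degree_eq_natDegree hP.ne_zero, hdeg] at this
  have h := Lagrange.coeff_eq_sum (s := Finset.univ) (v := u) hu.injOn hlt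
  have hev : ∀ x, (P - N).eval (u x) = P.eval (u x) := fun x => by
    rw [eval_sub, hN, Lagrange.eval_nodal_at_node (Finset.mem_univ x), sub_zero]
  simp only [hev] at h
  rw [← h, coeff_sub, Finset.card_univ]
  have hnext : N.nextCoeff = -∑ x, u x := by
    rw [hN, Lagrange.nodal_eq, prod_X_sub_C_nextCoeff]
  rw [nextCoeff_of_natDegree_pos (by omega), hNdeg] at hnext
  rw [nextCoeff_of_natDegree_pos (by omega), hdeg, hnext, sub_neg_eq_add]

/-- Partial fractions of `P / ∏ (X - u x)`; the polynomial part is `1` since both polynomials are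
monic of the same degree. -/
theorem one_add_sum_eval_div {u : U → ℂ} (hu : Function.Injective u) {P : ℂ[X]} (hP : P.Monic)
    (hdeg : P.natDegree = Fintype.card U) {t : ℂ} (ht : ∀ x, t ≠ u x) :
    1 + ∑ x, P.eval (u x) / ((∏ y ∈ Finset.univ.erase x, (u x - u y)) * (t - u x)) =
      P.eval t / ∏ x, (t - u x) := by
  set N := Lagrange.nodal Finset.univ u with hN
  have hlt : (P - N).degree < (Finset.univ : Finset U).card := by
    have : (P - N).degree < P.degree := by
      refine degree_sub_lt_left ?_ hP.ne_zero ?_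
      · rw [degree_eq_natDegree hP.ne_zero, hdeg, hN, Lagrange.degree_nodal, Finset.card_univ]
      · rw [hP.leadingCoeff, Lagrange.nodal_monic.leadingCoeff]
    rwa [degree_eq_natDegree hP.ne_zero, hdeg] at this
  have h := congrArg (eval t) (Lagrange.eq_interpolate hu.injOn hlt)
  rw [Lagrange.eval_interpolate_not_at_node _ fun i _ => ht i, ← hN] at h
  have hev : ∀ x, (P - N).eval (u x) = P.eval (u x) := fun x => by
    rw [eval_sub, hN, Lagrange.eval_nodal_at_node (Finset.mem_univ x), sub_zero]
  simp only [hev, eval_sub] at h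
  have hNt : N.eval t = ∏ x, (t - u x) := by rw [hN, Lagrange.eval_nodal]
  have hN0 : ∏ x, (t - u x) ≠ 0 := Finset.prod_ne_zero_iff.2 fun x _ => sub_ne_zero.2 (ht x)
  rw [eq_div_iff hN0, ← hNt, eq_add_of_sub_eq h, mul_comm, mul_add, mul_one, add_comm]
  congr 2
  refine Finset.sum_congr rfl fun x _ => ?_
  rw [Lagrange.nodalWeight, Finset.prod_inv_distrib, div_eq_mul_inv, mul_inv]
  ring

/-- Residues of the rational function `φ(t) ∏ (t + w_y + σ) / ∏ (t - u_x)`. -/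
structure IsResidue (u : U → ℂ) (w : W → ℂ) (σ : ℂ) (φ : ℂ[X]) (R : U → ℂ) : Prop where
  injective : Function.Injective u
  monic : φ.Monic
  natDegree : φ.natDegree + Fintype.card W = Fintype.card U + 1
  eq : ∀ x, R x * ∏ y ∈ Finset.univ.erase x, (u x - u y) =
    φ.eval (u x) * ∏ y, (u x + w y + σ)
  ne : ∀ x y, u x + w y + σ ≠ 0

namespace IsResidue

variable {u : U → ℂ} {w : W → ℂ} {σ : ℂ} {φ : ℂ[X]} {R : U → ℂ}

/-- The division cancels one factor of the residue. By the degree condition in `IsResidue` the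
remaining polynomial has degree exactly the number of nodes, as the two Lagrange sums require. -/
theorem div_eq (h : IsResidue u w σ φ R) (x : U) (y : W) : R x / (u x + w y + σ) =
    (φ * ∏ y' ∈ Finset.univ.erase y, (X + C (w y' + σ))).eval (u x) /
      ∏ x' ∈ Finset.univ.erase x, (u x - u x') := by
  have h1 : ∏ x' ∈ Finset.univ.erase x, (u x - u x') ≠ 0 :=
    Finset.prod_ne_zero_iff.2 fun x' hx' =>
      sub_ne_zero.2 fun h' => (Finset.mem_erase.1 hx').1 (h.injective h').symm
  rw [div_eq_div_iff (h.ne x y) h1, h.eq, eval_mul, eval_prod,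
    ← Finset.mul_prod_erase Finset.univ _ (Finset.mem_univ y)]
  simp only [eval_add, eval_X, eval_C, add_assoc]
  ring

theorem monic_mul (h : IsResidue u w σ φ R) (y : W) :
    (φ * ∏ y' ∈ Finset.univ.erase y, (X + C (w y' + σ))).Monic :=
  h.monic.mul (monic_prod_of_monic _ _ fun _ _ => monic_X_add_C _)

theorem natDegree_mul (h : IsResidue u w σ φ R) (y : W) :
    (φ * ∏ y' ∈ Finset.univ.erase y, (X + C (w y' + σ))).natDegree = Fintype.card U := by
  rw [h.monic.natDegree_mul (monic_prod_of_monic _ _ fun _ _ => monic_X_add_C _),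
    natDegree_prod_of_monic _ _ fun _ _ => monic_X_add_C _]
  simp only [natDegree_X_add_C, Finset.sum_const, smul_eq_mul, mul_one]
  rw [Finset.card_erase_of_mem (Finset.mem_univ y), Finset.card_univ]
  have := h.natDegree
  have : 0 < Fintype.card W := Fintype.card_pos_iff.2 ⟨y⟩
  omega

theorem sum_div (h : IsResidue u w σ φ R) (hU : 0 < Fintype.card U) (y : W) :
    ∑ x, R x / (u x + w y + σ) =
      φ.nextCoeff + ∑ y' ∈ Finset.univ.erase y, (w y' + σ) + ∑ x, u x := by
  simp only [h.div_eq]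
  rw [sum_eval_div_prod_sub h.injective (h.monic_mul y) (h.natDegree_mul y) hU,
    h.monic.nextCoeff_mul (monic_prod_of_monic _ _ fun _ _ => monic_X_add_C _),
    Monic.nextCoeff_prod _ _ fun _ _ => monic_X_add_C _]
  simp only [nextCoeff_X_add_C]

theorem one_add_sum_div (h : IsResidue u w σ φ R) (y : W) {t : ℂ} (ht : ∀ x, t ≠ u x) :
    1 + ∑ x, R x / ((u x + w y + σ) * (t - u x)) =
      φ.eval t * (∏ y' ∈ Finset.univ.erase y, (t + w y' + σ)) / ∏ x, (t - u x) := by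
  have h1 := one_add_sum_eval_div h.injective (h.monic_mul y) (h.natDegree_mul y) ht
  rw [eval_mul, eval_prod] at h1
  simp only [eval_add, eval_X, eval_C, ← add_assoc] at h1
  rw [← h1]
  congr 1
  refine Finset.sum_congr rfl fun x _ => ?_
  rw [← div_div, h.div_eq, div_div]

/-- The partial fraction expansion at `t = -w y - σ`, the zero of the cancelled factor: there `t - u
x = -(u x + w y + σ)`, which produces the squares. -/
theorem mul_one_sub_sum_div_sq (h : IsResidue u w σ φ R) (y : W) :
    (1 - ∑ x, R x / (u x + w y + σ) ^ 2) * ∏ x, (u x + w y + σ) =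
      (-1) ^ (Fintype.card U + Fintype.card W + 1) * φ.eval (-(w y) - σ) *
        ∏ y' ∈ Finset.univ.erase y, (w y - w y') := by
  have ht : ∀ x, -(w y) - σ ≠ u x := fun x hx => h.ne x y (by rw [← hx]; ring)
  have h1 := h.one_add_sum_div y ht
  have h2 : ∏ x, (-(w y) - σ - u x) = (-1) ^ Fintype.card U * ∏ x, (u x + w y + σ) := by
    rw [← Finset.card_univ, ← Finset.prod_const, ← Finset.prod_mul_distrib]
    exact Finset.prod_congr rfl fun x _ => by ring
  have h3 : ∏ y' ∈ Finset.univ.erase y, (-(w y) - σ + w y' + σ) =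
      (-1) ^ (Fintype.card W + 1) * ∏ y' ∈ Finset.univ.erase y, (w y - w y') := by
    have h4 : (-1 : ℂ) ^ (Fintype.card W + 1) = (-1) ^ (Finset.univ.erase y).card := by
      rw [Finset.card_erase_of_mem (Finset.mem_univ y), Finset.card_univ]
      have : 0 < Fintype.card W := Fintype.card_pos_iff.2 ⟨y⟩
      rw [show Fintype.card W + 1 = Fintype.card W - 1 + 2 by omega, pow_add]
      simp
    rw [h4, ← Finset.prod_const, ← Finset.prod_mul_distrib]
    exact Finset.prod_congr rfl fun x _ => by ring
  have h5 : ∑ x, R x / ((u x + w y + σ) * (-(w y) - σ - u x)) =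
      -∑ x, R x / (u x + w y + σ) ^ 2 := by
    rw [← Finset.sum_neg_distrib]
    refine Finset.sum_congr rfl fun x _ => ?_
    have := h.ne x y
    rw [show -(w y) - σ - u x = -(u x + w y + σ) by ring]
    field_simp
  have h6 : ∏ x, (u x + w y + σ) ≠ 0 := Finset.prod_ne_zero_iff.2 fun x _ => h.ne x y
  rw [h5, h2, h3, ← sub_eq_add_neg] at h1
  rw [h1]
  have h7 : ((-1 : ℂ) ^ Fintype.card U) * (-1) ^ Fintype.card U = 1 := by
    rw [← mul_pow]; simp
  have h8 : (-1 : ℂ) ^ Fintype.card U ≠ 0 := by simp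
  field_simp
  rw [pow_add, pow_add, pow_one]
  linear_combination (φ.eval (-w y - σ) * (∏ y' ∈ Finset.univ.erase y, (w y - w y')) *
    (-1) ^ Fintype.card W) * h7

/-- Partial fractions reduce the product of denominators to the difference of two sums `sum_div`,
and these differ by exactly `w y' - w y`. -/
theorem sum_div_mul (h : IsResidue u w σ φ R) (hU : 0 < Fintype.card U) {y y' : W}
    (hy : w y ≠ w y') : ∑ x, R x / ((u x + w y + σ) * (u x + w y' + σ)) = 1 := by
  have h1 : ∀ x, R x / ((u x + w y + σ) * (u x + w y' + σ)) =
      (R x / (u x + w y + σ) - R x / (u x + w y' + σ)) / (w y' - w y) := fun x => by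
    have := h.ne x y
    have := h.ne x y'
    have := sub_ne_zero.2 hy.symm
    field_simp
    ring
  simp only [h1]
  rw [← Finset.sum_div, Finset.sum_sub_distrib, h.sum_div hU, h.sum_div hU,
    div_eq_one_iff_eq (sub_ne_zero.2 hy.symm)]
  have h2 := Finset.add_sum_erase Finset.univ (fun x => w x + σ) (Finset.mem_univ y)
  have h3 := Finset.add_sum_erase Finset.univ (fun x => w x + σ) (Finset.mem_univ y')
  linear_combination h2 - h3

end IsResidue

end Lagrange

end

/-! ### Pairs of matrices of Cauchy type: the quadratic relations. -/

noncomputable section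

/-- Eigenvalues and coefficients of a pair of matrices of Cauchy type. -/
structure CauchyData (U W : Type) where
  /-- eigenvalues of `C` in the second block -/
  u : U → ℂ
  /-- eigenvalues of `C` in the third block -/
  w : W → ℂ
  /-- eigenvalue of `C` in the first block -/
  z : ℂ
  /-- first eigenvalue of `B` -/
  b₁ : ℂ
  /-- second eigenvalue of `B` -/
  b₂ : ℂ
  /-- third eigenvalue of `B` -/
  b₃ : ℂ
  /-- first eigenvalue of `A` -/
  a₁ : ℂ
  /-- second eigenvalue of `A` -/
  a₂ : ℂ
  /-- column coefficients, second block -/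
  F : U → ℂ
  /-- row coefficients, second block -/
  F' : U → ℂ
  /-- row coefficients, third block -/
  G : W → ℂ
  /-- column coefficients, third block -/
  G' : W → ℂ

namespace CauchyData

variable {U W : Type}

/-- The index set: third, second and first block. -/
abbrev Index (U W : Type) : Type := W ⊕ U ⊕ Unit

/-- The number of the block, counted from the end. -/
def level : Index U W → ℕ := Sum.elim (fun _ => 0) (Sum.elim (fun _ => 1) fun _ => 2)

theorem level_le_two (i : Index U W) : level i ≤ 2 := by
  rcases i with y | x | _ <;> simp [level]

variable (D : CauchyData U W)

/-- The shift in the denominators. -/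
def σ : ℂ := D.b₂ + D.b₃ - D.a₁ - D.a₂

/-- The spectrum of `C`. -/
def specC : Index U W → ℂ := Sum.elim D.w (Sum.elim D.u fun _ => D.z)

/-- The spectrum of `B`. -/
def specB : Index U W → ℂ := Sum.elim (fun _ => D.b₃) (Sum.elim (fun _ => D.b₂) fun _ => D.b₁)

/-- The nilpotent part of `B`. -/
def nilB : Matrix (Index U W) (Index U W) ℂ := Matrix.of fun i j =>
  match i, j with
  | Sum.inr (Sum.inl x), Sum.inl y => D.F x * D.G y / (D.u x + D.w y + D.σ)
  | Sum.inr (Sum.inr _), Sum.inl y => D.G y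
  | Sum.inr (Sum.inr _), Sum.inr (Sum.inl x) => D.F' x
  | _, _ => 0

/-- The nilpotent part of `C`. -/
def nilC : Matrix (Index U W) (Index U W) ℂ := Matrix.of fun i j =>
  match i, j with
  | Sum.inl y, Sum.inr (Sum.inl x) => D.G' y * D.F' x / (D.u x + D.w y + D.σ)
  | Sum.inl y, Sum.inr (Sum.inr _) => -D.G' y
  | Sum.inr (Sum.inl x), Sum.inr (Sum.inr _) => -D.F x
  | _, _ => 0

theorem nilB_eq_zero (i j : Index U W) (h : ¬ 2 - level i < 2 - level j) : D.nilB i j = 0 := by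
  rcases i with y | x | _ <;> rcases j with y' | x' | _ <;> simp [level] at h <;> rfl

theorem nilC_eq_zero (i j : Index U W) (h : ¬ level i < level j) : D.nilC i j = 0 := by
  rcases i with y | x | _ <;> rcases j with y' | x' | _ <;> simp [level] at h <;> rfl

variable [Fintype U] [DecidableEq U] [Fintype W] [DecidableEq W]

/-- The matrix `B`. -/
def matB : Matrix (Index U W) (Index U W) ℂ := Matrix.diagonal D.specB + D.nilB

/-- The matrix `C`. -/
def matC : Matrix (Index U W) (Index U W) ℂ := Matrix.diagonal D.specC + D.nilC

/-- The matrix `A`. -/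
def matA : Matrix (Index U W) (Index U W) ℂ := D.matB + D.matC

variable {D} {φ ψ : Polynomial ℂ}

/-- The relations between eigenvalues and coefficients, and the inequalities that hold for generic
eigenvalues. -/
structure IsGeneric (D : CauchyData U W) (φ ψ : Polynomial ℂ) : Prop where
  resF : IsResidue D.u D.w D.σ φ fun x => D.F x * D.F' x
  resG : IsResidue D.w D.u D.σ ψ fun y => D.G y * D.G' y
  sumF : φ.nextCoeff + ∑ y, (D.w y + D.σ) + ∑ x, D.u x = D.σ - (D.b₁ + D.z + D.b₃ - D.a₁ - D.a₂)
  sumG : ψ.nextCoeff + ∑ x, (D.u x + D.σ) + ∑ y, D.w y = D.σ - (D.b₁ + D.z + D.b₂ - D.a₁ - D.a₂)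
  eval_mul_eval : ∀ t, (-1) ^ (Fintype.card U + Fintype.card W + 1) * φ.eval t * ψ.eval (-t - D.σ) =
    (D.b₂ + t - D.a₁) * (D.b₂ + t - D.a₂)
  specC_injective : Function.Injective D.specC
  specC_add_ne : ∀ i j, i ≠ j → D.specC i + D.specC j + D.σ ≠ 0
  F_ne : ∀ x, D.F x ≠ 0
  nonemptyU : Nonempty U
  nonemptyW : Nonempty W

namespace IsGeneric

/-- `sum_div` omits the summand `w y + σ`; the full sum is given by the field `sumF`, which stands
for the trace condition. -/
theorem sum_F_div (h : D.IsGeneric φ ψ) (y : W) :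
    ∑ x, D.F x * D.F' x / (D.u x + D.w y + D.σ) =
      -(D.b₁ + D.z + D.b₃ + D.w y - D.a₁ - D.a₂) := by
  have h1 := h.resF.sum_div (Fintype.card_pos_iff.2 h.nonemptyU) y
  have h2 := Finset.add_sum_erase Finset.univ (fun x => D.w x + D.σ) (Finset.mem_univ y)
  have h3 := h.sumF
  rw [h1]
  linear_combination h3 + h2

theorem sum_G_div (h : D.IsGeneric φ ψ) (x : U) :
    ∑ y, D.G y * D.G' y / (D.u x + D.w y + D.σ) =
      -(D.b₁ + D.z + D.b₂ + D.u x - D.a₁ - D.a₂) := by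
  have h1 := h.resG.sum_div (Fintype.card_pos_iff.2 h.nonemptyW) x
  have h2 := Finset.add_sum_erase Finset.univ (fun y => D.u y + D.σ) (Finset.mem_univ x)
  have h3 := h.sumG
  simp only [add_comm (D.u x) (D.w _)]
  rw [h1]
  linear_combination h3 + h2

theorem sum_F_div_mul (h : D.IsGeneric φ ψ) {y y' : W} (hy : y ≠ y') :
    ∑ x, D.F x * D.F' x / ((D.u x + D.w y + D.σ) * (D.u x + D.w y' + D.σ)) = 1 :=
  h.resF.sum_div_mul (Fintype.card_pos_iff.2 h.nonemptyU) fun h' => hy (h.resG.injective h')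

theorem sum_G_div_mul (h : D.IsGeneric φ ψ) {x x' : U} (hx : x ≠ x') :
    ∑ y, D.G y * D.G' y / ((D.u x + D.w y + D.σ) * (D.u x' + D.w y + D.σ)) = 1 := by
  have := h.resG.sum_div_mul (Fintype.card_pos_iff.2 h.nonemptyW) fun h' => hx (h.resF.injective h')
  simpa only [add_comm (D.w _) (D.u _)] using this

/-- The residue at `u x` is multiplied by the value of the dual partial fraction at `-u x - σ`. All
products of differences and of sums cancel, and the rest is `± φ(u x) ψ(-u x - σ)`, which
`eval_mul_eval` factors. -/
theorem F_mul_sum (h : D.IsGeneric φ ψ) (x : U) :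
    D.F x * D.F' x * (1 - ∑ y, D.G y * D.G' y / (D.u x + D.w y + D.σ) ^ 2) =
      (D.b₂ + D.u x - D.a₁) * (D.b₂ + D.u x - D.a₂) := by
  have h1 := h.resG.mul_one_sub_sum_div_sq x
  simp only [add_comm (D.w _) (D.u _)] at h1
  have h2 := h.resF.eq x
  have h3 : ∏ y, (D.u x + D.w y + D.σ) ≠ 0 := Finset.prod_ne_zero_iff.2 fun y _ => h.resF.ne x y
  have h4 : ∏ y ∈ Finset.univ.erase x, (D.u x - D.u y) ≠ 0 :=
    Finset.prod_ne_zero_iff.2 fun x' hx' =>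
      sub_ne_zero.2 fun h' => (Finset.mem_erase.1 hx').1 (h.resF.injective h').symm
  rw [← h.eval_mul_eval]
  apply mul_right_cancel₀ h3
  apply mul_right_cancel₀ h4
  rw [add_comm (Fintype.card W)] at h1
  linear_combination (D.F x * D.F' x * ∏ y ∈ Finset.univ.erase x, (D.u x - D.u y)) * h1 +
    ((-1) ^ (Fintype.card U + Fintype.card W + 1) * ψ.eval (-D.u x - D.σ) *
      ∏ y ∈ Finset.univ.erase x, (D.u x - D.u y)) * h2

theorem G_mul_sum (h : D.IsGeneric φ ψ) (y : W) :
    D.G y * D.G' y * (1 - ∑ x, D.F x * D.F' x / (D.u x + D.w y + D.σ) ^ 2) =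
      (D.b₃ + D.w y - D.a₁) * (D.b₃ + D.w y - D.a₂) := by
  have h1 := h.resF.mul_one_sub_sum_div_sq y
  have h2 := h.resG.eq y
  simp only [add_comm (D.w _) (D.u _)] at h2
  have h3 : ∏ x, (D.u x + D.w y + D.σ) ≠ 0 := Finset.prod_ne_zero_iff.2 fun x _ => h.resF.ne x y
  have h4 : ∏ x ∈ Finset.univ.erase y, (D.w y - D.w x) ≠ 0 :=
    Finset.prod_ne_zero_iff.2 fun x' hx' =>
      sub_ne_zero.2 fun h' => (Finset.mem_erase.1 hx').1 (h.resG.injective h').symm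
  have h5 := h.eval_mul_eval (-D.w y - D.σ)
  rw [show -(-D.w y - D.σ) - D.σ = D.w y by ring] at h5
  -- The reflection `t ↦ -t - σ` exchanges `b₂` and `b₃`: it swaps the two factors and changes both
  -- signs.
  have h6 : (D.b₃ + D.w y - D.a₁) * (D.b₃ + D.w y - D.a₂) =
      (D.b₂ + (-D.w y - D.σ) - D.a₁) * (D.b₂ + (-D.w y - D.σ) - D.a₂) := by rw [σ]; ring
  rw [h6, ← h5]
  apply mul_right_cancel₀ h3
  apply mul_right_cancel₀ h4
  linear_combination (D.G y * D.G' y * ∏ x ∈ Finset.univ.erase y, (D.w y - D.w x)) * h1 +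
    ((-1) ^ (Fintype.card U + Fintype.card W + 1) * φ.eval (-D.w y - D.σ) *
      ∏ x ∈ Finset.univ.erase y, (D.w y - D.w x)) * h2

/-- The quadratic relation for `A`, up to one entry. -/
theorem quadratic_apply (h : D.IsGeneric φ ψ) (i j : Index U W)
    (hij : i ≠ Sum.inr (Sum.inr ()) ∨ j ≠ Sum.inr (Sum.inr ())) :
    (D.matA * D.matA) i j =
      ((D.a₁ + D.a₂) • D.matA - (D.a₁ * D.a₂) • (1 : Matrix (Index U W) (Index U W) ℂ)) i j := by
  rw [Matrix.mul_apply]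
  rcases i with y | x | _ <;> rcases j with y' | x' | _
  all_goals
    simp only [Fintype.sum_sum_type, matA, matB, matC, specB, specC, nilB, nilC, Matrix.add_apply,
      Matrix.sub_apply, Matrix.smul_apply, Matrix.one_apply, Matrix.diagonal_apply, Matrix.of_apply,
      Sum.elim_inl, Sum.elim_inr, Sum.inl.injEq, Sum.inr.injEq, reduceCtorEq, if_true, if_false,
      Finset.univ_unique, Finset.sum_singleton, add_zero, zero_add, smul_eq_mul, mul_zero, zero_mul,
      sub_zero, PUnit.default_eq_unit, add_mul, mul_add, ite_mul, mul_ite, Finset.sum_add_distrib,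
      Finset.sum_ite_eq, Finset.sum_ite_eq', Finset.mem_univ, Finset.sum_const_zero]
  · have e : ∀ x, D.G' y * D.F' x / (D.u x + D.w y + D.σ) * (D.F x * D.G y' /
        (D.u x + D.w y' + D.σ)) = D.G' y * D.G y' * (D.F x * D.F' x /
        ((D.u x + D.w y + D.σ) * (D.u x + D.w y' + D.σ))) := fun x => by
      rw [div_mul_div_comm, mul_div_assoc']; congr 1; ring
    simp only [e, ← Finset.mul_sum]
    by_cases hy : y = y'
    · subst hy
      have := h.G_mul_sum y
      simp only [if_true, ← pow_two] at this ⊢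
      linear_combination -this
    · simp only [if_neg hy, h.sum_F_div_mul hy]
      ring
  -- The path through the first block contributes `-G' y * F' x'`, which is minus this entry times
  -- `u x' + w y + σ`. The choice of `σ` leaves just the coefficient `a₁ + a₂`.
  · have := h.resF.ne x' y
    rw [σ] at *
    field_simp
    ring
  · have e : ∀ x, D.G' y * D.F' x / (D.u x + D.w y + D.σ) * -D.F x =
        -D.G' y * (D.F x * D.F' x / (D.u x + D.w y + D.σ)) := fun x => by ring
    simp only [e, ← Finset.mul_sum, h.sum_F_div]
    ring
  · have := h.resF.ne x y'
    rw [σ] at *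
    field_simp
    ring
  · have e : ∀ y, D.F x * D.G y / (D.u x + D.w y + D.σ) * (D.G' y * D.F' x' /
        (D.u x' + D.w y + D.σ)) = D.F x * D.F' x' * (D.G y * D.G' y /
        ((D.u x + D.w y + D.σ) * (D.u x' + D.w y + D.σ))) := fun y => by
      rw [div_mul_div_comm, mul_div_assoc']; congr 1; ring
    simp only [e, ← Finset.mul_sum]
    by_cases hx : x = x'
    · subst hx
      have := h.F_mul_sum x
      simp only [if_true, ← pow_two] at this ⊢
      linear_combination -this
    · simp only [if_neg hx, h.sum_G_div_mul hx]
      ring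
  · have e : ∀ y, D.F x * D.G y / (D.u x + D.w y + D.σ) * -D.G' y =
        -D.F x * (D.G y * D.G' y / (D.u x + D.w y + D.σ)) := fun y => by ring
    simp only [e, ← Finset.mul_sum, h.sum_G_div]
    ring
  · have e : ∀ x, D.F' x * (D.F x * D.G y' / (D.u x + D.w y' + D.σ)) =
        D.G y' * (D.F x * D.F' x / (D.u x + D.w y' + D.σ)) := fun x => by ring
    simp only [e, ← Finset.mul_sum, h.sum_F_div]
    ring
  · have e : ∀ y, D.G y * (D.G' y * D.F' x' / (D.u x' + D.w y + D.σ)) =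
        D.F' x' * (D.G y * D.G' y / (D.u x' + D.w y + D.σ)) := fun y => by ring
    simp only [e, ← Finset.mul_sum, h.sum_G_div]
    ring
  · simp at hij

/-- The defect `M` of the relation is a polynomial in `matA`, so it commutes with `matA`, and by
`quadratic_apply` it has at most one non-zero entry, at the corner of the first block. Comparing
`matA * M` with `M * matA` just outside the corner gives `F x` times that entry equal to zero. -/
theorem quadratic (h : D.IsGeneric φ ψ) :
    D.matA * D.matA =
      (D.a₁ + D.a₂) • D.matA - (D.a₁ * D.a₂) • (1 : Matrix (Index U W) (Index U W) ℂ) := by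
  set M := D.matA * D.matA -
    ((D.a₁ + D.a₂) • D.matA - (D.a₁ * D.a₂) • (1 : Matrix (Index U W) (Index U W) ℂ)) with hM
  have h0 : ∀ i j, (i ≠ Sum.inr (Sum.inr ()) ∨ j ≠ Sum.inr (Sum.inr ())) → M i j = 0 :=
    fun i j hij => sub_eq_zero.2 (h.quadratic_apply i j hij)
  have hcomm : D.matA * M = M * D.matA := by
    simp only [hM, mul_sub, sub_mul, Matrix.mul_smul, Matrix.smul_mul, mul_one, one_mul,
      Matrix.mul_assoc]
  obtain ⟨x⟩ := h.nonemptyU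
  have h1 := congrFun (congrFun hcomm (Sum.inr (Sum.inl x))) (Sum.inr (Sum.inr ()))
  rw [Matrix.mul_apply, Matrix.mul_apply, Finset.sum_eq_single (Sum.inr (Sum.inr ())),
    Finset.sum_eq_zero] at h1
  · have h2 : D.matA (Sum.inr (Sum.inl x)) (Sum.inr (Sum.inr ())) = -D.F x := by
      simp [matA, matB, matC, nilB, nilC]
    rw [h2] at h1
    have h3 := (mul_eq_zero.1 h1).resolve_left (neg_ne_zero.2 (h.F_ne x))
    ext i j
    rw [← sub_eq_zero]
    by_cases hij : i ≠ Sum.inr (Sum.inr ()) ∨ j ≠ Sum.inr (Sum.inr ())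
    · exact h0 i j hij
    · push Not at hij
      rw [hij.1, hij.2]
      exact h3
  · intro k _
    rw [h0 _ _ (Or.inl (by simp)), zero_mul]
  · intro k _ hk
    rw [h0 _ _ (Or.inl hk), mul_zero]
  · simp

end IsGeneric

variable (D) in
/-- The only non-zero row of `(B - b₂)(B - b₃)`. -/
def η : Index U W → ℂ :=
  Sum.elim (fun y => -(D.w y + D.z + D.σ) * D.G y)
    (Sum.elim (fun x => (D.b₁ - D.b₃) * D.F' x) fun _ => (D.b₁ - D.b₂) * (D.b₁ - D.b₃))

namespace IsGeneric

/-- Apart from the row of the first block, `B` involves only the eigenvalues `b₂` and `b₃`, so `(B -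
b₂)(B - b₃)` lives in that row. The sum in it is given by `sum_F_div`. -/
theorem matB_mul_matB (h : D.IsGeneric φ ψ) :
    D.matB * D.matB = (D.b₂ + D.b₃) • D.matB -
      (D.b₂ * D.b₃) • (1 : Matrix (Index U W) (Index U W) ℂ) +
      Matrix.of (fun i j => if i = Sum.inr (Sum.inr ()) then D.η j else 0) := by
  ext i j
  rw [Matrix.mul_apply]
  rcases i with y | x | _ <;> rcases j with y' | x' | _
  all_goals
    simp only [Fintype.sum_sum_type, η, matB, specB, nilB, Matrix.add_apply,
      Matrix.sub_apply, Matrix.smul_apply, Matrix.one_apply, Matrix.diagonal_apply, Matrix.of_apply,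
      Sum.elim_inl, Sum.elim_inr, Sum.inl.injEq, Sum.inr.injEq, reduceCtorEq, if_true, if_false,
      Finset.univ_unique, add_zero, zero_add, smul_eq_mul, mul_zero, zero_mul,
      sub_zero, PUnit.default_eq_unit, add_mul, mul_add, ite_mul, mul_ite, Finset.sum_add_distrib,
      Finset.sum_ite_eq, Finset.sum_ite_eq', Finset.mem_univ, Finset.sum_const_zero]
  · by_cases hy : y = y'
    · simp only [hy, if_true]; ring
    · simp only [hy, if_false]; ring
  · ring
  · by_cases hx : x = x'
    · simp only [hx, if_true]; ring
    · simp only [hx, if_false]; ring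
  · have e : ∀ x, D.F' x * (D.F x * D.G y' / (D.u x + D.w y' + D.σ)) =
        D.G y' * (D.F x * D.F' x / (D.u x + D.w y' + D.σ)) := fun x => by ring
    simp only [e, ← Finset.mul_sum, h.sum_F_div]
    rw [σ]
    ring
  · ring
  · ring

/-- Substitute `B = A - C` in `matB_mul_matB` and remove `A²` by `quadratic`. The result is linear
in `A`, so in the eigenbasis of `C` it determines each off-diagonal entry of `A` separately. -/
theorem anticommutator (h : D.IsGeneric φ ψ) :
    D.matA * D.matC + D.matC * D.matA + D.σ • D.matA =
      D.matC * D.matC + (D.b₂ + D.b₃) • D.matC +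
        (D.b₂ * D.b₃ - D.a₁ * D.a₂) • (1 : Matrix (Index U W) (Index U W) ℂ) -
        Matrix.of (fun i j => if i = Sum.inr (Sum.inr ()) then D.η j else 0) := by
  have h1 := h.quadratic
  have h2 := h.matB_mul_matB
  have h3 : D.matB = D.matA - D.matC := by rw [matA]; abel
  rw [h3, sub_mul, mul_sub, mul_sub, h1] at h2
  rw [σ]
  generalize Matrix.of (fun i j : Index U W => if i = Sum.inr (Sum.inr ()) then D.η j else 0) = E at h2 ⊢
  linear_combination (norm := module) (-1 : ℂ) • h2

end IsGeneric

end CauchyData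

end

/-! ### Pairs of matrices of Cauchy type: the form in the eigenbasis of `C`. -/

noncomputable section

namespace CauchyData

variable {U W : Type} [Fintype U] [DecidableEq U] [Fintype W] [DecidableEq W]

section Eigenvectors

variable (D : CauchyData U W)

/-- The matrix of right eigenvectors of `C`. -/
def right : Matrix (Index U W) (Index U W) ℂ := rightEigenvectors D.specC D.nilC

/-- The matrix of left eigenvectors of `C`. -/
def left : Matrix (Index U W) (Index U W) ℂ := leftEigenvectors D.specC D.nilC

variable {D}

theorem matC_mul_right (h : Function.Injective D.specC) :
    D.matC * D.right = D.right * Matrix.diagonal D.specC :=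
  mul_rightEigenvectors D.nilC_eq_zero level_le_two fun i j hij h' => by simp [h h'] at hij

theorem left_mul_matC (h : Function.Injective D.specC) :
    D.left * D.matC = Matrix.diagonal D.specC * D.left :=
  leftEigenvectors_mul D.nilC_eq_zero level_le_two fun i j hij h' => by simp [h h'] at hij

theorem left_mul_right (h : Function.Injective D.specC) : D.left * D.right = 1 :=
  leftEigenvectors_mul_rightEigenvectors D.nilC_eq_zero level_le_two
    fun i j hij h' => by simp [h h'] at hij

variable (D) in
/-- The last coordinates of the left eigenvectors of `C`. -/
def leftLast : Index U W → ℂ := fun i => D.left i (Sum.inr (Sum.inr ()))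

variable (D) in
/-- The row `η` in the eigenbasis of `C`. -/
def rowRight : Index U W → ℂ := D.η ᵥ* D.right

end Eigenvectors

variable {D : CauchyData U W} {φ ψ : Polynomial ℂ}

namespace IsGeneric

theorem leftLast_inr_inr : D.leftLast (Sum.inr (Sum.inr ())) = 1 := by
  rw [leftLast, left, leftEigenvectors_apply_eq_ite D.nilC_eq_zero (lt_irrefl _), if_pos rfl]

theorem leftLast_inr_inl (x : U) :
    D.leftLast (Sum.inr (Sum.inl x)) = -D.F x / (D.u x - D.z) := by
  simp [leftLast, left, leftEigenvectors, nilC, specC]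

/-- The direct path and the paths through the second block add up to the partial fraction
`one_add_sum_div` at `t = w y`, hence to a product. -/
theorem leftLast_inl (h : D.IsGeneric φ ψ) (y : W) :
    D.leftLast (Sum.inl y) = -D.G' y / (D.w y - D.z) *
      (φ.eval (D.w y) * (∏ y' ∈ Finset.univ.erase y, (D.w y + D.w y' + D.σ)) /
        ∏ x, (D.w y - D.u x)) := by
  have h1 := h.resF.one_add_sum_div y (t := D.w y) fun x hx => by
    simpa using h.specC_injective (a₁ := Sum.inl y) (a₂ := Sum.inr (Sum.inl x)) hx
  rw [← h1, mul_add, Finset.mul_sum]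
  simp only [leftLast, left, leftEigenvectors, nilC, specC, Matrix.of_apply, Sum.elim_inl,
    Sum.elim_inr, reduceCtorEq, if_false, zero_add, Fintype.sum_sum_type, zero_mul, zero_div,
    Finset.sum_const_zero, Finset.univ_unique, mul_zero, add_zero, mul_one]
  congr 1
  refine Finset.sum_congr rfl fun x _ => ?_
  rw [div_mul_eq_mul_div, div_div, div_mul_div_comm]
  congr 1 <;> ring

theorem rowRight_inl (y : W) :
    D.rowRight (Sum.inl y) = -(D.w y + D.z + D.σ) * D.G y := by
  rw [rowRight, Matrix.vecMul, dotProduct, Finset.sum_eq_single (Sum.inl y)]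
  · rw [right, rightEigenvectors_apply_eq_ite D.nilC_eq_zero (lt_irrefl _), if_pos rfl, mul_one]
    rfl
  · intro k _ hk
    rw [right, rightEigenvectors_apply_eq_ite D.nilC_eq_zero (by simp [level]), if_neg hk,
      mul_zero]
  · simp

theorem rowRight_inr_inl (h : D.IsGeneric φ ψ) (x : U) :
    D.rowRight (Sum.inr (Sum.inl x)) = -(D.u x + D.z + D.σ) * D.F' x *
      (ψ.eval (D.u x) * (∏ x' ∈ Finset.univ.erase x, (D.u x + D.u x' + D.σ)) /
        ∏ y, (D.u x - D.w y)) := by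
  have h0 : ∀ y, D.u x - D.w y ≠ 0 := fun y hx => by
    simpa using h.specC_injective (a₁ := Sum.inr (Sum.inl x)) (a₂ := Sum.inl y) (sub_eq_zero.1 hx)
  have h1 := h.resG.one_add_sum_div x (t := D.u x) fun y hx => h0 y (sub_eq_zero.2 hx)
  have h2 := h.sum_G_div x
  rw [← h1]
  simp only [rowRight, Matrix.vecMul, dotProduct, right, rightEigenvectors, nilC, specC, η,
    Matrix.of_apply, Sum.elim_inl, Sum.elim_inr, Sum.inr.injEq, reduceCtorEq,
    if_false, zero_add, Fintype.sum_sum_type, zero_mul, zero_div, mul_ite, mul_one, Finset.sum_ite_eq',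
    Finset.mem_univ, if_true, Finset.sum_const_zero, Finset.univ_unique,
    mul_zero, add_zero]
  -- Write `w y + z + σ` as `(u x + z + σ) - (u x - w y)`: the first part leads to the partial
  -- fraction, the second cancels a denominator and leads to `sum_G_div`.
  have h3 : ∀ y, -(D.w y + D.z + D.σ) * D.G y *
      (D.G' y * D.F' x / (D.u x + D.w y + D.σ) / (D.u x - D.w y)) =
      D.F' x * (D.G y * D.G' y / (D.u x + D.w y + D.σ)) - (D.u x + D.z + D.σ) * D.F' x *
        (D.G y * D.G' y / ((D.w y + D.u x + D.σ) * (D.u x - D.w y))) := fun y => by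
    have := h0 y
    have := h.resF.ne x y
    rw [add_comm (D.w y) (D.u x)]
    field_simp
    ring
  simp only [h3, Finset.sum_sub_distrib, ← Finset.mul_sum, h2]
  rw [σ]
  ring

theorem sum_F_div_sub (h : D.IsGeneric φ ψ) :
    ∑ x, D.F x * D.F' x / (D.z - D.u x) =
      φ.eval D.z * (∏ y, (D.z + D.w y + D.σ)) / (∏ x, (D.z - D.u x)) + D.b₁ - D.b₂ := by
  obtain ⟨y⟩ := h.nonemptyW
  have h0 : ∀ x, D.z - D.u x ≠ 0 := fun x hx => by
    simpa using h.specC_injective (a₁ := Sum.inr (Sum.inr ())) (a₂ := Sum.inr (Sum.inl x))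
      (sub_eq_zero.1 hx)
  have h1 := h.resF.one_add_sum_div y (t := D.z) fun x hx => h0 x (sub_eq_zero.2 hx)
  have h2 := h.sum_F_div y
  -- This uses `z + w y + σ = (u x + w y + σ) + (z - u x)` for an auxiliary `y`, on which the result
  -- does not depend.
  have h3 : ∀ x, D.F x * D.F' x / (D.z - D.u x) = (D.z + D.w y + D.σ) *
      (D.F x * D.F' x / ((D.u x + D.w y + D.σ) * (D.z - D.u x))) -
      D.F x * D.F' x / (D.u x + D.w y + D.σ) := fun x => by
    have := h0 x
    have := h.resF.ne x y
    field_simp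
    ring
  rw [← Finset.mul_prod_erase _ _ (Finset.mem_univ y), mul_left_comm, mul_div_assoc, ← h1]
  simp only [h3, Finset.sum_sub_distrib, ← Finset.mul_sum, h2]
  rw [σ]
  ring

theorem sum_G_div_sub (h : D.IsGeneric φ ψ) :
    ∑ y, D.G y * D.G' y / (D.z - D.w y) =
      ψ.eval D.z * (∏ x, (D.z + D.u x + D.σ)) / (∏ y, (D.z - D.w y)) + D.b₁ - D.b₃ := by
  obtain ⟨x⟩ := h.nonemptyU
  have h0 : ∀ y, D.z - D.w y ≠ 0 := fun x hx => by
    simpa using h.specC_injective (a₁ := Sum.inr (Sum.inr ())) (a₂ := Sum.inl x)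
      (sub_eq_zero.1 hx)
  have h1 := h.resG.one_add_sum_div x (t := D.z) fun x hx => h0 x (sub_eq_zero.2 hx)
  have h2 := h.sum_G_div x
  have h3 : ∀ y, D.G y * D.G' y / (D.z - D.w y) = (D.z + D.u x + D.σ) *
      (D.G y * D.G' y / ((D.w y + D.u x + D.σ) * (D.z - D.w y))) -
      D.G y * D.G' y / (D.u x + D.w y + D.σ) := fun y => by
    have := h0 y
    have := h.resF.ne x y
    rw [add_comm (D.w y) (D.u x)]
    field_simp
    ring
  rw [← Finset.mul_prod_erase _ _ (Finset.mem_univ x), mul_left_comm, mul_div_assoc, ← h1]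
  simp only [h3, Finset.sum_sub_distrib, ← Finset.mul_sum, h2]
  rw [σ]
  ring

/-- Call the two quotients `K` and `L`. The three blocks contribute `K (L + b₁ - b₃)`, `-(b₁ - b₃)(K
+ b₁ - b₂)` and `(b₁ - b₂)(b₁ - b₃)`, with sum `K L`. -/
theorem rowRight_inr_inr (h : D.IsGeneric φ ψ) :
    D.rowRight (Sum.inr (Sum.inr ())) =
      φ.eval D.z * (∏ y, (D.z + D.w y + D.σ)) / (∏ x, (D.z - D.u x)) *
        (ψ.eval D.z * (∏ x, (D.z + D.u x + D.σ)) / (∏ y, (D.z - D.w y))) := by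
  set K := φ.eval D.z * (∏ y, (D.z + D.w y + D.σ)) / (∏ x, (D.z - D.u x)) with hK
  set L := ψ.eval D.z * (∏ x, (D.z + D.u x + D.σ)) / (∏ y, (D.z - D.w y)) with hL
  have hu : ∀ x, D.z - D.u x ≠ 0 := fun x hx => by
    simpa using h.specC_injective (a₁ := Sum.inr (Sum.inr ())) (a₂ := Sum.inr (Sum.inl x))
      (sub_eq_zero.1 hx)
  have h1 := h.sum_F_div_sub
  have h2 := h.sum_G_div_sub
  rw [← hK] at h1
  rw [← hL] at h2
  have h3 : ∀ y, -(D.w y + D.z + D.σ) * D.G y * (-D.G' y / (D.z - D.w y) +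
      ∑ x, D.G' y * D.F' x / (D.u x + D.w y + D.σ) * -D.F x /
        ((D.z - D.w y) * (D.z - D.u x))) = K * (D.G y * D.G' y / (D.z - D.w y)) := fun y => by
    have h4 := h.resF.one_add_sum_div y (t := D.z) fun x hx => hu x (sub_eq_zero.2 hx)
    have h5 : ∀ x, D.G' y * D.F' x / (D.u x + D.w y + D.σ) * -D.F x /
        ((D.z - D.w y) * (D.z - D.u x)) = -D.G' y / (D.z - D.w y) *
        (D.F x * D.F' x / ((D.u x + D.w y + D.σ) * (D.z - D.u x))) := fun x => by
      rw [div_mul_eq_mul_div, div_div, div_mul_div_comm]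
      congr 1 <;> ring
    simp only [h5, ← Finset.mul_sum]
    rw [hK, ← Finset.mul_prod_erase _ _ (Finset.mem_univ y), mul_left_comm, mul_div_assoc, ← h4]
    ring
  simp only [rowRight, Matrix.vecMul, dotProduct, right, rightEigenvectors, nilC, specC, η,
    Matrix.of_apply, Sum.elim_inl, Sum.elim_inr, Sum.inr.injEq, reduceCtorEq,
    if_false, zero_add, Fintype.sum_sum_type, zero_mul, zero_div, mul_one, if_true, Finset.sum_const_zero, Finset.univ_unique, Finset.sum_singleton,
    mul_zero, add_zero, h3, ← Finset.mul_sum, h2]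
  have h6 : ∀ x, (D.b₁ - D.b₃) * D.F' x * (-D.F x / (D.z - D.u x)) =
      -(D.b₁ - D.b₃) * (D.F x * D.F' x / (D.z - D.u x)) := fun x => by ring
  simp only [h6, ← Finset.mul_sum, h1]
  ring

/-- Conjugate `anticommutator` into the eigenbasis of `C`. The left side multiplies each
off-diagonal entry by the bracket; on the right everything except the rank-one term is diagonal. Off
the diagonal `A` and `B` agree there. -/
theorem left_mul_matB_mul_right_apply_mul (h : D.IsGeneric φ ψ) {i j : Index U W} (hij : i ≠ j) :
    (D.left * D.matB * D.right) i j * (D.specC i + D.specC j + D.σ) =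
      -(D.leftLast i * D.rowRight j) := by
  have h1 := h.anticommutator
  have h2 := matC_mul_right h.specC_injective
  have h3 := left_mul_matC h.specC_injective
  have h4 := left_mul_right h.specC_injective
  have h5 : D.left * (D.matA * D.matC + D.matC * D.matA + D.σ • D.matA) * D.right =
      (D.left * D.matA * D.right) * Matrix.diagonal D.specC +
        Matrix.diagonal D.specC * (D.left * D.matA * D.right) +
        D.σ • (D.left * D.matA * D.right) := by
    simp only [Matrix.mul_add, Matrix.add_mul, Matrix.mul_smul, Matrix.smul_mul]
    congr 2
    · simp only [Matrix.mul_assoc, h2]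
    · simp only [← Matrix.mul_assoc, h3]
  have h6 : D.left * D.matA * D.right = D.left * D.matB * D.right + Matrix.diagonal D.specC := by
    rw [matA, Matrix.mul_add, Matrix.add_mul, h3, Matrix.mul_assoc, Matrix.mul_assoc, h4,
      Matrix.mul_one]
  have h7 : D.left * (D.matC * D.matC) * D.right =
      Matrix.diagonal D.specC * Matrix.diagonal D.specC := by
    rw [← Matrix.mul_assoc, h3, Matrix.mul_assoc, h2, ← Matrix.mul_assoc,
      Matrix.mul_assoc (Matrix.diagonal D.specC), h4, Matrix.mul_one]
  have h8 : (D.left * Matrix.of (fun i j : Index U W =>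
      if i = Sum.inr (Sum.inr ()) then D.η j else 0) * D.right) i j =
      D.leftLast i * D.rowRight j := by
    rw [Matrix.mul_assoc, Matrix.mul_apply, Finset.sum_eq_single (Sum.inr (Sum.inr ()))]
    · simp [leftLast, rowRight, Matrix.mul_apply, Matrix.vecMul, dotProduct]
    · intro k _ hk
      simp [Matrix.mul_apply, hk]
    · simp
  rw [h1, h6] at h5
  have h9 := congrFun (congrFun h5 i) j
  simp only [Matrix.mul_sub, Matrix.mul_add, Matrix.sub_mul, Matrix.add_mul, Matrix.mul_smul,
    Matrix.smul_mul, h7, h3, Matrix.mul_one, h4, Matrix.mul_assoc (Matrix.diagonal D.specC)] at h9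
  simp only [Matrix.sub_apply, Matrix.add_apply, h8, Matrix.smul_apply,
    Matrix.diagonal_mul_diagonal, Matrix.diagonal_apply_ne _ hij, Matrix.one_apply_ne hij,
    Matrix.mul_diagonal, Matrix.diagonal_mul, smul_eq_mul, mul_zero, add_zero, zero_sub] at h9
  linear_combination -h9

/-- `B` is self-adjoint for the form with the values `p i / q i` in the eigenbasis of `C`. -/
theorem num_mul_den_mul_conj (h : D.IsGeneric φ ψ) {p q : Index U W → ℂ}
    (hl : ∀ i, p i * D.leftLast i = q i * D.rowRight i) (i j : Index U W) :
    p i * q j * (D.left * D.matB * D.right) i j = p j * q i * (D.left * D.matB * D.right) j i := by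
  rcases eq_or_ne i j with rfl | hij
  · rfl
  have h1 := h.left_mul_matB_mul_right_apply_mul hij
  have h2 := h.left_mul_matB_mul_right_apply_mul hij.symm
  -- Multiplied by this factor, which is symmetric in `i` and `j`, both sides equal `-(q i * q j *
  -- rowRight i * rowRight j)`.
  apply mul_right_cancel₀ (h.specC_add_ne i j hij)
  linear_combination p i * q j * h1 - p j * q i * h2 - q j * D.rowRight j * hl i +
    q i * D.rowRight i * hl j

end IsGeneric

end CauchyData

end

/-! ### A realization criterion for matrices with three levels. -/

noncomputable section

namespace SimpsonType

variable {t : SimpsonType} {s : TripleSpace t.dim}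

theorem isEigenbasis_unique (hs : s ∈ t.S)
    (hE : ∀ v, t.IsEigenbasis s v ↔ ∀ i, t.matC s *ᵥ v i = s.2.2 i • v i ∧ v i i.rev = 1 ∧
      ∀ j, j < i.rev → v i j = 0)
    {v w : Module.Basis (Fin t.dim) ℂ (Fin t.dim → ℂ)} (hv : t.IsEigenbasis s v)
    (hw : t.IsEigenbasis s w) : w = v := by
  have hinj : Function.Injective s.2.2 := hasSpectralType_ones_iff.1 hs.2.2.1
  rw [hE] at hv hw
  refine Module.Basis.eq_of_apply_eq fun i => ?_
  exact eigenvector_unique (M := t.matC s) hinj v (fun j => (hv j).1) (hw i).1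
    (hv i).2.1 (hw i).2.1

/-- A criterion for matrices `B` and `C` that are triangular for a grading with three levels. -/
theorem realizes_of_levels {ι : Type} [Fintype ι] [DecidableEq ι] (hs : s ∈ t.S)
    (hE : ∀ v, t.IsEigenbasis s v ↔ ∀ i, t.matC s *ᵥ v i = s.2.2 i • v i ∧ v i i.rev = 1 ∧
      ∀ j, j < i.rev → v i j = 0)
    (e : ι ≃ Fin t.dim) {lev : ι → ℕ} (hlev : ∀ i, lev i ≤ 2)
    (he : ∀ i j, lev i < lev j → e j < e i) {x y : ι → ℂ} {NB NC : Matrix ι ι ℂ}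
    (hNB : ∀ i j, ¬ 2 - lev i < 2 - lev j → NB i j = 0)
    (hNC : ∀ i j, ¬ lev i < lev j → NC i j = 0)
    (hB : (t.matB s).submatrix e e = Matrix.diagonal y + NB)
    (hC : (t.matC s).submatrix e e = Matrix.diagonal x + NC)
    (hx : ∀ i, s.2.2 (e i).rev = x i) (hy : ∀ i, s.2.1 (e i) = y i)
    (hyne : ∀ i j, lev i < lev j → y i ≠ y j)
    (hspecA : ∀ i, s.1 i = t.eigA s 1 ∨ s.1 i = t.eigA s 2)
    (hquad : (Matrix.diagonal y + NB + (Matrix.diagonal x + NC) - t.eigA s 1 • 1) *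
      (Matrix.diagonal y + NB + (Matrix.diagonal x + NC) - t.eigA s 2 • 1) = 0)
    (hsymm : s ∈ t.S' → ∀ i j, t.num s (e i).rev * t.den s (e j).rev *
      (leftEigenvectors x NC * (Matrix.diagonal y + NB) * rightEigenvectors x NC) i j =
      t.num s (e j).rev * t.den s (e i).rev *
      (leftEigenvectors x NC * (Matrix.diagonal y + NB) * rightEigenvectors x NC) j i)
    (hne : s ∈ t.S' → ∃ i, t.num s i ≠ 0) : t.Realizes s := by
  have hinj : Function.Injective s.2.2 := hasSpectralType_ones_iff.1 hs.2.2.1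
  have hxne : ∀ i j, lev i < lev j → x i ≠ x j := fun i j hij h => by
    rw [← hx, ← hx] at h
    have := e.injective (Fin.rev_injective (hinj h))
    simp [this] at hij
  -- The eigenvalue of `C` with number `i` stands at the place `i.rev` of the diagonal.
  set f : ι ≃ Fin t.dim := e.trans Fin.revPerm with hf
  have hLR := leftEigenvectors_mul_rightEigenvectors hNC hlev hxne
  have hRC := mul_rightEigenvectors hNC hlev hxne
  have hxf : (fun i => x (f.symm i)) = s.2.2 := funext fun i => by
    rw [← hx]
    simp [hf]
  have hye : (fun i => y (e.symm i)) = s.2.1 := funext fun i => by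
    rw [← hy]
    simp
  have hdC : DiagonalizableWithSpectrum (t.matC s) s.2.2 := by
    rw [← hxf]
    exact .of_submatrix e f hLR (by rw [hC, hRC])
  have hdB : DiagonalizableWithSpectrum (t.matB s) s.2.1 := by
    rw [← hye]
    -- `B` is triangular for the opposite grading `2 - lev`.
    refine .of_submatrix e e (leftEigenvectors_mul_rightEigenvectors hNB (by omega) fun i j hij h =>
      hyne j i (by omega) h.symm) ?_
    rw [hB]
    exact mul_rightEigenvectors hNB (by omega) fun i j hij h => hyne j i (by omega) h.symm
  have hA : (t.matA s).submatrix e e = Matrix.diagonal y + NB + (Matrix.diagonal x + NC) := by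
    rw [← hB, ← hC]
    rfl
  have hdA : DiagonalizableWithSpectrum (t.matA s) s.1 := by
    refine .of_quadratic (eigA_ne hs) hspecA (trace_matA hs hdB hdC) ?_
    rw [← hA] at hquad
    have h1 : ∀ a : ℂ, (t.matA s).submatrix e e - a • 1 = (t.matA s - a • 1).submatrix e e :=
      fun a => by
        rw [← Matrix.submatrix_one_equiv e]
        rfl
    rw [h1, h1, Matrix.submatrix_mul_equiv] at hquad
    ext i j
    simpa using congrFun (congrFun hquad (e.symm i)) (e.symm j)
  have hCV := mul_submatrix_of_submatrix_mul e f (M := t.matC s) (by rw [hC, hRC])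
  rw [hxf] at hCV
  have hWV := submatrix_mul_eq_one e f hLR
  refine realizes_of_eigenvectors hdA hdB hdC hWV (fun v hv => ?_)
    (fun v w => isEigenbasis_unique hs hE) (fun hs' i j => ?_) (fun hs' i j => ?_) hne
  · rw [hE]
    intro i
    have hv' : ∀ j, v i j = rightEigenvectors x NC (e.symm j) (f.symm i) :=
      fun j => congrFun (hv i) j
    have hfi : f.symm i = e.symm i.rev := by simp [hf]
    refine ⟨?_, ?_, fun j hj => ?_⟩
    · rw [hv]
      exact mulVec_eq_smul_of_mul_eq hCV i
    · rw [hv', hfi, rightEigenvectors_apply_eq_ite hNC (lt_irrefl _), if_pos rfl]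
    · rw [hv', rightEigenvectors_apply_eq_ite hNC, if_neg]
      · rw [hfi]
        exact fun h => hj.ne (e.symm.injective h)
      · rw [hfi]
        intro h
        have := he _ _ h
        simp only [Equiv.apply_symm_apply] at this
        exact lt_asymm this hj
  · have key : ∀ i j, ((leftEigenvectors x NC).submatrix f.symm e.symm * t.matB s *
        (rightEigenvectors x NC).submatrix e.symm f.symm) i j =
        (leftEigenvectors x NC * (Matrix.diagonal y + NB) * rightEigenvectors x NC)
          (f.symm i) (f.symm j) := fun i j => by
      have h1 : t.matB s = ((t.matB s).submatrix e e).submatrix e.symm e.symm := by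
        simp [Matrix.submatrix_submatrix]
      rw [h1, hB, Matrix.submatrix_mul_equiv, Matrix.submatrix_mul_equiv, Matrix.submatrix_apply]
    have h1 := hsymm hs' (f.symm i) (f.symm j)
    have h2 : ∀ i, (e (f.symm i)).rev = i := fun i => by simp [hf]
    rw [h2, h2, ← key, ← key] at h1
    rw [div_mul_eq_mul_div, div_mul_eq_mul_div, div_eq_div_iff (hs'.2 i) (hs'.2 j)]
    linear_combination h1
  · rw [Matrix.mul_assoc, hCV, ← Matrix.mul_assoc, hWV, one_mul]
    rcases eq_or_ne i j with rfl | hij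
    · rfl
    · rw [Matrix.diagonal_apply_ne _ hij, Matrix.diagonal_apply_ne' _ hij, mul_zero, mul_zero]

end SimpsonType

end

noncomputable section

theorem prod_eq_mul_of_partition {s t u : Finset ℕ} (f : ℕ → ℂ) (h : ∀ k, k ∈ s ↔ k ∈ t ∨ k ∈ u)
    (hd : ∀ k, k ∈ t → k ∉ u) : ∏ k ∈ s, f k = (∏ k ∈ t, f k) * ∏ k ∈ u, f k := by
  rw [← Finset.prod_union (Finset.disjoint_left.2 hd)]
  exact Finset.prod_congr (Finset.ext fun k => by rw [h, Finset.mem_union]) fun _ _ => rfl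

theorem prod_univ_coe {s : Finset ℕ} (f : ℕ → ℂ) : ∏ k : s, f k = ∏ k ∈ s, f k :=
  Finset.prod_coe_sort s f

theorem prod_erase_univ_coe {s : Finset ℕ} (f : ℕ → ℂ) (x : s) :
    ∏ k ∈ Finset.univ.erase x, f k = ∏ k ∈ s.erase x, f k := by
  refine Finset.prod_bij (fun k _ => k) (fun k hk => ?_) (fun k _ l _ h => Subtype.ext h)
    (fun k hk => ?_) fun _ _ => rfl
  · exact Finset.mem_erase.2 ⟨fun h => (Finset.mem_erase.1 hk).1 (Subtype.ext h), k.2⟩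
  · obtain ⟨h1, h2⟩ := Finset.mem_erase.1 hk
    exact ⟨⟨k, h2⟩, Finset.mem_erase.2 ⟨fun h => h1 (congrArg Subtype.val h), Finset.mem_univ _⟩, rfl⟩

/-! ### The family that contains the even and the odd family -/

namespace CauchyFamily

open Polynomial

/-- The numbers of the eigenvalues of `C` in the second block. -/
abbrev U (n m : ℕ) : Type := Finset.Icc (m + 1) (n - 1)

/-- The numbers of the eigenvalues of `C` in the third block. -/
abbrev W (m : ℕ) : Type := Finset.Icc 1 m

/-- The indices, by the numbers of the eigenvalues of `C`. -/
abbrev Index (n m : ℕ) : Type := CauchyData.Index (U n m) (W m)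

variable (n m : ℕ) (φ χ : ℂ[X]) (a b c : ℕ → ℂ)

/-- The underlying matrices of Cauchy type. -/
def data : CauchyData (U n m) (W m) where
  u k := c k
  w k := c k
  z := c n
  b₁ := b 1
  b₂ := b 2
  b₃ := b 3
  a₁ := a 1
  a₂ := a 2
  F k := (∏ j ∈ Finset.Icc 1 (n - k), qForm a b c j k) /
    ∏ j ∈ Finset.Icc ((k : ℕ) + 1) (n - 1), (c k - c j)
  F' k := φ.eval (c k) * (∏ j ∈ Finset.Icc (n + 1 - k) m, qForm a b c j k) /
    ∏ j ∈ Finset.Icc (m + 1) (k - 1), (c k - c j)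
  G k := pForm a b c k 3 1 * (∏ j ∈ Finset.Icc (n + 1 - k) (n - 1), qForm a b c k j) /
    ∏ j ∈ Finset.Icc 1 ((k : ℕ) - 1), (c k - c j)
  G' k := χ.eval (c k) * (∏ j ∈ Finset.Icc (m + 1) (n - k), qForm a b c k j) /
    ∏ j ∈ Finset.Icc ((k : ℕ) + 1) m, (c k - c j)

/-- The nilpotent part of `B`. -/
def nilB : Matrix (Index n m) (Index n m) ℂ := Matrix.of fun i j =>
  match i, j with
  | Sum.inr (Sum.inl x), Sum.inl y =>
      pForm a b c y 3 1 * ((∏ k ∈ (Finset.Icc 1 (n - x)).erase y, qForm a b c k x) *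
        ∏ k ∈ (Finset.Icc (n + 1 - y) (n - 1)).erase x, qForm a b c y k) /
      ((∏ k ∈ Finset.Icc ((x : ℕ) + 1) (n - 1), (c x - c k)) *
        ∏ k ∈ Finset.Icc 1 ((y : ℕ) - 1), (c y - c k))
  | i, j => (data n m φ χ a b c).nilB i j

/-- The nilpotent part of `C`. -/
def nilC : Matrix (Index n m) (Index n m) ℂ := Matrix.of fun i j =>
  match i, j with
  | Sum.inl y, Sum.inr (Sum.inl x) =>
      χ.eval (c y) * φ.eval (c x) *
        ((∏ k ∈ (Finset.Icc (m + 1) (n - y)).erase x, qForm a b c y k) *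
          ∏ k ∈ (Finset.Icc (n + 1 - x) m).erase y, qForm a b c k x) /
      ((∏ k ∈ Finset.Icc ((y : ℕ) + 1) m, (c y - c k)) *
        ∏ k ∈ Finset.Icc (m + 1) (x - 1), (c x - c k))
  | i, j => (data n m φ χ a b c).nilC i j

/-- Numerators of the values of the form. -/
def num (k : ℕ) : ℂ :=
  (∏ j ∈ Finset.Icc (k + 1) n, (c k - c j)) *
    (∏ j ∈ (Finset.Icc (n + 1 - k) n).erase k, qForm a b c k j) *
    (pForm a b c k 3 1 * if k ≤ m then 1 else φ.eval (c k) * χ.eval (c k))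

/-- Denominators of the values of the form. -/
def den (k : ℕ) : ℂ :=
  (∏ j ∈ Finset.Icc 1 (k - 1), (c k - c j)) *
    (∏ j ∈ (Finset.Icc 1 (n - k)).erase k, qForm a b c k j) *
    if k ≤ m then φ.eval (c k) * χ.eval (c k) else 1

/-- The conditions on the sizes and the factors. -/
structure IsAdmissible : Prop where
  two_le : 2 ≤ m
  le : 2 * m ≤ n
  le' : n ≤ 2 * m + 1
  monicφ : φ.Monic
  monicχ : χ.Monic
  natDegreeφ : φ.natDegree + 2 * m = n
  natDegreeχ : χ.natDegree + n = 2 * m + 1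
  eval_mul_eval : ∀ t, (-1) ^ n * φ.eval t * ((X + C (b 3 - a 1)) * χ).eval
    (-t - (b 2 + b 3 - a 1 - a 2)) = (b 2 + t - a 1) * (b 2 + t - a 2)
  traceφ : φ.nextCoeff + m * (b 2 + b 3 - a 1 - a 2) + b 1 + ∑ k ∈ Finset.Icc 1 n, c k =
    b 2 + b 3 - a 1 - a 2 - (b 3 - a 1 - a 2)
  traceχ : ((X + C (b 3 - a 1)) * χ).nextCoeff + (n - 1 - m) * (b 2 + b 3 - a 1 - a 2) + b 1 +
    ∑ k ∈ Finset.Icc 1 n, c k = b 2 + b 3 - a 1 - a 2 - (b 2 - a 1 - a 2)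
  injOn : Set.InjOn c (Finset.Icc 1 n)

variable {n m φ χ a b c}

theorem IsAdmissible.sub_ne_zero (h : IsAdmissible n m φ χ a b c) {i j : ℕ} (hi : 1 ≤ i ∧ i ≤ n)
    (hj : 1 ≤ j ∧ j ≤ n) (hij : i ≠ j) : c i - c j ≠ 0 :=
  _root_.sub_ne_zero.2 fun h' => hij (h.injOn (by simpa using hi) (by simpa using hj) h')

theorem qForm_comm (i j : ℕ) : qForm a b c i j = qForm a b c j i := by
  rw [qForm, qForm]; ring

theorem sum_eq (h : IsAdmissible n m φ χ a b c) :
    ∑ k : U n m, c k + ∑ k : W m, c k + c n = ∑ k ∈ Finset.Icc 1 n, c k := by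
  have := h.le
  have := h.two_le
  rw [Finset.sum_coe_sort (Finset.Icc 1 m) c, Finset.sum_coe_sort (Finset.Icc (m + 1) (n - 1)) c]
  have h1 : Finset.Icc 1 n = insert n (Finset.Icc (m + 1) (n - 1) ∪ Finset.Icc 1 m) := by
    ext; simp; omega
  rw [h1, Finset.sum_insert (by simp; omega), Finset.sum_union (Finset.disjoint_left.2 (by
    intro k; simp; omega)), add_comm]

/-- `F` and `F'` share out one residue: the factors `q_{jx}` with `j ≤ n - x` and the differences
with `j > x` belong to `F`, all the others to `F'`. -/
theorem isResidueF (h : IsAdmissible n m φ χ a b c)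
    (hq : ∀ i j, 1 ≤ i → i ≤ n → 1 ≤ j → j ≤ n → i ≠ j → qForm a b c i j ≠ 0) :
    IsResidue (data n m φ χ a b c).u (data n m φ χ a b c).w (data n m φ χ a b c).σ φ
      fun x => (data n m φ χ a b c).F x * (data n m φ χ a b c).F' x := by
  have h1 := h.le
  have h2 := h.two_le
  have h3 := h.natDegreeφ
  have h4 := h.le'
  refine ⟨fun x y hxy => ?_, h.monicφ, ?_, fun x => ?_, fun x y => ?_⟩
  · have hx := Finset.mem_Icc.1 x.2
    have hy := Finset.mem_Icc.1 y.2
    exact Subtype.ext (h.injOn (by simp; omega) (by simp; omega) hxy)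
  · simp
    omega
  · have hx := Finset.mem_Icc.1 x.2
    change _ * ∏ y ∈ Finset.univ.erase x, (c x - c y) = φ.eval (c x) * ∏ y : W m, _
    rw [prod_erase_univ_coe (fun k => c x - c k),
      prod_eq_mul_of_partition (t := Finset.Icc (m + 1) (x - 1))
        (u := Finset.Icc ((x : ℕ) + 1) (n - 1)) _ (by intro k; simp; omega)
        (by intro k; simp; omega)]
    have h5 : ∏ y : W m, ((data n m φ χ a b c).u x + (data n m φ χ a b c).w y +
        (data n m φ χ a b c).σ) = ∏ k ∈ Finset.Icc 1 m, qForm a b c k x := by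
      rw [← prod_univ_coe (fun k => qForm a b c k x)]
      refine Finset.prod_congr rfl fun y _ => ?_
      simp only [data, CauchyData.σ, qForm]
      ring
    rw [h5, prod_eq_mul_of_partition (s := Finset.Icc 1 m) (t := Finset.Icc 1 (n - x)) (u := Finset.Icc (n + 1 - x) m)
      _ (by intro k; simp; omega) (by intro k; simp; omega)]
    have h6 : ∏ j ∈ Finset.Icc ((x : ℕ) + 1) (n - 1), (c x - c j) ≠ 0 :=
      Finset.prod_ne_zero_iff.2 fun j hj => by
        simp only [Finset.mem_Icc] at hj
        exact h.sub_ne_zero (by omega) (by omega) (by omega)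
    have h7 : ∏ j ∈ Finset.Icc (m + 1) ((x : ℕ) - 1), (c x - c j) ≠ 0 :=
      Finset.prod_ne_zero_iff.2 fun j hj => by
        simp only [Finset.mem_Icc] at hj
        exact h.sub_ne_zero (by omega) (by omega) (by omega)
    simp only [data]
    field_simp
  · have hx := Finset.mem_Icc.1 x.2
    have hy := Finset.mem_Icc.1 y.2
    have := hq x y (by omega) (by omega) (by omega) (by omega) (by omega)
    rw [qForm] at this
    convert this using 1
    simp only [data, CauchyData.σ]
    ring

/-- Here the polynomial is shared out too: its factor `X + (b 3 - a 1)` enters `G` as `p^{31}`, and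
`χ` enters `G'`. -/
theorem isResidueG (h : IsAdmissible n m φ χ a b c)
    (hq : ∀ i j, 1 ≤ i → i ≤ n → 1 ≤ j → j ≤ n → i ≠ j → qForm a b c i j ≠ 0) :
    IsResidue (data n m φ χ a b c).w (data n m φ χ a b c).u (data n m φ χ a b c).σ
      ((X + C (b 3 - a 1)) * χ)
      fun x => (data n m φ χ a b c).G x * (data n m φ χ a b c).G' x := by
  have h1 := h.le
  have h2 := h.two_le
  have h3 := h.natDegreeχ
  have h4 := h.le'
  refine ⟨fun x y hxy => ?_, (monic_X_add_C _).mul h.monicχ, ?_, fun x => ?_, fun x y => ?_⟩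
  · have hx := Finset.mem_Icc.1 x.2
    have hy := Finset.mem_Icc.1 y.2
    exact Subtype.ext (h.injOn (by simp; omega) (by simp; omega) hxy)
  · rw [(monic_X_add_C _).natDegree_mul h.monicχ, natDegree_X_add_C]
    simp
    omega
  · have hx := Finset.mem_Icc.1 x.2
    change _ * ∏ y ∈ Finset.univ.erase x, (c x - c y) = eval (c x) _ * ∏ y : U n m, _
    rw [prod_erase_univ_coe (fun k => c x - c k),
      prod_eq_mul_of_partition (t := Finset.Icc 1 ((x : ℕ) - 1))
        (u := Finset.Icc ((x : ℕ) + 1) m) _ (by intro k; simp; omega)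
        (by intro k; simp; omega)]
    have h5 : ∏ y : U n m, ((data n m φ χ a b c).w x + (data n m φ χ a b c).u y +
        (data n m φ χ a b c).σ) = ∏ k ∈ Finset.Icc (m + 1) (n - 1), qForm a b c x k := by
      rw [← prod_univ_coe (fun k => qForm a b c x k)]
      refine Finset.prod_congr rfl fun y _ => ?_
      simp only [data, CauchyData.σ, qForm]
      ring
    rw [h5, prod_eq_mul_of_partition (s := Finset.Icc (m + 1) (n - 1)) (t := Finset.Icc (m + 1) (n - x))
      (u := Finset.Icc (n + 1 - x) (n - 1))
      _ (by intro k; simp; omega) (by intro k; simp; omega)]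
    have h6 : ∏ j ∈ Finset.Icc ((x : ℕ) + 1) m, (c x - c j) ≠ 0 :=
      Finset.prod_ne_zero_iff.2 fun j hj => by
        simp only [Finset.mem_Icc] at hj
        exact h.sub_ne_zero (by omega) (by omega) (by omega)
    have h7 : ∏ j ∈ Finset.Icc 1 ((x : ℕ) - 1), (c x - c j) ≠ 0 :=
      Finset.prod_ne_zero_iff.2 fun j hj => by
        simp only [Finset.mem_Icc] at hj
        exact h.sub_ne_zero (by omega) (by omega) (by omega)
    simp only [data, pForm, eval_mul, eval_add, eval_X, eval_C]
    field_simp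
    ring
  · have hx := Finset.mem_Icc.1 x.2
    have hy := Finset.mem_Icc.1 y.2
    have := hq x y (by omega) (by omega) (by omega) (by omega) (by omega)
    rw [qForm] at this
    convert this using 1
    simp only [data, CauchyData.σ]
    ring

/-- The number of the eigenvalue of `C` that belongs to an index. -/
def number (n m : ℕ) : Index n m → ℕ := Sum.elim (fun y => y) (Sum.elim (fun x => x) fun _ => n)

theorem one_le_number (hm : 2 ≤ m) (hn : 2 * m ≤ n) (i : Index n m) : 1 ≤ number n m i := by
  rcases i with y | x | _
  · exact (Finset.mem_Icc.1 y.2).1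
  · exact (Nat.le_add_left 1 m).trans (Finset.mem_Icc.1 x.2).1
  · change 1 ≤ n
    omega

theorem number_le (hn : 2 * m ≤ n) (i : Index n m) : number n m i ≤ n := by
  rcases i with y | x | _
  · have : (y : ℕ) ≤ n := by have := Finset.mem_Icc.1 y.2; omega
    exact this
  · have : (x : ℕ) ≤ n := by have := Finset.mem_Icc.1 x.2; omega
    exact this
  · exact le_rfl

theorem number_injective (hm : 2 ≤ m) (hn : 2 * m ≤ n) : Function.Injective (number n m) := by
  intro i j hij
  rcases i with y | x | _ <;> rcases j with y' | x' | _
  all_goals simp only [number, Sum.elim_inl, Sum.elim_inr] at hij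
  all_goals try have h1 := Finset.mem_Icc.1 y.2
  all_goals try have h2 := Finset.mem_Icc.1 x.2
  all_goals try have h3 := Finset.mem_Icc.1 y'.2
  all_goals try have h4 := Finset.mem_Icc.1 x'.2
  all_goals first
    | rfl
    | omega
    | rw [Subtype.ext hij]

theorem specC_data (i : Index n m) : (data n m φ χ a b c).specC i = c (number n m i) := by
  rcases i with y | x | _ <;> rfl

theorem specC_injective (h : IsAdmissible n m φ χ a b c) :
    Function.Injective (data n m φ χ a b c).specC := by
  intro i j hij
  rw [specC_data, specC_data] at hij
  refine number_injective h.two_le h.le (h.injOn ?_ ?_ hij) <;>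
  simp [one_le_number h.two_le h.le, number_le h.le]

theorem isGeneric (h : IsAdmissible n m φ χ a b c)
    (hq : ∀ i j, 1 ≤ i → i ≤ n → 1 ≤ j → j ≤ n → i ≠ j → qForm a b c i j ≠ 0) :
    (data n m φ χ a b c).IsGeneric φ ((X + C (b 3 - a 1)) * χ) where
  resF := isResidueF h hq
  resG := isResidueG h hq
  sumF := by
    have h1 := h.traceφ
    rw [← sum_eq h] at h1
    simp only [data, CauchyData.σ, Finset.sum_add_distrib, Finset.sum_const, Finset.card_univ,
      Fintype.card_coe, Nat.card_Icc, Nat.add_sub_cancel, nsmul_eq_mul]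
    linear_combination h1
  sumG := by
    have h1 := h.traceχ
    have h2 : ((n - 1 + 1 - (m + 1) : ℕ) : ℂ) = n - 1 - m := by
      have := h.le
      have := h.two_le
      rw [show n - 1 + 1 - (m + 1) = n - (m + 1) by omega, Nat.cast_sub (by omega)]
      push_cast
      ring
    rw [← sum_eq h] at h1
    simp only [data, CauchyData.σ, Finset.sum_add_distrib, Finset.sum_const, Finset.card_univ,
      Fintype.card_coe, Nat.card_Icc, nsmul_eq_mul, h2]
    linear_combination h1
  eval_mul_eval t := by
    have h1 := h.le
    have h2 := h.two_le
    have h3 : Fintype.card (U n m) + Fintype.card (W m) + 1 = n := by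
      simp
      omega
    rw [h3]
    exact h.eval_mul_eval t
  specC_injective := specC_injective h
  specC_add_ne i j hij := by
    rw [specC_data, specC_data]
    have := hq _ _ (one_le_number h.two_le h.le i) (number_le h.le i)
      (one_le_number h.two_le h.le j) (number_le h.le j)
      fun h' => hij (number_injective h.two_le h.le h')
    rw [qForm] at this
    convert this using 1
    simp only [data, CauchyData.σ]
    ring
  F_ne x := by
    have h1 := h.le
    have h2 := h.two_le
    have h4 := h.le'
    have hx := Finset.mem_Icc.1 x.2
    refine div_ne_zero ?_ ?_ <;> refine Finset.prod_ne_zero_iff.2 fun j hj => ?_ <;>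
    simp only [Finset.mem_Icc] at hj
    · exact hq _ _ (by omega) (by omega) (by omega) (by omega) (by omega)
    · exact h.sub_ne_zero (by omega) (by omega) (by omega)
  nonemptyU := by
    have h1 := h.le
    have h2 := h.two_le
    exact ⟨⟨n - 1, by simp; omega⟩⟩
  nonemptyW := by
    have h2 := h.two_le
    exact ⟨⟨m, by simp; omega⟩⟩

end CauchyFamily

end

/-! ### The common family where no `q_{ij}` vanishes: entries and values of the form. -/

noncomputable section

namespace CauchyFamily

open Polynomial

variable {n m : ℕ} {φ χ : ℂ[X]} {a b c : ℕ → ℂ}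

/-- The Cauchy denominator `q_{xy}` occurs in exactly one of the two products of the numerator: in
the first if `y ≤ n - x`, in the second otherwise. Erasing it leaves an expression that makes sense
also where `q_{xy} = 0`. -/
theorem nilB_eq (h : IsAdmissible n m φ χ a b c)
    (hq : ∀ i j, 1 ≤ i → i ≤ n → 1 ≤ j → j ≤ n → i ≠ j → qForm a b c i j ≠ 0) :
    nilB n m φ χ a b c = (data n m φ χ a b c).nilB := by
  ext i j
  rcases i with y | x | _ <;> rcases j with y' | x' | _
  all_goals try rfl
  have h1 := h.le
  have h2 := h.two_le
  have h4 := h.le'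
  have hx := Finset.mem_Icc.1 x.2
  have hy := Finset.mem_Icc.1 y'.2
  have hne : qForm a b c x y' ≠ 0 := hq _ _ (by omega) (by omega) (by omega) (by omega) (by omega)
  have hσ : (data n m φ χ a b c).u x + (data n m φ χ a b c).w y' + (data n m φ χ a b c).σ =
      qForm a b c x y' := by
    simp only [data, CauchyData.σ, qForm]
    ring
  have hprod : ((∏ k ∈ (Finset.Icc 1 (n - x)).erase y', qForm a b c k x) *
        ∏ k ∈ (Finset.Icc (n + 1 - y') (n - 1)).erase x, qForm a b c y' k) * qForm a b c x y' =
      (∏ k ∈ (Finset.Icc 1 (n - x)), qForm a b c k x) *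
        ∏ k ∈ (Finset.Icc (n + 1 - y') (n - 1)), qForm a b c y' k := by
    by_cases hxy : (y' : ℕ) ≤ n - x
    · rw [← Finset.mul_prod_erase (Finset.Icc 1 (n - x)) _ (a := (y' : ℕ))
        (by simp only [Finset.mem_Icc]; omega), Finset.erase_eq_of_notMem (a := (x : ℕ))
        (by simp only [Finset.mem_Icc]; omega), qForm_comm (x : ℕ) y']
      ring
    · rw [← Finset.mul_prod_erase (Finset.Icc (n + 1 - y') (n - 1)) _ (a := (x : ℕ))
        (by simp only [Finset.mem_Icc]; omega), Finset.erase_eq_of_notMem (a := (y' : ℕ))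
        (by simp only [Finset.mem_Icc]; omega), qForm_comm (x : ℕ) y']
      ring
  change _ / _ = (data n m φ χ a b c).F x * (data n m φ χ a b c).G y' / _
  rw [hσ, eq_div_iff hne, div_mul_eq_mul_div, mul_assoc, hprod]
  simp only [data]
  rw [div_mul_div_comm]
  congr 1
  ring

theorem nilC_eq (h : IsAdmissible n m φ χ a b c)
    (hq : ∀ i j, 1 ≤ i → i ≤ n → 1 ≤ j → j ≤ n → i ≠ j → qForm a b c i j ≠ 0) :
    nilC n m φ χ a b c = (data n m φ χ a b c).nilC := by
  ext i j
  rcases i with y | x | _ <;> rcases j with y' | x' | _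
  all_goals try rfl
  have h1 := h.le
  have h2 := h.two_le
  have h4 := h.le'
  have hx := Finset.mem_Icc.1 x'.2
  have hy := Finset.mem_Icc.1 y.2
  have hne : qForm a b c x' y ≠ 0 := hq _ _ (by omega) (by omega) (by omega) (by omega) (by omega)
  have hσ : (data n m φ χ a b c).u x' + (data n m φ χ a b c).w y + (data n m φ χ a b c).σ =
      qForm a b c x' y := by
    simp only [data, CauchyData.σ, qForm]
    ring
  have hprod : ((∏ k ∈ (Finset.Icc (m + 1) (n - y)).erase x', qForm a b c y k) *
        ∏ k ∈ (Finset.Icc (n + 1 - x') m).erase y, qForm a b c k x') * qForm a b c x' y =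
      (∏ k ∈ (Finset.Icc (m + 1) (n - y)), qForm a b c y k) *
        ∏ k ∈ (Finset.Icc (n + 1 - x') m), qForm a b c k x' := by
    by_cases hxy : (y : ℕ) ≤ n - x'
    · rw [← Finset.mul_prod_erase (Finset.Icc (m + 1) (n - y)) _ (a := (x' : ℕ))
        (by simp only [Finset.mem_Icc]; omega), Finset.erase_eq_of_notMem (a := (y : ℕ))
        (by simp only [Finset.mem_Icc]; omega), qForm_comm (x' : ℕ) y]
      ring
    · rw [← Finset.mul_prod_erase (Finset.Icc (n + 1 - x') m) _ (a := (y : ℕ))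
        (by simp only [Finset.mem_Icc]; omega), Finset.erase_eq_of_notMem (a := (x' : ℕ))
        (by simp only [Finset.mem_Icc]; omega), qForm_comm (x' : ℕ) y]
      ring
  change _ / _ = (data n m φ χ a b c).G' y * (data n m φ χ a b c).F' x' / _
  rw [hσ, eq_div_iff hne, div_mul_eq_mul_div, mul_assoc, hprod]
  simp only [data]
  rw [div_mul_div_comm]
  congr 1
  ring

theorem IsAdmissible.prod_ne_zero (h : IsAdmissible n m φ χ a b c) {i : ℕ} (hi : 1 ≤ i ∧ i ≤ n)
    {s : Finset ℕ} (hs : ∀ k ∈ s, 1 ≤ k ∧ k ≤ n ∧ k ≠ i) : ∏ j ∈ s, (c i - c j) ≠ 0 :=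
  Finset.prod_ne_zero_iff.2 fun j hj =>
    h.sub_ne_zero hi ⟨(hs j hj).1, (hs j hj).2.1⟩ (hs j hj).2.2.symm

/-- Both `leftLast` and `rowRight` are products of linear forms. Once the ranges of the products are
cut at the block boundaries and at `n`, the same factors stand on both sides. -/
theorem num_mul_leftLast_inl (h : IsAdmissible n m φ χ a b c)
    (hq : ∀ i j, 1 ≤ i → i ≤ n → 1 ≤ j → j ≤ n → i ≠ j → qForm a b c i j ≠ 0) (y : W m) :
    num n m φ χ a b c (number n m (Sum.inl y)) * (data n m φ χ a b c).leftLast (Sum.inl y) =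
      den n m φ χ a b c (number n m (Sum.inl y)) * (data n m φ χ a b c).rowRight (Sum.inl y) := by
  have hg := isGeneric h hq
  have h1 := h.le
  have h2 := h.two_le
  have h4 := h.le'
  have hσ : ∀ k l, c k + c l + (data n m φ χ a b c).σ = qForm a b c k l := fun k l => by
    simp only [data, CauchyData.σ, qForm]
    ring
  have hy := Finset.mem_Icc.1 y.2
  rw [hg.leftLast_inl, CauchyData.IsGeneric.rowRight_inl]
  change num n m φ χ a b c y * (-(χ.eval (c y) * _ / _) / (c y - c n) * (φ.eval (c y) *
    (∏ y' ∈ Finset.univ.erase y, (c y + c y' + (data n m φ χ a b c).σ)) /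
    ∏ x : U n m, (c y - c x))) = den n m φ χ a b c y *
      (-(c y + c n + (data n m φ χ a b c).σ) * (_ / _))
  simp only [hσ]
  rw [prod_erase_univ_coe (fun k => qForm a b c y k), prod_univ_coe (fun k => c y - c k)]
  have e1 : ∏ j ∈ Finset.Icc ((y : ℕ) + 1) n, (c y - c j) =
      (∏ j ∈ Finset.Icc ((y : ℕ) + 1) m, (c y - c j)) *
      ((∏ j ∈ Finset.Icc (m + 1) (n - 1), (c y - c j)) * (c y - c n)) := by
    rw [← Finset.prod_singleton (fun k => c y - c k) n,
      ← prod_eq_mul_of_partition (s := Finset.Icc (m + 1) n) _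
        (by intro k; simp; omega) (by intro k; simp; omega),
      ← prod_eq_mul_of_partition (s := Finset.Icc ((y : ℕ) + 1) n) _
        (by intro k; simp; omega) (by intro k; simp; omega)]
  have e2 : ∏ j ∈ (Finset.Icc (n + 1 - y) n).erase y, qForm a b c y j =
      (∏ j ∈ Finset.Icc (n + 1 - y) (n - 1), qForm a b c y j) * qForm a b c y n := by
    rw [← Finset.prod_singleton (fun k => qForm a b c y k) n]
    exact prod_eq_mul_of_partition _ (by intro k; simp; omega) (by intro k; simp; omega)
  have e3 : ∏ j ∈ (Finset.Icc 1 (n - y)).erase y, qForm a b c y j =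
      (∏ j ∈ (Finset.Icc 1 m).erase y, qForm a b c y j) *
      ∏ j ∈ Finset.Icc (m + 1) (n - y), qForm a b c y j :=
    prod_eq_mul_of_partition _ (by intro k; simp; omega) (by intro k; simp; omega)
  have d1 : ∏ j ∈ Finset.Icc ((y : ℕ) + 1) m, (c y - c j) ≠ 0 :=
    h.prod_ne_zero (by omega) (by simp; omega)
  have d2 : ∏ j ∈ Finset.Icc (m + 1) (n - 1), (c y - c j) ≠ 0 :=
    h.prod_ne_zero (by omega) (by simp; omega)
  have d3 : ∏ j ∈ Finset.Icc 1 ((y : ℕ) - 1), (c y - c j) ≠ 0 :=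
    h.prod_ne_zero (by omega) (by simp; omega)
  have d4 := h.sub_ne_zero (i := y) (j := n) (by omega) (by omega) (by omega)
  rw [num, den, if_pos hy.2, if_pos hy.2, e1, e2, e3]
  field_simp

theorem num_mul_leftLast_inr_inl (h : IsAdmissible n m φ χ a b c)
    (hq : ∀ i j, 1 ≤ i → i ≤ n → 1 ≤ j → j ≤ n → i ≠ j → qForm a b c i j ≠ 0) (x : U n m) :
    num n m φ χ a b c (number n m (Sum.inr (Sum.inl x))) * (data n m φ χ a b c).leftLast (Sum.inr (Sum.inl x)) =
      den n m φ χ a b c (number n m (Sum.inr (Sum.inl x))) * (data n m φ χ a b c).rowRight (Sum.inr (Sum.inl x)) := by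
  have hg := isGeneric h hq
  have h1 := h.le
  have h2 := h.two_le
  have h4 := h.le'
  have hσ : ∀ k l, c k + c l + (data n m φ χ a b c).σ = qForm a b c k l := fun k l => by
    simp only [data, CauchyData.σ, qForm]
    ring
  have hx := Finset.mem_Icc.1 x.2
  rw [CauchyData.IsGeneric.leftLast_inr_inl, hg.rowRight_inr_inl]
  change num n m φ χ a b c x * (-(_ / _) / (c x - c n)) = den n m φ χ a b c x *
    (-(c x + c n + (data n m φ χ a b c).σ) * (φ.eval (c x) * _ / _) * (eval (c x) _ *
    (∏ x' ∈ Finset.univ.erase x, (c x + c x' + (data n m φ χ a b c).σ)) /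
    ∏ y : W m, (c x - c y)))
  simp only [hσ]
  rw [prod_erase_univ_coe (fun k => qForm a b c x k), prod_univ_coe (fun k => c x - c k)]
  have e1 : ∏ j ∈ Finset.Icc ((x : ℕ) + 1) n, (c x - c j) =
      (∏ j ∈ Finset.Icc ((x : ℕ) + 1) (n - 1), (c x - c j)) * (c x - c n) := by
    rw [← Finset.prod_singleton (fun k => c x - c k) n]
    exact prod_eq_mul_of_partition _ (by intro k; simp; omega) (by intro k; simp; omega)
  have e2 : ∏ j ∈ (Finset.Icc (n + 1 - x) n).erase x, qForm a b c x j =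
      (∏ j ∈ Finset.Icc (n + 1 - x) m, qForm a b c j x) *
      ((∏ j ∈ (Finset.Icc (m + 1) (n - 1)).erase x, qForm a b c x j) * qForm a b c x n) := by
    simp only [fun j => qForm_comm (a := a) (b := b) (c := c) j (x : ℕ)]
    rw [← Finset.prod_singleton (fun k => qForm a b c x k) n,
      ← prod_eq_mul_of_partition (s := (Finset.Icc (m + 1) n).erase x) _
        (by intro k; simp; omega) (by intro k; simp; omega),
      ← prod_eq_mul_of_partition (s := (Finset.Icc (n + 1 - x) n).erase x) _
        (by intro k; simp; omega) (by intro k; simp; omega)]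
  have e3 : ∏ j ∈ (Finset.Icc 1 (n - x)).erase x, qForm a b c x j =
      ∏ j ∈ Finset.Icc 1 (n - x), qForm a b c j x := by
    rw [Finset.erase_eq_of_notMem (by simp; omega)]
    exact Finset.prod_congr rfl fun k _ => qForm_comm _ _
  have e4 : ∏ j ∈ Finset.Icc 1 ((x : ℕ) - 1), (c x - c j) =
      (∏ j ∈ Finset.Icc 1 m, (c x - c j)) *
      ∏ j ∈ Finset.Icc (m + 1) ((x : ℕ) - 1), (c x - c j) :=
    prod_eq_mul_of_partition _ (by intro k; simp; omega) (by intro k; simp; omega)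
  have d1 : ∏ j ∈ Finset.Icc ((x : ℕ) + 1) (n - 1), (c x - c j) ≠ 0 :=
    h.prod_ne_zero (by omega) (by simp; omega)
  have d2 : ∏ j ∈ Finset.Icc 1 m, (c x - c j) ≠ 0 :=
    h.prod_ne_zero (by omega) (by simp; omega)
  have d3 : ∏ j ∈ Finset.Icc (m + 1) ((x : ℕ) - 1), (c x - c j) ≠ 0 :=
    h.prod_ne_zero (by omega) (by simp; omega)
  have d4 := h.sub_ne_zero (i := x) (j := n) (by omega) (by omega) (by omega)
  rw [num, den, if_neg (by omega), if_neg (by omega), e1, e2, e3, e4]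
  simp only [pForm, eval_mul, eval_add, eval_X, eval_C]
  generalize ∏ j ∈ Finset.Icc ((x : ℕ) + 1) (n - 1), (c x - c j) = p₁ at d1 ⊢
  generalize ∏ j ∈ Finset.Icc 1 m, (c x - c j) = p₂ at d2 ⊢
  generalize ∏ j ∈ Finset.Icc (m + 1) ((x : ℕ) - 1), (c x - c j) = p₃ at d3 ⊢
  generalize ∏ j ∈ Finset.Icc (n + 1 - x) m, qForm a b c j x = q₁
  generalize ∏ j ∈ (Finset.Icc (m + 1) (n - 1)).erase x, qForm a b c x j = q₂
  generalize ∏ j ∈ Finset.Icc 1 (n - x), qForm a b c j x = q₃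
  field_simp
  ring

theorem num_mul_leftLast_inr_inr (h : IsAdmissible n m φ χ a b c)
    (hq : ∀ i j, 1 ≤ i → i ≤ n → 1 ≤ j → j ≤ n → i ≠ j → qForm a b c i j ≠ 0) :
    num n m φ χ a b c (number n m (Sum.inr (Sum.inr ()))) * (data n m φ χ a b c).leftLast (Sum.inr (Sum.inr ())) =
      den n m φ χ a b c (number n m (Sum.inr (Sum.inr ()))) * (data n m φ χ a b c).rowRight (Sum.inr (Sum.inr ())) := by
  have hg := isGeneric h hq
  have h1 := h.le
  have h2 := h.two_le
  have h4 := h.le'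
  have hσ : ∀ k l, c k + c l + (data n m φ χ a b c).σ = qForm a b c k l := fun k l => by
    simp only [data, CauchyData.σ, qForm]
    ring
  rw [CauchyData.IsGeneric.leftLast_inr_inr, hg.rowRight_inr_inr]
  change num n m φ χ a b c n * 1 = den n m φ χ a b c n * (φ.eval (c n) *
    (∏ y : W m, (c n + c y + (data n m φ χ a b c).σ)) / (∏ x : U n m, (c n - c x)) *
    (eval (c n) _ * (∏ x : U n m, (c n + c x + (data n m φ χ a b c).σ)) /
    (∏ y : W m, (c n - c y))))
  simp only [hσ]
  rw [prod_univ_coe (fun k => qForm a b c n k), prod_univ_coe (fun k => qForm a b c n k),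
    prod_univ_coe (fun k => c n - c k), prod_univ_coe (fun k => c n - c k)]
  have e1 : ∏ j ∈ (Finset.Icc (n + 1 - n) n).erase n, qForm a b c n j =
      (∏ j ∈ Finset.Icc 1 m, qForm a b c n j) *
      ∏ j ∈ Finset.Icc (m + 1) (n - 1), qForm a b c n j :=
    prod_eq_mul_of_partition _ (by intro k; simp; omega) (by intro k; simp; omega)
  have e2 : ∏ j ∈ Finset.Icc 1 (n - 1), (c n - c j) =
      (∏ j ∈ Finset.Icc 1 m, (c n - c j)) * ∏ j ∈ Finset.Icc (m + 1) (n - 1), (c n - c j) :=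
    prod_eq_mul_of_partition _ (by intro k; simp; omega) (by intro k; simp; omega)
  have d1 : ∏ j ∈ Finset.Icc (m + 1) (n - 1), (c n - c j) ≠ 0 :=
    h.prod_ne_zero (by omega) (by simp; omega)
  have d2 : ∏ j ∈ Finset.Icc 1 m, (c n - c j) ≠ 0 :=
    h.prod_ne_zero (by omega) (by simp; omega)
  rw [num, den, if_neg (by omega), if_neg (by omega), e1, e2]
  simp only [pForm, eval_mul, eval_add, eval_X, eval_C, Finset.Icc_eq_empty_of_lt n.lt_succ_self,
    Nat.sub_self, Finset.Icc_eq_empty_of_lt Nat.zero_lt_one, Finset.erase_empty,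
    Finset.prod_empty]
  field_simp
  ring

theorem num_mul_leftLast (h : IsAdmissible n m φ χ a b c)
    (hq : ∀ i j, 1 ≤ i → i ≤ n → 1 ≤ j → j ≤ n → i ≠ j → qForm a b c i j ≠ 0) (i : Index n m) :
    num n m φ χ a b c (number n m i) * (data n m φ χ a b c).leftLast i =
      den n m φ χ a b c (number n m i) * (data n m φ χ a b c).rowRight i := by
  rcases i with y | x | _
  · exact num_mul_leftLast_inl h hq y
  · exact num_mul_leftLast_inr_inl h hq x
  · exact num_mul_leftLast_inr_inr h hq

end CauchyFamily

end

/-! ### The common family in general: deformation and continuity. -/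

noncomputable section

open Filter Topology in
theorem eq_of_eventuallyEq_nhdsNE {X : Type*} [TopologicalSpace X] [T2Space X] {f g : ℂ → X}
    (hf : Continuous f) (hg : Continuous g) (h : f =ᶠ[𝓝[≠] 0] g) : f 0 = g 0 :=
  tendsto_nhds_unique_of_eventuallyEq ((hf.tendsto 0).mono_left nhdsWithin_le_nhds)
    ((hg.tendsto 0).mono_left nhdsWithin_le_nhds) h

open Filter Topology in
theorem eventually_add_two_mul_ne_zero (p : ℂ) : ∀ᶠ t in 𝓝[≠] (0 : ℂ), p + 2 * t ≠ 0 := by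
  by_cases hp : p = 0
  · filter_upwards [self_mem_nhdsWithin] with t ht
    simpa [hp] using ht
  · have h1 : Continuous fun t : ℂ => p + 2 * t := by fun_prop
    exact nhdsWithin_le_nhds ((h1.tendsto 0).eventually_ne (by simpa using hp))

section

variable {ι : Type*} [Fintype ι] [DecidableEq ι]

/-- Only differences of eigenvalues enter, so along the deformation the eigenvectors change through
`N` alone. -/
theorem rightEigenvectors_add_const (x : ι → ℂ) (N : Matrix ι ι ℂ) (t : ℂ) :
    rightEigenvectors (fun i => x i + t) N = rightEigenvectors x N := by
  simp [rightEigenvectors]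

theorem leftEigenvectors_add_const (x : ι → ℂ) (N : Matrix ι ι ℂ) (t : ℂ) :
    leftEigenvectors (fun i => x i + t) N = leftEigenvectors x N := by
  simp [leftEigenvectors]

theorem continuous_rightEigenvectors (x : ι → ℂ) {N : ℂ → Matrix ι ι ℂ} (hN : Continuous N) :
    Continuous fun t => rightEigenvectors x (N t) := by
  have h : ∀ i j, Continuous fun t => N t i j := fun i j => hN.matrix_elem i j
  refine continuous_matrix fun i j => ?_
  simp only [rightEigenvectors, Matrix.of_apply]
  fun_prop

theorem continuous_leftEigenvectors (x : ι → ℂ) {N : ℂ → Matrix ι ι ℂ} (hN : Continuous N) :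
    Continuous fun t => leftEigenvectors x (N t) := by
  have h : ∀ i j, Continuous fun t => N t i j := fun i j => hN.matrix_elem i j
  refine continuous_matrix fun i j => ?_
  simp only [leftEigenvectors, Matrix.of_apply]
  fun_prop

end

namespace CauchyFamily

open Polynomial

/-- The eigenvalues of `B` on a line of constant trace. -/
def shiftB (n : ℕ) (b : ℕ → ℂ) (t : ℂ) : ℕ → ℂ := Function.update b 1 (b 1 - n * t)

/-- The eigenvalues of `C` on a line of constant trace. -/
def shiftC (c : ℕ → ℂ) (t : ℂ) : ℕ → ℂ := fun k => c k + t

variable {n m : ℕ} {φ χ : ℂ[X]} {a b c : ℕ → ℂ} {t : ℂ}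

theorem shiftB_two : shiftB n b t 2 = b 2 := by simp [shiftB]

theorem shiftB_three : shiftB n b t 3 = b 3 := by simp [shiftB]

theorem shiftB_one : shiftB n b t 1 = b 1 - n * t := by simp [shiftB]

theorem shiftB_zero : shiftB n b 0 = b := by simp [shiftB]

theorem shiftC_zero : shiftC c 0 = c := by
  funext k
  simp [shiftC]

/-- The `n` eigenvalues `c_k` gain `t` each and `b 1` loses `n t`, so the trace is constant. The
polynomials `φ`, `χ` stay fixed, and the identity between them involves neither `b 1` nor the `c_k`.
-/
theorem IsAdmissible.shift (h : IsAdmissible n m φ χ a b c) (t : ℂ) :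
    IsAdmissible n m φ χ a (shiftB n b t) (shiftC c t) where
  two_le := h.two_le
  le := h.le
  le' := h.le'
  monicφ := h.monicφ
  monicχ := h.monicχ
  natDegreeφ := h.natDegreeφ
  natDegreeχ := h.natDegreeχ
  eval_mul_eval := by
    rw [shiftB_two, shiftB_three]
    exact h.eval_mul_eval
  traceφ := by
    rw [shiftB_one, shiftB_two, shiftB_three, ← h.traceφ]
    simp only [shiftC, Finset.sum_add_distrib, Finset.sum_const, Nat.card_Icc, nsmul_eq_mul,
      Nat.add_sub_cancel]
    ring
  traceχ := by
    rw [shiftB_one, shiftB_two, shiftB_three, ← h.traceχ]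
    simp only [shiftC, Finset.sum_add_distrib, Finset.sum_const, Nat.card_Icc, nsmul_eq_mul,
      Nat.add_sub_cancel]
    ring
  injOn i hi j hj hij := h.injOn hi hj (add_right_cancel hij)

theorem qForm_shift (i j : ℕ) :
    qForm a (shiftB n b t) (shiftC c t) i j = qForm a b c i j + 2 * t := by
  rw [qForm, qForm, shiftB_two, shiftB_three, shiftC, shiftC]
  ring

theorem pForm_shift (i k : ℕ) : pForm a (shiftB n b t) (shiftC c t) i 3 k = pForm a b c i 3 k + t := by
  rw [pForm, pForm, shiftB_three, shiftC]
  ring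

theorem shiftC_sub (i j : ℕ) : shiftC c t i - shiftC c t j = c i - c j := by
  simp [shiftC]

open Filter Topology in
theorem eventually_qForm_ne_zero (n : ℕ) (a b c : ℕ → ℂ) : ∀ᶠ t in 𝓝[≠] (0 : ℂ),
    ∀ i j, 1 ≤ i → i ≤ n → 1 ≤ j → j ≤ n → i ≠ j →
      qForm a (shiftB n b t) (shiftC c t) i j ≠ 0 := by
  have h : ∀ᶠ t in 𝓝[≠] (0 : ℂ), ∀ i ∈ Finset.Icc 1 n, ∀ j ∈ Finset.Icc 1 n,
      qForm a b c i j + 2 * t ≠ 0 := by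
    simp only [Filter.eventually_all_finset]
    exact fun i _ j _ => eventually_add_two_mul_ne_zero _
  filter_upwards [h] with t ht i j hi hi' hj hj' _
  rw [qForm_shift]
  exact ht i (by simp [hi, hi']) j (by simp [hj, hj'])

theorem specC_shift (t : ℂ) : (data n m φ χ a (shiftB n b t) (shiftC c t)).specC =
    fun i => (data n m φ χ a b c).specC i + t := by
  funext i
  rw [specC_data, specC_data]
  rfl

theorem continuous_specB :
    Continuous fun t => Matrix.diagonal (data n m φ χ a (shiftB n b t) (shiftC c t)).specB := by
  refine Continuous.matrix_diagonal (continuous_pi fun i => ?_)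
  rcases i with y | x | _
  · simp only [CauchyData.specB, data, Sum.elim_inl, shiftB_three]
    fun_prop
  · simp only [CauchyData.specB, data, Sum.elim_inl, Sum.elim_inr, shiftB_two]
    fun_prop
  · simp only [CauchyData.specB, data, Sum.elim_inr, shiftB_one]
    fun_prop

theorem continuous_eval (φ : ℂ[X]) (k : ℕ) : Continuous fun t => φ.eval (shiftC c t k) := by
  simp only [shiftC]
  fun_prop

/-- All denominators are differences of the `c_k` and do not depend on `t`. This is what the erased
factors in `nilB` achieve: a denominator `q_{xy}` would move and could vanish at `t = 0`. -/
theorem continuous_nilB :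
    Continuous fun t => nilB n m φ χ a (shiftB n b t) (shiftC c t) := by
  have := fun k => continuous_eval (c := c) φ k
  refine continuous_matrix fun i j => ?_
  rcases i with y | x | _ <;> rcases j with y' | x' | _ <;>
  simp only [nilB, CauchyData.nilB, data, Matrix.of_apply, shiftC_sub, qForm_shift, pForm_shift] <;>
  fun_prop

theorem continuous_nilC :
    Continuous fun t => nilC n m φ χ a (shiftB n b t) (shiftC c t) := by
  have := fun k => continuous_eval (c := c) φ k
  have := fun k => continuous_eval (c := c) χ k
  refine continuous_matrix fun i j => ?_
  rcases i with y | x | _ <;> rcases j with y' | x' | _ <;>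
  simp only [nilC, CauchyData.nilC, data, Matrix.of_apply, shiftC_sub, qForm_shift, pForm_shift] <;>
  fun_prop

theorem continuous_num (k : ℕ) :
    Continuous fun t => num n m φ χ a (shiftB n b t) (shiftC c t) k := by
  have := continuous_eval (c := c) φ k
  have := continuous_eval (c := c) χ k
  simp only [num, shiftC_sub, qForm_shift, pForm_shift]
  split_ifs <;> fun_prop

theorem continuous_den (k : ℕ) :
    Continuous fun t => den n m φ χ a (shiftB n b t) (shiftC c t) k := by
  have := continuous_eval (c := c) φ k
  have := continuous_eval (c := c) χ k
  simp only [den, shiftC_sub, qForm_shift]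
  split_ifs <;> fun_prop

theorem continuous_η :
    Continuous fun t => (data n m φ χ a (shiftB n b t) (shiftC c t)).η := by
  have := fun k => continuous_eval (c := c) φ k
  have : ∀ k, Continuous fun t => shiftC c t k := fun k => by simp only [shiftC]; fun_prop
  refine continuous_pi fun i => ?_
  rcases i with y | x | _ <;>
  simp only [CauchyData.η, CauchyData.σ, data, Sum.elim_inl, Sum.elim_inr, shiftC_sub, qForm_shift,
    pForm_shift, shiftB_one, shiftB_two, shiftB_three] <;>
  fun_prop

theorem quadratic (h : IsAdmissible n m φ χ a b c) :
    (Matrix.diagonal (data n m φ χ a b c).specB + nilB n m φ χ a b c +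
      (Matrix.diagonal (data n m φ χ a b c).specC + nilC n m φ χ a b c) - a 1 • 1) *
    (Matrix.diagonal (data n m φ χ a b c).specB + nilB n m φ χ a b c +
      (Matrix.diagonal (data n m φ χ a b c).specC + nilC n m φ χ a b c) - a 2 • 1) = 0 := by
  have h1 : Continuous fun t => Matrix.diagonal (data n m φ χ a (shiftB n b t) (shiftC c t)).specC := by
    simp only [specC_shift]
    fun_prop
  have h2 := continuous_specB (n := n) (m := m) (φ := φ) (χ := χ) (a := a) (b := b) (c := c)
  have h3 := continuous_nilB (n := n) (m := m) (φ := φ) (χ := χ) (a := a) (b := b) (c := c)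
  have h4 := continuous_nilC (n := n) (m := m) (φ := φ) (χ := χ) (a := a) (b := b) (c := c)
  -- Both sides are continuous in `t` and agree for small `t ≠ 0`, where no `q_{ij}` vanishes.
  have key := eq_of_eventuallyEq_nhdsNE
    (((h2.add h3).add (h1.add h4)).sub (continuous_const (y := a 1 • 1)) |>.mul
    (((h2.add h3).add (h1.add h4)).sub (continuous_const (y := a 2 • 1)))) (continuous_const (y := 0)) (by
      filter_upwards [eventually_qForm_ne_zero n a b c] with t ht
      simp only [Pi.mul_apply, Pi.add_apply, Pi.sub_apply]
      rw [nilB_eq (h.shift t) ht, nilC_eq (h.shift t) ht]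
      have h5 := (isGeneric (h.shift t) ht).quadratic
      simp only [CauchyData.matA, CauchyData.matB, CauchyData.matC] at h5
      rw [sub_mul, mul_sub, mul_sub, h5]
      simp only [data, Matrix.mul_smul, Matrix.smul_mul, mul_one, one_mul]
      module)
  simpa only [Pi.mul_apply, Pi.add_apply, Pi.sub_apply, shiftB_zero, shiftC_zero] using key

theorem num_mul_left (h : IsAdmissible n m φ χ a b c) (i : Index n m) :
    num n m φ χ a b c (number n m i) * leftEigenvectors (data n m φ χ a b c).specC
      (nilC n m φ χ a b c) i (Sum.inr (Sum.inr ())) =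
    den n m φ χ a b c (number n m i) * ((data n m φ χ a b c).η ᵥ* rightEigenvectors
      (data n m φ χ a b c).specC (nilC n m φ χ a b c)) i := by
  have hC := continuous_nilC (n := n) (m := m) (φ := φ) (χ := χ) (a := a) (b := b) (c := c)
  have h1 := continuous_leftEigenvectors (data n m φ χ a b c).specC hC
  have h2 := continuous_rightEigenvectors (data n m φ χ a b c).specC hC
  have h3 := (continuous_pi_iff.1 (continuous_η (n := n) (m := m) (φ := φ) (χ := χ) (a := a)
    (b := b) (c := c) |>.matrix_vecMul h2)) i
  have key := eq_of_eventuallyEq_nhdsNE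
    ((continuous_num (n := n) (m := m) (φ := φ) (χ := χ) (a := a) (b := b) (c := c)
      (number n m i)).mul (h1.matrix_elem i (Sum.inr (Sum.inr ()))))
    ((continuous_den (n := n) (m := m) (φ := φ) (χ := χ) (a := a) (b := b) (c := c)
      (number n m i)).mul h3) (by
      filter_upwards [eventually_qForm_ne_zero n a b c] with t ht
      have h4 := num_mul_leftLast (h.shift t) ht i
      rw [CauchyData.leftLast, CauchyData.left, CauchyData.rowRight, CauchyData.right,
        ← nilC_eq (h.shift t) ht, specC_shift, leftEigenvectors_add_const,
        rightEigenvectors_add_const] at h4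
      exact h4)
  simpa only [Pi.mul_apply, Pi.add_apply, Pi.sub_apply, shiftB_zero, shiftC_zero] using key

theorem num_mul_den_mul_conj (h : IsAdmissible n m φ χ a b c) (i j : Index n m) :
    num n m φ χ a b c (number n m i) * den n m φ χ a b c (number n m j) *
      (leftEigenvectors (data n m φ χ a b c).specC (nilC n m φ χ a b c) *
      (Matrix.diagonal (data n m φ χ a b c).specB + nilB n m φ χ a b c) *
      rightEigenvectors (data n m φ χ a b c).specC (nilC n m φ χ a b c)) i j =
    num n m φ χ a b c (number n m j) * den n m φ χ a b c (number n m i) *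
      (leftEigenvectors (data n m φ χ a b c).specC (nilC n m φ χ a b c) *
      (Matrix.diagonal (data n m φ χ a b c).specB + nilB n m φ χ a b c) *
      rightEigenvectors (data n m φ χ a b c).specC (nilC n m φ χ a b c)) j i := by
  have hC := continuous_nilC (n := n) (m := m) (φ := φ) (χ := χ) (a := a) (b := b) (c := c)
  have h1 := ((continuous_leftEigenvectors (data n m φ χ a b c).specC hC).mul
    ((continuous_specB (n := n) (m := m) (φ := φ) (χ := χ) (a := a) (b := b) (c := c)).add
    (continuous_nilB (n := n) (m := m) (φ := φ) (χ := χ) (a := a) (b := b) (c := c)))).mul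
    (continuous_rightEigenvectors (data n m φ χ a b c).specC hC)
  have hnum := fun i => continuous_num (n := n) (m := m) (φ := φ) (χ := χ) (a := a) (b := b)
    (c := c) (number n m i)
  have hden := fun i => continuous_den (n := n) (m := m) (φ := φ) (χ := χ) (a := a) (b := b)
    (c := c) (number n m i)
  have key := eq_of_eventuallyEq_nhdsNE (((hnum i).mul (hden j)).mul (h1.matrix_elem i j))
    (((hnum j).mul (hden i)).mul (h1.matrix_elem j i)) (by
      filter_upwards [eventually_qForm_ne_zero n a b c] with t ht
      have h4 := (isGeneric (h.shift t) ht).num_mul_den_mul_conj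
        (num_mul_leftLast (h.shift t) ht) i j
      rw [CauchyData.matB, CauchyData.left, CauchyData.right, ← nilC_eq (h.shift t) ht,
        ← nilB_eq (h.shift t) ht, specC_shift, leftEigenvectors_add_const,
        rightEigenvectors_add_const] at h4
      exact h4)
  simpa only [Pi.mul_apply, Pi.add_apply, Pi.sub_apply, shiftB_zero, shiftC_zero] using key

/-- If all numerators vanished, `num_mul_left` would give `η V = 0`, hence `η = 0` as `V` is
invertible. But the last entry of `η` is `(b 1 - b 2) * (b 1 - b 3)`. -/
theorem exists_num_ne_zero (h : IsAdmissible n m φ χ a b c)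
    (hb : (b 1 - b 2) * (b 1 - b 3) ≠ 0)
    (hden : ∀ i : Index n m, den n m φ χ a b c (number n m i) ≠ 0) :
    ∃ i : Index n m, num n m φ χ a b c (number n m i) ≠ 0 := by
  by_contra! hnum
  have hC : ∀ i j : Index n m, ¬ CauchyData.level i < CauchyData.level j →
      nilC n m φ χ a b c i j = 0 := fun i j hij => by
    rw [← (data n m φ χ a b c).nilC_eq_zero i j hij]
    rcases i with y | x | _ <;> rcases j with y' | x' | _ <;> simp [CauchyData.level] at hij <;> rfl
  have h1 : (data n m φ χ a b c).η ᵥ* rightEigenvectors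
      (data n m φ χ a b c).specC (nilC n m φ χ a b c) = 0 := funext fun i => by
    have := num_mul_left h i
    rw [hnum, zero_mul] at this
    exact (mul_eq_zero.1 this.symm).resolve_left (hden i)
  have h2 := leftEigenvectors_mul_rightEigenvectors (x := (data n m φ χ a b c).specC) hC
    CauchyData.level_le_two fun i j hij h' => by simp [specC_injective h h'] at hij
  have h3 : (data n m φ χ a b c).η = 0 := by
    rw [← Matrix.vecMul_one (data n m φ χ a b c).η, ← mul_eq_one_comm.1 h2,
      ← Matrix.vecMul_vecMul, h1, Matrix.zero_vecMul]
  exact hb (congrFun h3 (Sum.inr (Sum.inr ())))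

end CauchyFamily

end

/-! ### The even and odd families as members of the common family. -/

noncomputable section

theorem prod_sub_comm (c : ℕ → ℂ) (s : Finset ℕ) (u : ℕ) :
    ∏ k ∈ s, (c k - c u) = (-1) ^ s.card * ∏ k ∈ s, (c u - c k) := by
  rw [← Finset.prod_const, ← Finset.prod_mul_distrib]
  exact Finset.prod_congr rfl fun k _ => by ring

theorem neg_one_pow_mul_div {p q : ℕ} (h : Even (p + q)) (x y : ℂ) :
    (-1) ^ p * x / ((-1) ^ q * y) = x / y := by
  have h1 : ((-1) ^ p : ℂ) = (-1) ^ q := by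
    have h2 : ((-1) ^ p : ℂ) * (-1) ^ q = 1 := by rw [← pow_add, h.neg_one_pow]
    have h3 : ((-1) ^ q : ℂ) * (-1) ^ q = 1 := by rw [← pow_add, (Even.add_self q).neg_one_pow]
    have h4 : ((-1) ^ q : ℂ) ≠ 0 := pow_ne_zero _ (by norm_num)
    exact mul_right_cancel₀ h4 (h2.trans h3.symm)
  rw [h1, mul_div_mul_left _ _ (pow_ne_zero _ (by norm_num))]

namespace CauchyFamily

open Polynomial

section Even

variable {m : ℕ} {a b c : ℕ → ℂ} {u w : ℕ}

/-- Entries are rewritten in terms of eigenvalue numbers, `u` in the second block and `w` in the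
third. The explicit sign compensates for reversing the factors `c k - c u`, whose number has the
parity of the exponent. -/
theorem even_B12 (hu : m + 1 ≤ u ∧ u ≤ 2 * m - 1) : EvenFamily.B12 m a b c (2 * m - u) =
    (∏ j ∈ Finset.Icc (2 * m + 1 - u) m, qForm a b c j u) /
      ∏ j ∈ Finset.Icc (m + 1) (u - 1), (c u - c j) := by
  rw [EvenFamily.B12, show 2 * m - (2 * m - u) = u by omega,
    show 2 * m - 1 - (2 * m - u) = u - 1 by omega, show 2 * m - u + 1 = 2 * m + 1 - u by omega,
    prod_sub_comm, neg_one_pow_mul_div]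
  rw [Nat.card_Icc]
  exact ⟨u - m, by omega⟩

theorem even_B13 (hw : 1 ≤ w ∧ w ≤ m) : EvenFamily.B13 m a b c (m + 1 - w) =
    pForm a b c w 3 1 * (∏ j ∈ Finset.Icc (2 * m + 1 - w) (2 * m - 1), qForm a b c w j) /
      ∏ j ∈ Finset.Icc 1 (w - 1), (c w - c j) := by
  rw [EvenFamily.B13, show m + 1 - (m + 1 - w) = w by omega, show m - (m + 1 - w) = w - 1 by omega,
    show m + (m + 1 - w) = 2 * m + 1 - w by omega, prod_sub_comm, mul_assoc, neg_one_pow_mul_div]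
  rw [Nat.card_Icc]
  exact ⟨w - 1, by omega⟩

theorem even_B23 (hu : m + 1 ≤ u ∧ u ≤ 2 * m - 1) (hw : 1 ≤ w ∧ w ≤ m) :
    EvenFamily.B23 m a b c (2 * m - u) (m + 1 - w) =
      pForm a b c w 3 1 * ((∏ k ∈ (Finset.Icc 1 (2 * m - u)).erase w, qForm a b c k u) *
        ∏ k ∈ (Finset.Icc (2 * m + 1 - w) (2 * m - 1)).erase u, qForm a b c w k) /
      ((∏ k ∈ Finset.Icc (u + 1) (2 * m - 1), (c u - c k)) *
        ∏ k ∈ Finset.Icc 1 (w - 1), (c w - c k)) := by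
  rw [EvenFamily.B23, show m + 1 - (m + 1 - w) = w by omega, show m - (m + 1 - w) = w - 1 by omega,
    show m + (m + 1 - w) = 2 * m + 1 - w by omega, show 2 * m - (2 * m - u) = u by omega,
    show 2 * m + 1 - (2 * m - u) = u + 1 by omega, prod_sub_comm, mul_assoc, mul_left_comm (∏ k ∈ Finset.Icc (u + 1) (2 * m - 1), (c u - c k)), neg_one_pow_mul_div]
  rw [Nat.card_Icc]
  exact ⟨w - 1, by omega⟩

theorem even_C21 (hu : m + 1 ≤ u ∧ u ≤ 2 * m - 1) : EvenFamily.C21 m a b c (2 * m - u) =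
    -((∏ j ∈ Finset.Icc 1 (2 * m - u), qForm a b c j u) /
      ∏ j ∈ Finset.Icc (u + 1) (2 * m - 1), (c u - c j)) := by
  rw [EvenFamily.C21, show 2 * m - (2 * m - u) = u by omega,
    show 2 * m + 1 - (2 * m - u) = u + 1 by omega]

theorem even_C31 (hw : 1 ≤ w ∧ w ≤ m) : EvenFamily.C31 m a b c (m + 1 - w) =
    -(pForm a b c w 3 2 * (∏ j ∈ Finset.Icc (m + 1) (2 * m - w), qForm a b c w j) /
      ∏ j ∈ Finset.Icc (w + 1) m, (c w - c j)) := by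
  rw [EvenFamily.C31, show m + 1 - (m + 1 - w) = w by omega,
    show m + 2 - (m + 1 - w) = w + 1 by omega, show m - 1 + (m + 1 - w) = 2 * m - w by omega]

theorem even_C32 (hu : m + 1 ≤ u ∧ u ≤ 2 * m - 1) (hw : 1 ≤ w ∧ w ≤ m) :
    EvenFamily.C32 m a b c (m + 1 - w) (2 * m - u) =
      pForm a b c w 3 2 * ((∏ k ∈ (Finset.Icc (m + 1) (2 * m - w)).erase u, qForm a b c w k) *
        ∏ k ∈ (Finset.Icc (2 * m + 1 - u) m).erase w, qForm a b c k u) /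
      ((∏ k ∈ Finset.Icc (w + 1) m, (c w - c k)) *
        ∏ k ∈ Finset.Icc (m + 1) (u - 1), (c u - c k)) := by
  rw [EvenFamily.C32, show m + 1 - (m + 1 - w) = w by omega,
    show m + 2 - (m + 1 - w) = w + 1 by omega, show m - 1 + (m + 1 - w) = 2 * m - w by omega,
    show 2 * m - (2 * m - u) = u by omega, show 2 * m - 1 - (2 * m - u) = u - 1 by omega,
    show 2 * m - u + 1 = 2 * m + 1 - u by omega, prod_sub_comm, mul_assoc, mul_left_comm (∏ k ∈ Finset.Icc (w + 1) m, (c w - c k)), neg_one_pow_mul_div]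
  rw [Nat.card_Icc]
  exact ⟨u - m, by omega⟩

/-- `p` and `q` are positions counted from `1`. The eigenvalues of `C` descend along the diagonal,
so position and number add up to `2 * m + 1`. -/
theorem even_entryB (hm : 2 ≤ m) (i j : Index (2 * m) m) {p q : ℕ}
    (hp : p + number (2 * m) m i = 2 * m + 1) (hq : q + number (2 * m) m j = 2 * m + 1) :
    EvenFamily.entryB m a b c p q =
      (Matrix.diagonal (data (2 * m) m 1 (X + C (b 3 - a 2)) a b c).specB +
        nilB (2 * m) m 1 (X + C (b 3 - a 2)) a b c) i j := by
  rw [Matrix.add_apply, Matrix.diagonal_apply]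
  rcases i with y | x | _ <;> rcases j with y' | x' | _
  all_goals simp only [EvenFamily.entryB, nilB, CauchyData.nilB, data, CauchyData.specB,
    Matrix.of_apply, Sum.elim_inl, Sum.elim_inr, Sum.inl.injEq, Sum.inr.injEq, reduceCtorEq,
    if_false, if_true, add_zero, zero_add, eval_one, one_mul, Subtype.ext_iff]
  all_goals simp only [number, Sum.elim_inl, Sum.elim_inr] at hp hq
  all_goals try have h1 := Finset.mem_Icc.1 y.2
  all_goals try have h2 := Finset.mem_Icc.1 x.2
  all_goals try have h3 := Finset.mem_Icc.1 y'.2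
  all_goals try have h4 := Finset.mem_Icc.1 x'.2
  · split_ifs <;> first | omega | rfl
  · split_ifs <;> first | omega | rfl
  · split_ifs <;> first | omega | rfl
  · rw [if_neg (by omega), if_pos (by omega), if_neg (by omega), show p - 1 = 2 * m - x by omega,
      show q - m = m + 1 - y' by omega, even_B23 h2 h3]
  · split_ifs <;> first | omega | rfl
  · split_ifs <;> first | omega | rfl
  · rw [if_pos (by omega), if_neg (by omega), if_neg (by omega),
      show q - m = m + 1 - y' by omega, even_B13 h3]
  · rw [if_pos (by omega), if_neg (by omega), if_pos (by omega), show q - 1 = 2 * m - x' by omega, even_B12 h4]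
  · split_ifs <;> first | omega | rfl

theorem even_entryC (hm : 2 ≤ m) (i j : Index (2 * m) m) {p q : ℕ}
    (hp : p + number (2 * m) m i = 2 * m + 1) (hq : q + number (2 * m) m j = 2 * m + 1) :
    EvenFamily.entryC m a b c p q =
      (Matrix.diagonal (data (2 * m) m 1 (X + C (b 3 - a 2)) a b c).specC +
        nilC (2 * m) m 1 (X + C (b 3 - a 2)) a b c) i j := by
  rw [Matrix.add_apply, Matrix.diagonal_apply]
  have hpForm : ∀ w, c w + (b 3 - a 2) = pForm a b c w 3 2 := fun w => by rw [pForm]; ring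
  rcases i with y | x | _ <;> rcases j with y' | x' | _
  all_goals simp only [EvenFamily.entryC, nilC, CauchyData.nilC, data, CauchyData.specC,
    Matrix.of_apply, Sum.elim_inl, Sum.elim_inr, Sum.inl.injEq, Sum.inr.injEq, reduceCtorEq,
    if_false, if_true, add_zero, zero_add, eval_one, mul_one, eval_add, eval_X, eval_C, hpForm,
    Subtype.ext_iff]
  all_goals simp only [number, Sum.elim_inl, Sum.elim_inr] at hp hq
  all_goals try have h1 := Finset.mem_Icc.1 y.2
  all_goals try have h2 := Finset.mem_Icc.1 x.2
  all_goals try have h3 := Finset.mem_Icc.1 y'.2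
  all_goals try have h4 := Finset.mem_Icc.1 x'.2
  · split_ifs <;> first | omega | rfl | (congr 1; omega)
  · rw [if_neg (by omega), if_neg (by omega), if_neg (by omega), if_neg (by omega),
      if_pos (by omega), show q - 1 = 2 * m - x' by omega,
      show p - m = m + 1 - y by omega,
      even_C32 h4 h1]
  · rw [if_neg (by omega), if_neg (by omega), if_neg (by omega), if_pos (by omega),
      show p - m = m + 1 - y by omega, even_C31 h1]
  · split_ifs <;> first | omega | rfl
  · split_ifs <;> first | omega | rfl | (congr 1; omega)
  · rw [if_neg (by omega), if_neg (by omega), if_pos (by omega), if_pos (by omega),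
      show p - 1 = 2 * m - x by omega, even_C21 h2]
  · split_ifs <;> first | omega | rfl
  · split_ifs <;> first | omega | rfl
  · rw [if_pos (by omega)]
    congr 1
    omega

theorem even_num (k : ℕ) : EvenFamily.num m a b c k =
    num (2 * m) m 1 (X + C (b 3 - a 2)) a b c k := by
  rw [EvenFamily.num, num]
  split_ifs
  · rw [mul_one]
  · simp only [eval_one, one_mul, eval_add, eval_X, eval_C, pForm]
    ring

theorem even_den (k : ℕ) : EvenFamily.den m a b c k =
    den (2 * m) m 1 (X + C (b 3 - a 2)) a b c k := by
  rw [EvenFamily.den, den]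
  split_ifs
  · simp only [eval_one, one_mul, eval_add, eval_X, eval_C, pForm]
    ring
  · rfl

/-- Here `φ = 1`, so both linear factors `p^{31}` and `p^{32}` belong to the dual polynomial. The
two trace fields are rearrangements of the trace condition. -/
theorem even_isAdmissible (hm : 2 ≤ m) (hc : Set.InjOn c (Finset.Icc 1 (2 * m)))
    (htr : m * a 1 + m * a 2 =
      b 1 + (m - 1) * b 2 + m * b 3 + ∑ k ∈ Finset.Icc 1 (2 * m), c k) :
    IsAdmissible (2 * m) m 1 (X + C (b 3 - a 2)) a b c where
  two_le := hm
  le := le_rfl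
  le' := by omega
  monicφ := monic_one
  monicχ := monic_X_add_C _
  natDegreeφ := by simp
  natDegreeχ := by rw [natDegree_X_add_C]; omega
  eval_mul_eval t := by
    rw [(even_two_mul m).neg_one_pow]
    simp only [eval_one, eval_mul, eval_add, eval_X, eval_C]
    ring
  traceφ := by
    rw [← C_1, nextCoeff_C_eq_zero]
    linear_combination -htr
  traceχ := by
    rw [(monic_X_add_C _).nextCoeff_mul (monic_X_add_C _), nextCoeff_X_add_C, nextCoeff_X_add_C]
    push_cast
    linear_combination -htr
  injOn := hc

end Even

section Odd

variable {m : ℕ} {a b c : ℕ → ℂ} {u w : ℕ}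

theorem odd_B12 (hu : m + 1 ≤ u ∧ u ≤ 2 * m) : OddFamily.B12 m a b c (2 * m + 1 - u) =
    pForm a b c u 2 1 * (∏ j ∈ Finset.Icc (2 * m + 1 + 1 - u) m, qForm a b c j u) /
      ∏ j ∈ Finset.Icc (m + 1) (u - 1), (c u - c j) := by
  rw [OddFamily.B12, show 2 * m + 1 - (2 * m + 1 - u) = u by omega,
    show 2 * m - (2 * m + 1 - u) = u - 1 by omega,
    show 2 * m + 1 - u + 1 = 2 * m + 1 + 1 - u by omega, prod_sub_comm, mul_assoc,
    neg_one_pow_mul_div]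
  rw [Nat.card_Icc]
  exact ⟨u - m - 1, by omega⟩

theorem odd_B13 (hw : 1 ≤ w ∧ w ≤ m) : OddFamily.B13 m a b c (m + 1 - w) =
    pForm a b c w 3 1 * (∏ j ∈ Finset.Icc (2 * m + 1 + 1 - w) (2 * m), qForm a b c w j) /
      ∏ j ∈ Finset.Icc 1 (w - 1), (c w - c j) := by
  rw [OddFamily.B13, show m + 1 - (m + 1 - w) = w by omega, show m - (m + 1 - w) = w - 1 by omega,
    show m + 1 + (m + 1 - w) = 2 * m + 1 + 1 - w by omega, prod_sub_comm, mul_assoc,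
    neg_one_pow_mul_div]
  rw [Nat.card_Icc]
  exact ⟨w - 1, by omega⟩

theorem odd_B23 (hu : m + 1 ≤ u ∧ u ≤ 2 * m) (hw : 1 ≤ w ∧ w ≤ m) :
    OddFamily.B23 m a b c (2 * m + 1 - u) (m + 1 - w) =
      pForm a b c w 3 1 * ((∏ k ∈ (Finset.Icc 1 (2 * m + 1 - u)).erase w, qForm a b c k u) *
        ∏ k ∈ (Finset.Icc (2 * m + 1 + 1 - w) (2 * m)).erase u, qForm a b c w k) /
      ((∏ k ∈ Finset.Icc (u + 1) (2 * m), (c u - c k)) *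
        ∏ k ∈ Finset.Icc 1 (w - 1), (c w - c k)) := by
  rw [OddFamily.B23, show m + 1 - (m + 1 - w) = w by omega, show m - (m + 1 - w) = w - 1 by omega,
    show m + 1 + (m + 1 - w) = 2 * m + 1 + 1 - w by omega,
    show 2 * m + 1 - (2 * m + 1 - u) = u by omega,
    show 2 * m + 2 - (2 * m + 1 - u) = u + 1 by omega, prod_sub_comm, mul_assoc,
    mul_left_comm (∏ k ∈ Finset.Icc (u + 1) (2 * m), (c u - c k)), neg_one_pow_mul_div]
  rw [Nat.card_Icc]
  exact ⟨w - 1, by omega⟩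

theorem odd_C21 (hu : m + 1 ≤ u ∧ u ≤ 2 * m) : OddFamily.C21 m a b c (2 * m + 1 - u) =
    -((∏ j ∈ Finset.Icc 1 (2 * m + 1 - u), qForm a b c j u) /
      ∏ j ∈ Finset.Icc (u + 1) (2 * m), (c u - c j)) := by
  rw [OddFamily.C21, show 2 * m + 1 - (2 * m + 1 - u) = u by omega,
    show 2 * m + 2 - (2 * m + 1 - u) = u + 1 by omega]

theorem odd_C31 (hw : 1 ≤ w ∧ w ≤ m) : OddFamily.C31 m a b c (m + 1 - w) =
    -((∏ j ∈ Finset.Icc (m + 1) (2 * m + 1 - w), qForm a b c w j) /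
      ∏ j ∈ Finset.Icc (w + 1) m, (c w - c j)) := by
  rw [OddFamily.C31, show m + 1 - (m + 1 - w) = w by omega,
    show m + 2 - (m + 1 - w) = w + 1 by omega, show m + (m + 1 - w) = 2 * m + 1 - w by omega]

theorem odd_C32 (hu : m + 1 ≤ u ∧ u ≤ 2 * m) (hw : 1 ≤ w ∧ w ≤ m) :
    OddFamily.C32 m a b c (m + 1 - w) (2 * m + 1 - u) =
      pForm a b c u 2 1 * ((∏ k ∈ (Finset.Icc (m + 1) (2 * m + 1 - w)).erase u, qForm a b c w k) *
        ∏ k ∈ (Finset.Icc (2 * m + 1 + 1 - u) m).erase w, qForm a b c k u) /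
      ((∏ k ∈ Finset.Icc (w + 1) m, (c w - c k)) *
        ∏ k ∈ Finset.Icc (m + 1) (u - 1), (c u - c k)) := by
  rw [OddFamily.C32, show m + 1 - (m + 1 - w) = w by omega,
    show m + 2 - (m + 1 - w) = w + 1 by omega, show m + (m + 1 - w) = 2 * m + 1 - w by omega,
    show 2 * m + 1 - (2 * m + 1 - u) = u by omega, show 2 * m - (2 * m + 1 - u) = u - 1 by omega,
    show 2 * m + 1 - u + 1 = 2 * m + 1 + 1 - u by omega, prod_sub_comm, mul_assoc,
    mul_left_comm (∏ k ∈ Finset.Icc (w + 1) m, (c w - c k)), neg_one_pow_mul_div]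
  rw [Nat.card_Icc]
  exact ⟨u - m - 1, by omega⟩

theorem odd_entryB (hm : 2 ≤ m) (i j : Index (2 * m + 1) m) {p q : ℕ}
    (hp : p + number (2 * m + 1) m i = 2 * m + 1 + 1) (hq : q + number (2 * m + 1) m j = 2 * m + 1 + 1) :
    OddFamily.entryB m a b c p q =
      (Matrix.diagonal (data (2 * m + 1) m (X + C (b 2 - a 1)) 1 a b c).specB +
        nilB (2 * m + 1) m (X + C (b 2 - a 1)) 1 a b c) i j := by
  rw [Matrix.add_apply, Matrix.diagonal_apply]
  have hpForm : ∀ w, c w + (b 2 - a 1) = pForm a b c w 2 1 := fun w => by rw [pForm]; ring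
  rcases i with y | x | _ <;> rcases j with y' | x' | _
  all_goals simp only [OddFamily.entryB, nilB, CauchyData.nilB, data, CauchyData.specB,
    Matrix.of_apply, Sum.elim_inl, Sum.elim_inr, Sum.inl.injEq, Sum.inr.injEq, reduceCtorEq,
    if_false, if_true, add_zero, zero_add, Nat.add_sub_cancel, eval_add, eval_X, eval_C, hpForm, Subtype.ext_iff]
  all_goals simp only [number, Sum.elim_inl, Sum.elim_inr] at hp hq
  all_goals try have h1 := Finset.mem_Icc.1 y.2
  all_goals try have h2 := Finset.mem_Icc.1 x.2
  all_goals try have h3 := Finset.mem_Icc.1 y'.2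
  all_goals try have h4 := Finset.mem_Icc.1 x'.2
  · split_ifs <;> first | omega | rfl
  · split_ifs <;> first | omega | rfl
  · split_ifs <;> first | omega | rfl
  · rw [if_neg (by omega), if_pos (by omega), if_neg (by omega), show p - 1 = 2 * m + 1 - x by omega,
      show q - (m + 1) = m + 1 - y' by omega, odd_B23 h2 h3]
  · split_ifs <;> first | omega | rfl
  · split_ifs <;> first | omega | rfl
  · rw [if_pos (by omega), if_neg (by omega), if_neg (by omega),
      show q - (m + 1) = m + 1 - y' by omega, odd_B13 h3]
  · rw [if_pos (by omega), if_neg (by omega), if_pos (by omega), show q - 1 = 2 * m + 1 - x' by omega, odd_B12 h4]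
  · split_ifs <;> first | omega | rfl

theorem odd_entryC (hm : 2 ≤ m) (i j : Index (2 * m + 1) m) {p q : ℕ}
    (hp : p + number (2 * m + 1) m i = 2 * m + 1 + 1) (hq : q + number (2 * m + 1) m j = 2 * m + 1 + 1) :
    OddFamily.entryC m a b c p q =
      (Matrix.diagonal (data (2 * m + 1) m (X + C (b 2 - a 1)) 1 a b c).specC +
        nilC (2 * m + 1) m (X + C (b 2 - a 1)) 1 a b c) i j := by
  rw [Matrix.add_apply, Matrix.diagonal_apply]
  have hpForm : ∀ w, c w + (b 2 - a 1) = pForm a b c w 2 1 := fun w => by rw [pForm]; ring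
  rcases i with y | x | _ <;> rcases j with y' | x' | _
  all_goals simp only [OddFamily.entryC, nilC, CauchyData.nilC, data, CauchyData.specC,
    Matrix.of_apply, Sum.elim_inl, Sum.elim_inr, Sum.inl.injEq, Sum.inr.injEq, reduceCtorEq,
    if_false, if_true, add_zero, zero_add, Nat.add_sub_cancel, eval_one, one_mul, eval_add, eval_X, eval_C, hpForm,
    Subtype.ext_iff]
  all_goals simp only [number, Sum.elim_inl, Sum.elim_inr] at hp hq
  all_goals try have h1 := Finset.mem_Icc.1 y.2
  all_goals try have h2 := Finset.mem_Icc.1 x.2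
  all_goals try have h3 := Finset.mem_Icc.1 y'.2
  all_goals try have h4 := Finset.mem_Icc.1 x'.2
  · split_ifs <;> first | omega | rfl | (congr 1; omega)
  · rw [if_neg (by omega), if_neg (by omega), if_neg (by omega), if_neg (by omega),
      if_pos (by omega), show q - 1 = 2 * m + 1 - x' by omega,
      show p - (m + 1) = m + 1 - y by omega,
      odd_C32 h4 h1]
  · rw [if_neg (by omega), if_neg (by omega), if_neg (by omega), if_pos (by omega),
      show p - (m + 1) = m + 1 - y by omega, odd_C31 h1]
  · split_ifs <;> first | omega | rfl
  · split_ifs <;> first | omega | rfl | (congr 1; omega)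
  · rw [if_neg (by omega), if_neg (by omega), if_pos (by omega), if_pos (by omega),
      show p - 1 = 2 * m + 1 - x by omega, odd_C21 h2]
  · split_ifs <;> first | omega | rfl
  · split_ifs <;> first | omega | rfl
  · rw [if_pos (by omega)]
    congr 1
    omega

theorem odd_num (k : ℕ) : OddFamily.num m a b c k =
    num (2 * m + 1) m (X + C (b 2 - a 1)) 1 a b c k := by
  rw [OddFamily.num, num]
  split_ifs
  · rw [mul_one]
  · simp only [eval_one, mul_one, eval_add, eval_X, eval_C, pForm]
    ring

theorem odd_den (k : ℕ) : OddFamily.den m a b c k =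
    den (2 * m + 1) m (X + C (b 2 - a 1)) 1 a b c k := by
  rw [OddFamily.den, den]
  split_ifs
  · simp only [eval_one, mul_one, eval_add, eval_X, eval_C, pForm]
    ring
  · rfl

/-- Each of the two polynomials has one linear factor, `p^{21}` and `p^{31}`. The reflection changes
one sign, which the odd power of `-1` restores. -/
theorem odd_isAdmissible (hm : 2 ≤ m) (hc : Set.InjOn c (Finset.Icc 1 (2 * m + 1)))
    (htr : (m + 1) * a 1 + m * a 2 =
      b 1 + m * b 2 + m * b 3 + ∑ k ∈ Finset.Icc 1 (2 * m + 1), c k) :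
    IsAdmissible (2 * m + 1) m (X + C (b 2 - a 1)) 1 a b c where
  two_le := hm
  le := by omega
  le' := le_rfl
  monicφ := monic_X_add_C _
  monicχ := monic_one
  natDegreeφ := by rw [natDegree_X_add_C]; omega
  natDegreeχ := by simp
  eval_mul_eval t := by
    rw [(odd_two_mul_add_one m).neg_one_pow]
    simp only [eval_one, eval_mul, eval_add, eval_X, eval_C]
    ring
  traceφ := by
    rw [nextCoeff_X_add_C]
    linear_combination -htr
  traceχ := by
    rw [mul_one, nextCoeff_X_add_C]
    push_cast
    linear_combination -htr
  injOn := hc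

end Odd

end CauchyFamily

end

/-! ### Realization of the even and odd families. -/

noncomputable section

namespace CauchyFamily

open Polynomial

variable {n m : ℕ}

theorem number_lt_of_level_lt (hm : 2 ≤ m) (hn : 2 * m ≤ n) {i j : Index n m}
    (h : CauchyData.level i < CauchyData.level j) : number n m i < number n m j := by
  rcases i with y | x | _ <;> rcases j with y' | x' | _ <;> simp [CauchyData.level] at h
  all_goals simp only [number, Sum.elim_inl, Sum.elim_inr]
  all_goals try have h1 := Finset.mem_Icc.1 y.2
  all_goals try have h2 := Finset.mem_Icc.1 x.2
  all_goals try have h4 := Finset.mem_Icc.1 x'.2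
  all_goals omega

/-- The position of the eigenvalue of `C` on the diagonal. -/
def position (hm : 2 ≤ m) (hn : 2 * m ≤ n) : Index n m ≃ Fin n :=
  Equiv.ofBijective (fun i => ⟨n - number n m i, by have := one_le_number hm hn i; omega⟩) <| by
    rw [Fintype.bijective_iff_injective_and_card]
    constructor
    · intro i j hij
      have h1 := number_le hn i
      have h2 := number_le hn j
      have h3 : n - number n m i = n - number n m j := congrArg Fin.val hij
      exact number_injective hm hn (by omega)
    · simp
      omega

theorem position_val (hm : 2 ≤ m) (hn : 2 * m ≤ n) (i : Index n m) :
    (position hm hn i : ℕ) = n - number n m i := rfl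

theorem position_add (hm : 2 ≤ m) (hn : 2 * m ≤ n) (i : Index n m) :
    (position hm hn i : ℕ) + 1 + number n m i = n + 1 := by
  rw [position_val]
  have := number_le hn i
  omega

theorem rev_position_add_one (hm : 2 ≤ m) (hn : 2 * m ≤ n) (i : Index n m) :
    ((position hm hn i).rev : ℕ) + 1 = number n m i := by
  rw [Fin.val_rev, position_val]
  have := number_le hn i
  have := one_le_number hm hn i
  omega

variable {φ χ : ℂ[X]}

theorem realizes_of_isAdmissible {t : SimpsonType} {s : TripleSpace t.dim} (hs : s ∈ t.S)
    (hE : ∀ v, t.IsEigenbasis s v ↔ ∀ i, t.matC s *ᵥ v i = s.2.2 i • v i ∧ v i i.rev = 1 ∧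
      ∀ j, j < i.rev → v i j = 0)
    (h : IsAdmissible t.dim m φ χ (t.eigA s) (t.eigB s) (t.eigC s))
    (hA : ∀ i, s.1 i = t.eigA s 1 ∨ s.1 i = t.eigA s 2)
    (hB : ∀ i j, t.matB s (position h.two_le h.le i) (position h.two_le h.le j) =
      (Matrix.diagonal (data t.dim m φ χ (t.eigA s) (t.eigB s) (t.eigC s)).specB +
        nilB t.dim m φ χ (t.eigA s) (t.eigB s) (t.eigC s)) i j)
    (hC : ∀ i j, t.matC s (position h.two_le h.le i) (position h.two_le h.le j) =
      (Matrix.diagonal (data t.dim m φ χ (t.eigA s) (t.eigB s) (t.eigC s)).specC +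
        nilC t.dim m φ χ (t.eigA s) (t.eigB s) (t.eigC s)) i j)
    (hspecB : ∀ i, s.2.1 (position h.two_le h.le i) =
      (data t.dim m φ χ (t.eigA s) (t.eigB s) (t.eigC s)).specB i)
    (hnum : ∀ k, t.num s k = num t.dim m φ χ (t.eigA s) (t.eigB s) (t.eigC s) (k + 1))
    (hden : ∀ k, t.den s k = den t.dim m φ χ (t.eigA s) (t.eigB s) (t.eigC s) (k + 1))
    (hb : Set.InjOn (t.eigB s) (Finset.Icc 1 3)) : t.Realizes s := by
  have hb12 : t.eigB s 1 - t.eigB s 2 ≠ 0 := sub_ne_zero.2 fun h' => by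
    have := hb (by simp) (by simp) h'
    omega
  have hb13 : t.eigB s 1 - t.eigB s 3 ≠ 0 := sub_ne_zero.2 fun h' => by
    have := hb (by simp) (by simp) h'
    omega
  have hb23 : t.eigB s 2 - t.eigB s 3 ≠ 0 := sub_ne_zero.2 fun h' => by
    have := hb (by simp) (by simp) h'
    omega
  refine t.realizes_of_levels hs hE (position h.two_le h.le) CauchyData.level_le_two
    (fun i j hij => ?_) (fun i j hij => ?_) (fun i j hij => ?_) (Matrix.ext hB) (Matrix.ext hC)
    (fun i => ?_) hspecB (fun i j hij => ?_) hA (quadratic h) (fun _ i j => ?_) (fun hs' => ?_)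
  · have := number_lt_of_level_lt h.two_le h.le hij
    have := number_le h.le j
    rw [Fin.lt_def, position_val, position_val]
    omega
  · rw [← (data t.dim m φ χ (t.eigA s) (t.eigB s) (t.eigC s)).nilB_eq_zero i j hij]
    rcases i with y | x | _ <;> rcases j with y' | x' | _ <;> simp [CauchyData.level] at hij <;> rfl
  · rw [← (data t.dim m φ χ (t.eigA s) (t.eigB s) (t.eigC s)).nilC_eq_zero i j hij]
    rcases i with y | x | _ <;> rcases j with y' | x' | _ <;> simp [CauchyData.level] at hij <;> rfl
  · rw [SimpsonType.specC_of_mem_S, rev_position_add_one, specC_data]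
  · rcases i with y | x | _ <;> rcases j with y' | x' | _ <;> simp [CauchyData.level] at hij
    · exact (sub_ne_zero.1 hb23).symm
    · exact (sub_ne_zero.1 hb13).symm
    · exact (sub_ne_zero.1 hb12).symm
  · rw [hnum, hnum, hden, hden, rev_position_add_one, rev_position_add_one]
    exact num_mul_den_mul_conj h i j
  · obtain ⟨i, hi⟩ := exists_num_ne_zero h (mul_ne_zero hb12 hb13) fun i => by
      rw [← rev_position_add_one h.two_le h.le, ← hden]
      exact hs'.2 _
    refine ⟨(position h.two_le h.le i).rev, ?_⟩
    rw [hnum, rev_position_add_one]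
    exact hi

theorem even_specB {a b c : ℕ → ℂ} {i : Index (2 * m) m} {p : ℕ}
    (hp : p + 1 + number (2 * m) m i = 2 * m + 1) :
    (if p = 0 then b 1 else if p < m then b 2 else b 3) =
      (data (2 * m) m φ χ a b c).specB i := by
  rcases i with y | x | _
  all_goals simp only [number, Sum.elim_inl, Sum.elim_inr] at hp
  · have h2 := Finset.mem_Icc.1 y.2
    rw [if_neg (by omega), if_neg (by omega)]
    rfl
  · have h2 := Finset.mem_Icc.1 x.2
    rw [if_neg (by omega), if_pos (by omega)]
    rfl
  · rw [if_pos (by omega)]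
    rfl

theorem odd_specB {a b c : ℕ → ℂ} {i : Index (2 * m + 1) m} {p : ℕ}
    (hp : p + 1 + number (2 * m + 1) m i = 2 * m + 1 + 1) :
    (if p = 0 then b 1 else if p < m + 1 then b 2 else b 3) =
      (data (2 * m + 1) m φ χ a b c).specB i := by
  rcases i with y | x | _
  all_goals simp only [number, Sum.elim_inl, Sum.elim_inr] at hp
  · have h2 := Finset.mem_Icc.1 y.2
    rw [if_neg (by omega), if_neg (by omega)]
    rfl
  · have h2 := Finset.mem_Icc.1 x.2
    rw [if_neg (by omega), if_pos (by omega)]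
    rfl
  · rw [if_pos (by omega)]
    rfl

end CauchyFamily

namespace SimpsonType

open CauchyFamily

theorem realizes_even {m : ℕ} {hm : 2 ≤ m} {s : TripleSpace (even m hm).dim}
    (hs : s ∈ (even m hm).S) : (even m hm).Realizes s := by
  have h := even_isAdmissible hm (eigC_injOn hs) (trace_even hs)
  refine realizes_of_isAdmissible hs (fun v => Iff.rfl) h (fun i => ?_)
    (fun i j => even_entryB hm i j (position_add _ _ i) (position_add _ _ j))
    (fun i j => even_entryC hm i j (position_add _ _ i) (position_add _ _ j)) (fun i => ?_)
    (fun k => even_num _) (fun k => even_den _) (eigB_injOn hs)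
  · have := specA_even hs i
    split_ifs at this
    · exact Or.inl this
    · exact Or.inr this
  · exact (specB_even hs _).trans (even_specB (position_add h.two_le h.le i))

theorem realizes_odd {m : ℕ} {hm : 2 ≤ m} {s : TripleSpace (odd m hm).dim}
    (hs : s ∈ (odd m hm).S) : (odd m hm).Realizes s := by
  have h := odd_isAdmissible hm (eigC_injOn hs) (trace_odd hs)
  refine realizes_of_isAdmissible hs (fun v => Iff.rfl) h (fun i => ?_)
    (fun i j => odd_entryB hm i j (position_add _ _ i) (position_add _ _ j))
    (fun i j => odd_entryC hm i j (position_add _ _ i) (position_add _ _ j)) (fun i => ?_)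
    (fun k => odd_num _) (fun k => odd_den _) (eigB_injOn hs)
  · have := specA_odd hs i
    split_ifs at this
    · exact Or.inl this
    · exact Or.inr this
  · exact (specB_odd hs _).trans (odd_specB (position_add h.two_le h.le i))

end SimpsonType

end

noncomputable section

/-! ### Six eigenvalues in three blocks of two -/

namespace ThreeBlocks

/-- The number of the block. -/
def lev : Fin 6 → ℕ := ![0, 0, 1, 1, 2, 2]

theorem lev_le_two (i : Fin 6) : lev i ≤ 2 := by
  fin_cases i <;> simp [lev]

/-- The part of `diagonal w * P` above the diagonal blocks. -/
def upper (w : Fin 6 → ℂ) (P : Matrix (Fin 6) (Fin 6) ℂ) : Matrix (Fin 6) (Fin 6) ℂ :=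
  Matrix.of fun i j => if lev i < lev j then w i * P i j else 0

/-- The part of `diagonal w * P` below the diagonal blocks. -/
def lower (w : Fin 6 → ℂ) (P : Matrix (Fin 6) (Fin 6) ℂ) : Matrix (Fin 6) (Fin 6) ℂ :=
  Matrix.of fun i j => if lev j < lev i then w i * P i j else 0

variable {x w : Fin 6 → ℂ} {β : Fin 3 → ℂ} {P : Matrix (Fin 6) (Fin 6) ℂ}

theorem upper_eq_zero (i j : Fin 6) (h : ¬ lev i < lev j) : upper w P i j = 0 := if_neg h

theorem lower_eq_zero (i j : Fin 6) (h : ¬ 2 - lev i < 2 - lev j) : lower w P i j = 0 :=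
  if_neg fun h' => h (by have := lev_le_two i; omega)

/-- The sums of `P` over the middle block, with resolvents. -/
def middle (x : Fin 6 → ℂ) (P : Matrix (Fin 6) (Fin 6) ℂ) (t : ℂ) (i j : Fin 6) : ℂ :=
  P i 2 * P 2 j / (t - x 2) + P i 3 * P 3 j / (t - x 3)

theorem mul_right_of_lev_zero {j : Fin 6} (hj : lev j = 0) (i : Fin 6) :
    (P * rightEigenvectors x (upper w P)) i j = P i j := by
  rw [Matrix.mul_apply, Finset.sum_eq_single j]
  · rw [rightEigenvectors_apply_eq_ite upper_eq_zero (by omega), if_pos rfl, mul_one]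
  · intro k _ hk
    rw [rightEigenvectors_apply_eq_ite upper_eq_zero (by omega), if_neg hk, mul_zero]
  · simp

/-- As `P` is the identity on the blocks, the entry is `w i * P i j / (x j - x i) + P i j`, and `w i
+ (x j - x i) = β 2 + x j`. -/
theorem mul_right_of_lev_one (hx : Function.Injective x) (hw : ∀ i, lev i = 0 → w i = β 2 + x i)
    (hP : ∀ i j, lev i = lev j → P i j = if i = j then 1 else 0) {i j : Fin 6} (hi : lev i = 0)
    (hj : lev j = 1) : (P * rightEigenvectors x (upper w P)) i j =
      (β 2 + x j) * P i j / (x j - x i) := by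
  have hne : x j - x i ≠ 0 := sub_ne_zero.2 fun h => by simp [hx h, hi] at hj
  have hP0 : P 0 0 = 1 ∧ P 0 1 = 0 ∧ P 1 0 = 0 ∧ P 1 1 = 1 :=
    ⟨hP 0 0 rfl, hP 0 1 rfl, hP 1 0 rfl, hP 1 1 rfl⟩
  have h01 : w 0 = _ ∧ w 1 = _ := ⟨hw 0 rfl, hw 1 rfl⟩
  rw [Matrix.mul_apply, Fin.sum_univ_six]
  fin_cases i <;> simp [lev] at hi <;> fin_cases j <;> simp [lev] at hj
  all_goals
    simp [rightEigenvectors, upper, Fin.sum_univ_six, lev, hP0, h01] at hne ⊢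
    field_simp
    ring

/-- The same collection of terms is done twice. The factorization `hP'` writes `P i j` as a sum over
paths through the middle block, so that it combines with the second-order terms. -/
theorem mul_right_of_lev_two (hx : Function.Injective x) (hw : ∀ i, lev i = 0 → w i = β 2 + x i)
    (hw' : ∀ i, lev i = 1 → w i = β 1 + x i)
    (hP : ∀ i j, lev i = lev j → P i j = if i = j then 1 else 0)
    (hP' : ∀ i j, P i j = P i 2 * P 2 j + P i 3 * P 3 j) {i j : Fin 6} (hi : lev i = 0)
    (hj : lev j = 2) : (P * rightEigenvectors x (upper w P)) i j =
      (β 2 + x j) * (β 1 + x j) * middle x P (x j) i j / (x j - x i) := by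
  have hne : x j - x i ≠ 0 := sub_ne_zero.2 fun h => by simp [hx h, hi] at hj
  have hne2 : x j - x 2 ≠ 0 := sub_ne_zero.2 fun h => by simp [hx h, lev] at hj
  have hne3 : x j - x 3 ≠ 0 := sub_ne_zero.2 fun h => by simp [hx h, lev] at hj
  have h1 := hP' i j
  have hP0 : P 0 0 = 1 ∧ P 0 1 = 0 ∧ P 1 0 = 0 ∧ P 1 1 = 1 :=
    ⟨hP 0 0 rfl, hP 0 1 rfl, hP 1 0 rfl, hP 1 1 rfl⟩
  have h01 : w 0 = _ ∧ w 1 = _ := ⟨hw 0 rfl, hw 1 rfl⟩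
  have h23 : w 2 = _ ∧ w 3 = _ := ⟨hw' 2 rfl, hw' 3 rfl⟩
  rw [Matrix.mul_apply, Fin.sum_univ_six]
  fin_cases i <;> simp [lev] at hi <;> fin_cases j <;> simp [lev] at hj
  all_goals
    simp [rightEigenvectors, upper, Fin.sum_univ_six, lev, hP0, h01, h23, middle] at hne hne2 hne3 h1 ⊢
    rw [h1]
    field_simp
    ring

theorem left_mul_of_lev_two {j s : Fin 6} (hj : lev j = 2) (hs : lev s = 2)
    (hP : ∀ i j, lev i = lev j → P i j = if i = j then 1 else 0) :
    (leftEigenvectors x (upper w P) * Matrix.of fun i j => w i * P i j) j s =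
      if j = s then w j else 0 := by
  rw [Matrix.mul_apply, Finset.sum_eq_single j]
  · rw [leftEigenvectors_apply_eq_ite upper_eq_zero (lt_irrefl _), if_pos rfl, one_mul,
      Matrix.of_apply, hP _ _ (hj.trans hs.symm), mul_ite, mul_one, mul_zero]
  · intro k _ hk
    rw [leftEigenvectors_apply_eq_ite upper_eq_zero (by have := lev_le_two k; omega),
      if_neg hk.symm, zero_mul]
  · simp

theorem left_mul_of_lev_one (hx : Function.Injective x) (hw : ∀ i, lev i = 2 → w i = β 0 + x i)
    (hP : ∀ i j, lev i = lev j → P i j = if i = j then 1 else 0) {j s : Fin 6} (hj : lev j = 1)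
    (hs : lev s = 2) : (leftEigenvectors x (upper w P) * Matrix.of fun i j => w i * P i j) j s =
      w j * (β 0 + x j) * P j s / (x j - x s) := by
  have hne : x j - x s ≠ 0 := sub_ne_zero.2 fun h => by simp [hx h, hs] at hj
  have hP2 : P 4 4 = 1 ∧ P 4 5 = 0 ∧ P 5 4 = 0 ∧ P 5 5 = 1 :=
    ⟨hP 4 4 rfl, hP 4 5 rfl, hP 5 4 rfl, hP 5 5 rfl⟩
  have h45 : w 4 = _ ∧ w 5 = _ := ⟨hw 4 rfl, hw 5 rfl⟩
  rw [Matrix.mul_apply, Fin.sum_univ_six]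
  fin_cases j <;> simp [lev] at hj <;> fin_cases s <;> simp [lev] at hs
  all_goals
    simp [leftEigenvectors, upper, Fin.sum_univ_six, lev, hP2, h45] at hne ⊢
    field_simp
    ring

theorem left_mul_of_lev_zero (hx : Function.Injective x) (hw : ∀ i, lev i = 2 → w i = β 0 + x i)
    (hw' : ∀ i, lev i = 1 → w i = β 1 + x i)
    (hP : ∀ i j, lev i = lev j → P i j = if i = j then 1 else 0)
    (hP' : ∀ i j, P i j = P i 2 * P 2 j + P i 3 * P 3 j) {j s : Fin 6} (hj : lev j = 0)
    (hs : lev s = 2) : (leftEigenvectors x (upper w P) * Matrix.of fun i j => w i * P i j) j s =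
      w j * (β 0 + x j) * (β 1 + x j) * middle x P (x j) j s / (x j - x s) := by
  have hne : x j - x s ≠ 0 := sub_ne_zero.2 fun h => by simp [hx h, hs] at hj
  have hne2 : x j - x 2 ≠ 0 := sub_ne_zero.2 fun h => by simp [hx h, lev] at hj
  have hne3 : x j - x 3 ≠ 0 := sub_ne_zero.2 fun h => by simp [hx h, lev] at hj
  have h1 := hP' j s
  have hP2 : P 4 4 = 1 ∧ P 4 5 = 0 ∧ P 5 4 = 0 ∧ P 5 5 = 1 :=
    ⟨hP 4 4 rfl, hP 4 5 rfl, hP 5 4 rfl, hP 5 5 rfl⟩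
  have h45 : w 4 = _ ∧ w 5 = _ := ⟨hw 4 rfl, hw 5 rfl⟩
  have h23 : w 2 = _ ∧ w 3 = _ := ⟨hw' 2 rfl, hw' 3 rfl⟩
  rw [Matrix.mul_apply, Fin.sum_univ_six]
  fin_cases j <;> simp [lev] at hj <;> fin_cases s <;> simp [lev] at hs
  all_goals
    simp [leftEigenvectors, upper, Fin.sum_univ_six, lev, hP2, h45, h23, middle] at hne hne2 hne3 h1 ⊢
    rw [h1]
    field_simp
    ring

/-- By `hP` the conjugate is `∑ X_s(i) Y_s(j)` over `s = 4, 5`, with columns `X_s` of `L w P` and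
rows `Y_s` of `P R`. The hypotheses `h4`, `h5` say `p X_s = q ∑ T_{st} Y_t` for the matrix `T_{st} =
Z₀ s * P 0 t + Z₁ s * P 1 t`, and `hZ` is the symmetry of `T`. -/
theorem conj_symm (hP : ∀ i j, P i j = P i 4 * P 4 j + P i 5 * P 5 j)
    {L R : Matrix (Fin 6) (Fin 6) ℂ} {p q Z₀ Z₁ : Fin 6 → ℂ}
    (hZ : Z₀ 4 * P 0 5 + Z₁ 4 * P 1 5 = Z₀ 5 * P 0 4 + Z₁ 5 * P 1 4)
    (h4 : ∀ j, q j * (Z₀ 4 * (P * R) 0 j + Z₁ 4 * (P * R) 1 j) =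
      p j * (L * Matrix.of fun i j => w i * P i j) j 4)
    (h5 : ∀ j, q j * (Z₀ 5 * (P * R) 0 j + Z₁ 5 * (P * R) 1 j) =
      p j * (L * Matrix.of fun i j => w i * P i j) j 5) (i j : Fin 6) :
    p i * q j * (L * (Matrix.of fun i j => w i * P i j) * R) i j =
      p j * q i * (L * (Matrix.of fun i j => w i * P i j) * R) j i := by
  have hPR : ∀ i j, (P * R) i j = P i 4 * (P * R) 4 j + P i 5 * (P * R) 5 j := fun i j => by
    simp only [Matrix.mul_apply, Finset.mul_sum, ← Finset.sum_add_distrib]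
    refine Finset.sum_congr rfl fun k _ => ?_
    rw [hP i k]
    ring
  have hLR : ∀ i j, (L * (Matrix.of fun i j => w i * P i j) * R) i j =
      (L * Matrix.of fun i j => w i * P i j) i 4 * (P * R) 4 j +
        (L * Matrix.of fun i j => w i * P i j) i 5 * (P * R) 5 j := fun i j => by
    have h1 : (Matrix.of fun i j => w i * P i j) * R =
        Matrix.of fun i j => w i * (P * R) i j := by
      ext k l
      simp only [Matrix.mul_apply, Matrix.of_apply, Finset.mul_sum, mul_assoc]
    rw [Matrix.mul_assoc, h1]
    simp only [Matrix.mul_apply (M := L), Matrix.of_apply, Finset.sum_mul,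
      ← Finset.sum_add_distrib]
    refine Finset.sum_congr rfl fun k _ => ?_
    rw [hPR k j]
    ring
  have i4 := h4 i
  have i5 := h5 i
  have j4 := h4 j
  have j5 := h5 j
  rw [hPR 0, hPR 1] at i4 i5 j4 j5
  rw [hLR, hLR]
  linear_combination -q j * (P * R) 4 j * i4 - q j * (P * R) 5 j * i5 +
    q i * (P * R) 4 i * j4 + q i * (P * R) 5 i * j5 +
    q i * q j * ((P * R) 4 j * (P * R) 5 i - (P * R) 5 j * (P * R) 4 i) * hZ

/-- Since `P` factors through the last block, the square is controlled by a two-by-two matrix of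
weighted sums, which the hypotheses make equal to `κ` times the identity. -/
theorem mul_self_eq_smul (hP : ∀ i j, P i j = P i 4 * P 4 j + P i 5 * P 5 j) {κ : ℂ}
    (h44 : ∑ k, P 4 k * w k * P k 4 = κ) (h45 : ∑ k, P 4 k * w k * P k 5 = 0)
    (h54 : ∑ k, P 5 k * w k * P k 4 = 0) (h55 : ∑ k, P 5 k * w k * P k 5 = κ) :
    (Matrix.of fun i j => w i * P i j) * (Matrix.of fun i j => w i * P i j) =
      κ • Matrix.of fun i j => w i * P i j := by
  ext i j
  simp only [Matrix.mul_apply, Matrix.of_apply, Matrix.smul_apply, smul_eq_mul]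
  have h : ∀ k, w i * P i k * (w k * P k j) =
      w i * P i 4 * P 4 j * (P 4 k * w k * P k 4) + w i * P i 4 * P 5 j * (P 4 k * w k * P k 5) +
      w i * P i 5 * P 4 j * (P 5 k * w k * P k 4) +
      w i * P i 5 * P 5 j * (P 5 k * w k * P k 5) := fun k => by
    rw [hP i k, hP k j]
    ring
  simp only [h, Finset.sum_add_distrib, ← Finset.mul_sum, h44, h45, h54, h55]
  rw [hP i j]
  ring

end ThreeBlocks

end

noncomputable section

/-! ### The extra case -/

namespace ExtraCase

theorem q_eq (c : ℕ → ℂ) (i j k : ℕ) :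
    q c i j k = c i + c j + c k - (c 1 + c 2 + c 3 + c 4 + c 5 + c 6) / 2 := by
  rw [q, Finset.sum_Icc_succ_top (by norm_num), Finset.sum_Icc_succ_top (by norm_num),
    Finset.sum_Icc_succ_top (by norm_num), Finset.sum_Icc_succ_top (by norm_num),
    Finset.sum_Icc_succ_top (by norm_num), Finset.Icc_self, Finset.sum_singleton]
  ring

/-- The matrix with `A - a_1 = diagonal w * P`. -/
def profile (c : ℕ → ℂ) : Matrix (Fin 6) (Fin 6) ℂ :=
  !![1, 0, -q c 2 3 6 / (c 1 - c 2),
      q c 2 4 5 * q c 2 4 6 / ((c 1 - c 2) * (c 3 - c 4)), q c 2 4 5 / (c 1 - c 2),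
      q c 2 3 6 * q c 2 4 6 / ((c 1 - c 2) * (c 5 - c 6));
     0, 1, -1, q c 2 3 5 / (c 3 - c 4), -1, -q c 2 3 5 / (c 5 - c 6);
     q c 2 3 5 / (c 3 - c 4), -(q c 2 4 5 * q c 2 4 6) / ((c 1 - c 2) * (c 3 - c 4)), 1, 0,
      -q c 2 4 5 / (c 3 - c 4), -(q c 2 3 5 * q c 2 4 6) / ((c 3 - c 4) * (c 5 - c 6));
     1, -q c 2 3 6 / (c 1 - c 2), 0, 1, -1, -q c 2 3 6 / (c 5 - c 6);
     -q c 2 3 5 / (c 5 - c 6), -(q c 2 3 6 * q c 2 4 6) / ((c 1 - c 2) * (c 5 - c 6)),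
      -q c 2 3 6 / (c 5 - c 6), q c 2 3 5 * q c 2 4 6 / ((c 3 - c 4) * (c 5 - c 6)), 1, 0;
     1, q c 2 4 5 / (c 1 - c 2), 1, -q c 2 4 5 / (c 3 - c 4), 0, 1]

/-- The diagonal factor of `A - a_1`. -/
def weight (a b c : ℕ → ℂ) : Fin 6 → ℂ :=
  ![p a b c 3 1, p a b c 3 2, p a b c 2 3, p a b c 2 4, p a b c 1 5, p a b c 1 6]

variable {a b c : ℕ → ℂ}

theorem profile_of_lev_eq (i j : Fin 6) (h : ThreeBlocks.lev i = ThreeBlocks.lev j) :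
    profile c i j = if i = j then 1 else 0 := by
  fin_cases i <;> fin_cases j <;> simp [ThreeBlocks.lev] at h <;> simp [profile]

/-- A matrix of rank two with an identity block is the product of the columns and the rows through
that block. -/
theorem profile_eq_middle (h12 : c 1 - c 2 ≠ 0) (h34 : c 3 - c 4 ≠ 0) (h56 : c 5 - c 6 ≠ 0)
    (i j : Fin 6) :
    profile c i j = profile c i 2 * profile c 2 j + profile c i 3 * profile c 3 j := by
  fin_cases i <;> fin_cases j <;> simp [profile]
  all_goals
    field_simp
    simp only [q_eq]
    ring

theorem profile_eq_last (h12 : c 1 - c 2 ≠ 0) (h34 : c 3 - c 4 ≠ 0) (h56 : c 5 - c 6 ≠ 0)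
    (i j : Fin 6) :
    profile c i j = profile c i 4 * profile c 4 j + profile c i 5 * profile c 5 j := by
  fin_cases i <;> fin_cases j <;> simp [profile]
  all_goals
    field_simp
    simp only [q_eq]
    ring

end ExtraCase

end

/-! ### The quadratic relation and the symmetrizing matrix in the extra case. -/

noncomputable section

namespace ExtraCase

open ThreeBlocks

variable {a b c : ℕ → ℂ}

theorem weighted_mul_self (h12 : c 1 - c 2 ≠ 0) (h34 : c 3 - c 4 ≠ 0) (h56 : c 5 - c 6 ≠ 0)
    (htr : 4 * a 1 + 2 * a 2 = 2 * b 1 + 2 * b 2 + 2 * b 3 + ∑ k ∈ Finset.Icc 1 6, c k) :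
    (Matrix.of fun i j => weight a b c i * profile c i j) *
      (Matrix.of fun i j => weight a b c i * profile c i j) =
      (a 2 - a 1) • Matrix.of fun i j => weight a b c i * profile c i j := by
  have hκ : a 2 - a 1 =
      b 1 + b 2 + b 3 + (c 1 + c 2 + c 3 + c 4 + c 5 + c 6) / 2 - 3 * a 1 := by
    -- This only serves to write out the sum of the six `c k`; the terms `c 0` cancel.
    have h := q_eq c 0 0 0
    rw [q] at h
    linear_combination htr / 2 - h
  rw [hκ]
  refine mul_self_eq_smul (profile_eq_last h12 h34 h56) ?_ ?_ ?_ ?_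
  all_goals
    rw [Fin.sum_univ_six]
    simp [profile, weight, p]
    field_simp
    simp only [q_eq]
    ring

/-- The eigenvalues of `C` in the order of their indices. -/
def points (c : ℕ → ℂ) : Fin 6 → ℂ := ![c 1, c 2, c 3, c 4, c 5, c 6]

/-- The differences of the eigenvalues of `C` do not vanish. -/
structure HasDistinctEntries (c : ℕ → ℂ) : Prop where
  ne : ∀ i ∈ Finset.Icc 1 6, ∀ j ∈ Finset.Icc 1 6, i ≠ j → c i - c j ≠ 0

theorem HasDistinctEntries.sub_ne (h : HasDistinctEntries c) (i j : ℕ) (hi : i ∈ Finset.Icc 1 6 := by decide)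
    (hj : j ∈ Finset.Icc 1 6 := by decide) (hij : i ≠ j := by decide) : c i - c j ≠ 0 :=
  h.ne i hi j hj hij

/-- At the eigenvalue that belongs to one of its two indices the two-term sum `middle` collapses to
a product of linear forms; the next lemmas are further instances. -/
theorem middle_zero_five (h : HasDistinctEntries c) : middle (points c) (profile c) (c 1) 0 5 =
    q c 1 2 5 * q c 1 3 5 * q c 1 4 5 /
      ((c 5 - c 6) * (c 1 - c 2) * (c 1 - c 3) * (c 1 - c 4)) := by
  have h1 := h.sub_ne 1 2
  have h2 := h.sub_ne 1 3
  have h3 := h.sub_ne 1 4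
  have h4 := h.sub_ne 3 4
  have h5 := h.sub_ne 5 6
  simp [middle, profile, points]
  field_simp
  simp only [q_eq]
  ring

theorem middle_zero_four (h : HasDistinctEntries c) : middle (points c) (profile c) (c 1) 0 4 =
    -(q c 1 2 6 * q c 1 3 6) / ((c 1 - c 2) * (c 1 - c 3) * (c 1 - c 4)) := by
  have h1 := h.sub_ne 1 2
  have h2 := h.sub_ne 1 3
  have h3 := h.sub_ne 1 4
  have h4 := h.sub_ne 3 4
  simp [middle, profile, points]
  field_simp
  simp only [q_eq]
  ring

theorem middle_one_five (h : HasDistinctEntries c) : middle (points c) (profile c) (c 2) 1 5 =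
    q c 1 2 5 * q c 1 4 6 / ((c 5 - c 6) * (c 2 - c 3) * (c 2 - c 4)) := by
  have h2 := h.sub_ne 2 3
  have h3 := h.sub_ne 2 4
  have h4 := h.sub_ne 3 4
  have h5 := h.sub_ne 5 6
  simp [middle, profile, points]
  field_simp
  simp only [q_eq]
  ring

theorem middle_one_four (h : HasDistinctEntries c) : middle (points c) (profile c) (c 2) 1 4 =
    -q c 1 2 6 / ((c 2 - c 3) * (c 2 - c 4)) := by
  have h2 := h.sub_ne 2 3
  have h3 := h.sub_ne 2 4
  have h4 := h.sub_ne 3 4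
  simp [middle, profile, points]
  field_simp
  simp only [q_eq]
  ring

theorem middle_four_zero (h : HasDistinctEntries c) : middle (points c) (profile c) (c 5) 0 4 =
    q c 2 4 5 * q c 2 5 6 / ((c 1 - c 2) * (c 5 - c 3) * (c 5 - c 4)) := by
  have h1 := h.sub_ne 1 2
  have h2 := h.sub_ne 5 3
  have h3 := h.sub_ne 5 4
  have h4 := h.sub_ne 3 4
  simp [middle, profile, points]
  field_simp
  simp only [q_eq]
  ring

theorem middle_four_one (h : HasDistinctEntries c) : middle (points c) (profile c) (c 5) 1 4 =
    q c 2 3 4 / ((c 5 - c 3) * (c 5 - c 4)) := by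
  have h2 := h.sub_ne 5 3
  have h3 := h.sub_ne 5 4
  have h4 := h.sub_ne 3 4
  simp [middle, profile, points]
  field_simp
  simp only [q_eq]
  ring

theorem middle_five_zero (h : HasDistinctEntries c) : middle (points c) (profile c) (c 6) 0 5 =
    q c 2 3 6 * q c 2 4 6 * q c 2 5 6 /
      ((c 1 - c 2) * (c 5 - c 6) * (c 6 - c 3) * (c 6 - c 4)) := by
  have h1 := h.sub_ne 1 2
  have h2 := h.sub_ne 6 3
  have h3 := h.sub_ne 6 4
  have h4 := h.sub_ne 3 4
  have h5 := h.sub_ne 5 6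
  simp [middle, profile, points]
  field_simp
  simp only [q_eq]
  ring

theorem middle_five_one (h : HasDistinctEntries c) : middle (points c) (profile c) (c 6) 1 5 =
    q c 2 3 4 * q c 2 3 5 / ((c 5 - c 6) * (c 6 - c 3) * (c 6 - c 4)) := by
  have h2 := h.sub_ne 6 3
  have h3 := h.sub_ne 6 4
  have h4 := h.sub_ne 3 4
  have h5 := h.sub_ne 5 6
  simp [middle, profile, points]
  field_simp
  simp only [q_eq]
  ring

/-- The row `0` of the symmetrizing matrix. -/
def symmZero (c : ℕ → ℂ) : Fin 6 → ℂ :=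
  ![0, 0, 0, 0, q c 1 2 6 * q c 1 3 6 * (c 1 - c 6),
    -(q c 1 2 5 * q c 1 3 5 * q c 1 4 5 * (c 1 - c 5)) / (c 5 - c 6)]

/-- The row `1` of the symmetrizing matrix. -/
def symmOne (c : ℕ → ℂ) : Fin 6 → ℂ :=
  ![0, 0, 0, 0, -(q c 1 3 4 * q c 1 3 5 * q c 1 3 6 * q c 1 4 5 * q c 1 2 6 * (c 2 - c 6)) /
      ((c 2 - c 1) * (q c 1 4 6 * q c 1 5 6)),
    q c 1 3 4 * q c 1 3 5 * q c 1 3 6 * q c 1 4 5 * q c 1 2 5 * (c 2 - c 5) /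
      ((c 2 - c 1) * q c 1 5 6 * (c 5 - c 6))]

/-- The forms of complementary triples add up to zero, so all of them can be expressed by triples
that contain `1`. -/
theorem q_compl : q c 2 3 4 = -q c 1 5 6 ∧ q c 2 3 5 = -q c 1 4 6 ∧ q c 2 3 6 = -q c 1 4 5 ∧
    q c 2 4 5 = -q c 1 3 6 ∧ q c 2 4 6 = -q c 1 3 5 ∧ q c 2 5 6 = -q c 1 3 4 := by
  refine ⟨?_, ?_, ?_, ?_, ?_, ?_⟩ <;> simp only [q_eq] <;> ring

theorem symm_compatible (h : HasDistinctEntries c) (h146 : q c 1 4 6 ≠ 0) (h156 : q c 1 5 6 ≠ 0) :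
    symmZero c 4 * profile c 0 5 + symmOne c 4 * profile c 1 5 =
      symmZero c 5 * profile c 0 4 + symmOne c 5 * profile c 1 4 := by
  have h1 := h.sub_ne 1 2
  have h2 := h.sub_ne 2 1
  have h3 := h.sub_ne 5 6
  simp [symmZero, symmOne, profile, q_compl]
  field_simp
  simp only [q_eq]
  ring

/-- For the first two indices the columns of `P R` reduce to unit vectors in the coordinates `0`,
`1`. These two equations thus determine `symmZero` and `symmOne`; the equations for the other four
indices are then genuine conditions. -/
theorem symm_zero (h : HasDistinctEntries c) {s : Fin 6} (hs : lev s = 2) :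
    den a b c 0 * symmZero c s = num a b c 0 * (weight a b c 0 * p a b c 1 1 * p a b c 2 1 *
      middle (points c) (profile c) (c 1) 0 s / (c 1 - points c s)) := by
  have h1 := h.sub_ne 1 2
  have h2 := h.sub_ne 1 3
  have h3 := h.sub_ne 1 4
  have h4 := h.sub_ne 1 5
  have h5 := h.sub_ne 1 6
  have h6 := h.sub_ne 5 6
  fin_cases s <;> simp [lev] at hs
  · simp only [Fin.reduceFinMk, middle_zero_four h]
    simp [den, num, points, weight, symmZero]
    field_simp
  · simp only [Fin.reduceFinMk, middle_zero_five h]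
    simp [den, num, points, weight, symmZero]
    field_simp

theorem symm_one (h : HasDistinctEntries c) (h146 : q c 1 4 6 ≠ 0) (h156 : q c 1 5 6 ≠ 0) {s : Fin 6}
    (hs : lev s = 2) :
    den a b c 1 * symmOne c s = num a b c 1 * (weight a b c 1 * p a b c 1 2 * p a b c 2 2 *
      middle (points c) (profile c) (c 2) 1 s / (c 2 - points c s)) := by
  have h1 := h.sub_ne 2 1
  have h2 := h.sub_ne 2 3
  have h3 := h.sub_ne 2 4
  have h4 := h.sub_ne 2 5
  have h5 := h.sub_ne 2 6
  have h6 := h.sub_ne 5 6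
  fin_cases s <;> simp [lev] at hs
  · simp only [Fin.reduceFinMk, middle_one_four h]
    simp [den, num, points, weight, symmOne]
    field_simp
  · simp only [Fin.reduceFinMk, middle_one_five h]
    simp [den, num, points, weight, symmOne]
    field_simp

/-- Once the common factors are removed, a three-term identity of degree four in the `c k` alone
remains; it is `core`. -/
theorem symm_two (h : HasDistinctEntries c) (h146 : q c 1 4 6 ≠ 0) (h156 : q c 1 5 6 ≠ 0) {s : Fin 6}
    (hs : lev s = 2) :
    den a b c 2 * (symmZero c s * (p a b c 3 3 * profile c 0 2 / (c 3 - c 1)) +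
      symmOne c s * (p a b c 3 3 * profile c 1 2 / (c 3 - c 2))) =
      num a b c 2 * (weight a b c 2 * p a b c 1 3 * profile c 2 s / (c 3 - points c s)) := by
  have h1 := h.sub_ne 3 1
  have h2 := h.sub_ne 3 2
  have h3 := h.sub_ne 3 4
  have h4 := h.sub_ne 3 5
  have h5 := h.sub_ne 3 6
  have h6 := h.sub_ne 5 6
  have h7 := h.sub_ne 2 1
  have h8 := h.sub_ne 1 2
  fin_cases s <;> simp [lev] at hs
  · simp [den, num, points, weight, symmZero, symmOne, profile, q_compl]
    field_simp
    have core : (c 3 - c 2) * q c 1 4 6 * q c 1 5 6 * (c 1 - c 6) -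
        (c 3 - c 1) * q c 1 3 4 * q c 1 3 5 * (c 2 - c 6) =
        (c 1 - c 2) * (c 3 - c 6) * q c 1 2 4 * q c 1 2 5 := by
      simp only [q_eq]
      ring
    linear_combination (c 2 - c 1) *
      (p a b c 1 3 * p a b c 2 3 * q c 1 2 6 * q c 1 3 6 *
        p a b c 3 3 * q c 1 4 5) * core
  · simp [den, num, points, weight, symmZero, symmOne, profile, q_compl]
    field_simp
    have core : (c 3 - c 2) * q c 1 4 5 * q c 1 5 6 * (c 1 - c 5) -
        (c 3 - c 1) * q c 1 3 4 * q c 1 3 6 * (c 2 - c 5) =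
        (c 1 - c 2) * (c 3 - c 5) * q c 1 2 4 * q c 1 2 6 := by
      simp only [q_eq]
      ring
    linear_combination (c 1 - c 2) *
      (p a b c 1 3 * p a b c 2 3 * q c 1 2 5 * q c 1 3 5 * q c 1 4 5 *
        p a b c 3 3) * core

theorem symm_three (h : HasDistinctEntries c) (h146 : q c 1 4 6 ≠ 0) (h156 : q c 1 5 6 ≠ 0) {s : Fin 6}
    (hs : lev s = 2) :
    den a b c 3 * (symmZero c s * (p a b c 3 4 * profile c 0 3 / (c 4 - c 1)) +
      symmOne c s * (p a b c 3 4 * profile c 1 3 / (c 4 - c 2))) =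
      num a b c 3 * (weight a b c 3 * p a b c 1 4 * profile c 3 s / (c 4 - points c s)) := by
  have h1 := h.sub_ne 4 1
  have h2 := h.sub_ne 4 2
  have h3 := h.sub_ne 3 4
  have h4 := h.sub_ne 4 5
  have h5 := h.sub_ne 4 6
  have h6 := h.sub_ne 5 6
  have h7 := h.sub_ne 2 1
  have h8 := h.sub_ne 1 2
  fin_cases s <;> simp [lev] at hs
  · simp [den, num, points, weight, symmZero, symmOne, profile, q_compl]
    field_simp
    have core : (c 4 - c 2) * q c 1 3 6 * q c 1 5 6 * (c 1 - c 6) -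
        (c 4 - c 1) * q c 1 3 4 * q c 1 4 5 * (c 2 - c 6) =
        (c 1 - c 2) * (c 4 - c 6) * q c 1 2 3 * q c 1 2 5 := by
      simp only [q_eq]
      ring
    linear_combination (c 2 - c 1) * (c 4 - c 3) *
      (p a b c 1 4 * p a b c 2 4 * q c 1 2 6 * q c 1 3 6 *
        p a b c 3 4 * q c 1 3 5) * core
  · simp [den, num, points, weight, symmZero, symmOne, profile, q_compl]
    field_simp
    have core : (c 4 - c 2) * q c 1 3 5 * q c 1 5 6 * (c 1 - c 5) -
        (c 4 - c 1) * q c 1 3 4 * q c 1 4 6 * (c 2 - c 5) =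
        (c 1 - c 2) * (c 4 - c 5) * q c 1 2 3 * q c 1 2 6 := by
      simp only [q_eq]
      ring
    linear_combination (c 1 - c 2) * (c 4 - c 3) *
      (p a b c 1 4 * p a b c 2 4 * q c 1 2 5 * q c 1 3 5 * q c 1 4 5 *
        p a b c 3 4 * q c 1 3 6) * core

theorem symm_four (h : HasDistinctEntries c) (h146 : q c 1 4 6 ≠ 0) (h156 : q c 1 5 6 ≠ 0) {s : Fin 6}
    (hs : lev s = 2) :
    den a b c 4 * (symmZero c s * (p a b c 3 5 * p a b c 2 5 *
        middle (points c) (profile c) (c 5) 0 4 / (c 5 - c 1)) +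
      symmOne c s * (p a b c 3 5 * p a b c 2 5 *
        middle (points c) (profile c) (c 5) 1 4 / (c 5 - c 2))) =
      num a b c 4 * if 4 = s then weight a b c 4 else 0 := by
  have h1 := h.sub_ne 5 1
  have h2 := h.sub_ne 5 2
  have h3 := h.sub_ne 5 3
  have h4 := h.sub_ne 5 4
  have h6 := h.sub_ne 5 6
  have h7 := h.sub_ne 2 1
  have h8 := h.sub_ne 1 2
  fin_cases s <;> simp [lev] at hs
  · simp [middle_four_zero h, middle_four_one h, den, num, weight, symmZero, symmOne, q_compl]
    field_simp
    have core : (c 5 - c 2) * q c 1 3 6 * q c 1 4 6 * (c 1 - c 6) -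
        (c 5 - c 1) * q c 1 3 5 * q c 1 4 5 * (c 2 - c 6) =
        (c 1 - c 2) * (c 5 - c 6) * q c 1 2 3 * q c 1 2 4 := by
      simp only [q_eq]
      ring
    linear_combination (c 2 - c 1) *
      (p a b c 1 5 * q c 1 2 6 * q c 1 3 6 *
        p a b c 3 5 * p a b c 2 5 * q c 1 3 4) * core
  · simp [middle_four_zero h, middle_four_one h, den, num, symmZero, symmOne, q_compl]
    -- The target is off the diagonal of the last block, so the two contributions have to cancel.
    right
    field_simp
    ring

theorem symm_five (h : HasDistinctEntries c) (h146 : q c 1 4 6 ≠ 0) (h156 : q c 1 5 6 ≠ 0) {s : Fin 6}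
    (hs : lev s = 2) :
    den a b c 5 * (symmZero c s * (p a b c 3 6 * p a b c 2 6 *
        middle (points c) (profile c) (c 6) 0 5 / (c 6 - c 1)) +
      symmOne c s * (p a b c 3 6 * p a b c 2 6 *
        middle (points c) (profile c) (c 6) 1 5 / (c 6 - c 2))) =
      num a b c 5 * if 5 = s then weight a b c 5 else 0 := by
  have h1 := h.sub_ne 6 1
  have h2 := h.sub_ne 6 2
  have h3 := h.sub_ne 6 3
  have h4 := h.sub_ne 6 4
  have h5 := h.sub_ne 6 5
  have h6 := h.sub_ne 5 6
  have h7 := h.sub_ne 2 1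
  have h8 := h.sub_ne 1 2
  fin_cases s <;> simp [lev] at hs
  · simp [middle_five_zero h, middle_five_one h, den, num, symmZero, symmOne, q_compl]
    right
    field_simp
    ring
  · simp [middle_five_zero h, middle_five_one h, den, num, weight, symmZero, symmOne, q_compl]
    field_simp
    have core : (c 6 - c 2) * q c 1 3 5 * q c 1 4 5 * (c 1 - c 5) -
        (c 6 - c 1) * q c 1 3 6 * q c 1 4 6 * (c 2 - c 5) =
        (c 1 - c 2) * (c 6 - c 5) * q c 1 2 3 * q c 1 2 4 := by
      simp only [q_eq]
      ring
    linear_combination (c 2 - c 1) * (c 6 - c 5) *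
      (p a b c 1 6 * q c 1 2 5 * q c 1 3 5 * q c 1 4 5 *
        p a b c 3 6 * p a b c 2 6 * q c 1 3 4) * core

end ExtraCase

end

/-! ### Realization of the extra case. -/

noncomputable section

namespace ExtraCase

open ThreeBlocks

variable {a b c : ℕ → ℂ}

/-- The eigenvalues of `B` in the order of `points`. -/
def opposite (b : ℕ → ℂ) : Fin 6 → ℂ := ![b 3, b 3, b 2, b 2, b 1, b 1]

theorem matB_submatrix : (matB a b c).submatrix Fin.revPerm Fin.revPerm =
    Matrix.diagonal (opposite b) + lower (weight a b c) (profile c) := by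
  ext i j
  fin_cases i <;> fin_cases j <;> simp [matB, lower, weight, profile, lev, opposite, Fin.rev] <;> try ring

theorem matC_submatrix : (matC a b c).submatrix Fin.revPerm Fin.revPerm =
    Matrix.diagonal (points c) + upper (weight a b c) (profile c) := by
  ext i j
  fin_cases i <;> fin_cases j <;> simp [matC, upper, weight, profile, lev, points, Fin.rev] <;> try ring

theorem matA_eq : Matrix.diagonal (opposite b) + lower (weight a b c) (profile c) +
    (Matrix.diagonal (points c) + upper (weight a b c) (profile c)) =
      a 1 • 1 + Matrix.of fun i j => weight a b c i * profile c i j := by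
  ext i j
  fin_cases i <;> fin_cases j <;> simp [lower, upper, weight, profile, lev, points, opposite, p]

theorem points_injective (h : HasDistinctEntries c) : Function.Injective (points c) := by
  have key : ∀ i : Fin 6, points c i = c (i + 1) := fun i => by fin_cases i <;> rfl
  intro i j hij
  by_contra hne
  rw [key, key] at hij
  refine h.ne (i + 1) (Finset.mem_Icc.2 (by omega)) (j + 1) (Finset.mem_Icc.2 (by omega))
    (fun h' => hne (Fin.ext (by omega))) (sub_eq_zero.2 hij)

theorem conj_mul_symm (h : HasDistinctEntries c) (h146 : q c 1 4 6 ≠ 0) (h156 : q c 1 5 6 ≠ 0)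
    (i j : Fin 6) :
    num a b c i * den a b c j *
      (leftEigenvectors (points c) (upper (weight a b c) (profile c)) *
        (Matrix.of fun i j => weight a b c i * profile c i j) *
        rightEigenvectors (points c) (upper (weight a b c) (profile c))) i j =
    num a b c j * den a b c i *
      (leftEigenvectors (points c) (upper (weight a b c) (profile c)) *
        (Matrix.of fun i j => weight a b c i * profile c i j) *
        rightEigenvectors (points c) (upper (weight a b c) (profile c))) j i := by
  have hx := points_injective h
  have hw0 : ∀ i, lev i = 0 → weight a b c i = ![b 1 - a 1, b 2 - a 1, b 3 - a 1] 2 + points c i := by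
    intro i hi
    fin_cases i <;> simp [lev] at hi <;> simp [weight, p, points] <;> ring
  have hw1 : ∀ i, lev i = 1 → weight a b c i = ![b 1 - a 1, b 2 - a 1, b 3 - a 1] 1 + points c i := by
    intro i hi
    fin_cases i <;> simp [lev] at hi <;> simp [weight, p, points] <;> ring
  have hw2 : ∀ i, lev i = 2 → weight a b c i = ![b 1 - a 1, b 2 - a 1, b 3 - a 1] 0 + points c i := by
    intro i hi
    fin_cases i <;> simp [lev] at hi <;> simp [weight, p, points] <;> ring
  have hmid := profile_eq_middle (h.sub_ne 1 2) (h.sub_ne 3 4) (h.sub_ne 5 6)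
  have key : ∀ s, lev s = 2 → ∀ j, den a b c j *
      (symmZero c s *
        (profile c * rightEigenvectors (points c) (upper (weight a b c) (profile c))) 0 j +
      symmOne c s *
        (profile c * rightEigenvectors (points c) (upper (weight a b c) (profile c))) 1 j) =
      num a b c j * (leftEigenvectors (points c) (upper (weight a b c) (profile c)) *
        Matrix.of fun i j => weight a b c i * profile c i j) j s := by
    intro s hs j
    have hp : ∀ i k : ℕ, p a b c i k = b i - a 1 + c k := fun i k => by rw [p]; ring
    obtain rfl | rfl | rfl | rfl | rfl | rfl :
        j = 0 ∨ j = 1 ∨ j = 2 ∨ j = 3 ∨ j = 4 ∨ j = 5 := by omega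
    · rw [mul_right_of_lev_zero rfl, mul_right_of_lev_zero rfl,
        left_mul_of_lev_zero hx hw2 hw1 profile_of_lev_eq hmid rfl hs,
        profile_of_lev_eq 0 0 rfl, profile_of_lev_eq 1 0 rfl]
      have h1 := symm_zero (a := a) (b := b) h hs
      rw [hp 1, hp 2] at h1
      simpa [points] using h1
    · rw [mul_right_of_lev_zero rfl, mul_right_of_lev_zero rfl,
        left_mul_of_lev_zero hx hw2 hw1 profile_of_lev_eq hmid rfl hs,
        profile_of_lev_eq 0 1 rfl, profile_of_lev_eq 1 1 rfl]
      have h1 := symm_one (a := a) (b := b) h h146 h156 hs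
      rw [hp 1, hp 2] at h1
      simpa [points] using h1
    · rw [mul_right_of_lev_one hx hw0 profile_of_lev_eq rfl rfl,
        mul_right_of_lev_one hx hw0 profile_of_lev_eq rfl rfl,
        left_mul_of_lev_one hx hw2 profile_of_lev_eq rfl hs]
      have h1 := symm_two (a := a) (b := b) h h146 h156 hs
      rw [hp 1, hp 3] at h1
      simpa [points] using h1
    · rw [mul_right_of_lev_one hx hw0 profile_of_lev_eq rfl rfl,
        mul_right_of_lev_one hx hw0 profile_of_lev_eq rfl rfl,
        left_mul_of_lev_one hx hw2 profile_of_lev_eq rfl hs]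
      have h1 := symm_three (a := a) (b := b) h h146 h156 hs
      rw [hp 1, hp 3] at h1
      simpa [points] using h1
    · rw [mul_right_of_lev_two hx hw0 hw1 profile_of_lev_eq hmid rfl rfl,
        mul_right_of_lev_two hx hw0 hw1 profile_of_lev_eq hmid rfl rfl,
        left_mul_of_lev_two rfl hs profile_of_lev_eq]
      have h1 := symm_four (a := a) (b := b) h h146 h156 hs
      rw [hp 2, hp 3] at h1
      simpa [points] using h1
    · rw [mul_right_of_lev_two hx hw0 hw1 profile_of_lev_eq hmid rfl rfl,
        mul_right_of_lev_two hx hw0 hw1 profile_of_lev_eq hmid rfl rfl,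
        left_mul_of_lev_two rfl hs profile_of_lev_eq]
      have h1 := symm_five (a := a) (b := b) h h146 h156 hs
      rw [hp 2, hp 3] at h1
      simpa [points] using h1
  exact conj_symm (profile_eq_last (h.sub_ne 1 2) (h.sub_ne 3 4) (h.sub_ne 5 6))
    (symm_compatible h h146 h156) (key 4 rfl) (key 5 rfl) i j

theorem lev_ne (h : HasDistinctEntries c) (i j : Fin 6) (hij : lev i < lev j) : points c i ≠ points c j :=
  fun h' => hij.ne (congrArg lev (points_injective h h'))

theorem opposite_ne (h12 : b 1 ≠ b 2) (h13 : b 1 ≠ b 3) (h23 : b 2 ≠ b 3) {i j : Fin 6}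
    (hij : lev i < lev j) : opposite b i ≠ opposite b j := by
  fin_cases i <;> fin_cases j <;> simp [lev] at hij <;>
    first | exact h12.symm | exact h13.symm | exact h23.symm

/-- In the eigenbasis of `C` the matrices `B` and `A - a 1` differ by a diagonal matrix, so the
symmetry passes from one to the other. -/
theorem conj_matB_symm (h : HasDistinctEntries c) (h146 : q c 1 4 6 ≠ 0) (h156 : q c 1 5 6 ≠ 0)
    (i j : Fin 6) :
    num a b c (Fin.revPerm i).rev * den a b c (Fin.revPerm j).rev *
      (leftEigenvectors (points c) (upper (weight a b c) (profile c)) *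
        (Matrix.diagonal (opposite b) + lower (weight a b c) (profile c)) *
        rightEigenvectors (points c) (upper (weight a b c) (profile c))) i j =
    num a b c (Fin.revPerm j).rev * den a b c (Fin.revPerm i).rev *
      (leftEigenvectors (points c) (upper (weight a b c) (profile c)) *
        (Matrix.diagonal (opposite b) + lower (weight a b c) (profile c)) *
        rightEigenvectors (points c) (upper (weight a b c) (profile c))) j i := by
  simp only [Fin.revPerm_apply, Fin.rev_rev]
  have hLR := leftEigenvectors_mul_rightEigenvectors (upper_eq_zero (w := weight a b c)
    (P := profile c)) lev_le_two (lev_ne h)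
  have hCR := mul_rightEigenvectors (upper_eq_zero (w := weight a b c)
    (P := profile c)) lev_le_two (lev_ne h)
  rcases eq_or_ne i j with rfl | hij
  · rfl
  have key : leftEigenvectors (points c) (upper (weight a b c) (profile c)) *
        (Matrix.diagonal (opposite b) + lower (weight a b c) (profile c)) *
        rightEigenvectors (points c) (upper (weight a b c) (profile c)) =
      leftEigenvectors (points c) (upper (weight a b c) (profile c)) *
        (Matrix.of fun i j => weight a b c i * profile c i j) *
        rightEigenvectors (points c) (upper (weight a b c) (profile c)) +
      (a 1 • 1 - Matrix.diagonal (points c)) := by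
    rw [eq_sub_of_add_eq (matA_eq (a := a) (b := b) (c := c)), mul_sub, sub_mul,
      Matrix.mul_assoc _ (_ + upper _ _), hCR, ← Matrix.mul_assoc, hLR, one_mul, mul_add, add_mul,
      Matrix.mul_smul, Matrix.mul_one, Matrix.smul_mul, hLR]
    abel
  rw [key, Matrix.add_apply, Matrix.add_apply, Matrix.sub_apply, Matrix.sub_apply,
    Matrix.smul_apply, Matrix.smul_apply, Matrix.one_apply_ne hij, Matrix.one_apply_ne hij.symm,
    Matrix.diagonal_apply_ne _ hij, Matrix.diagonal_apply_ne _ hij.symm, smul_zero, sub_zero,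
    add_zero, add_zero]
  exact conj_mul_symm h h146 h156 i j

theorem matA_quadratic (h : HasDistinctEntries c)
    (htr : 4 * a 1 + 2 * a 2 = 2 * b 1 + 2 * b 2 + 2 * b 3 + ∑ k ∈ Finset.Icc 1 6, c k) :
    (Matrix.diagonal (opposite b) + lower (weight a b c) (profile c) +
      (Matrix.diagonal (points c) + upper (weight a b c) (profile c)) - a 1 • 1) *
      (Matrix.diagonal (opposite b) + lower (weight a b c) (profile c) +
      (Matrix.diagonal (points c) + upper (weight a b c) (profile c)) - a 2 • 1) = 0 := by
  have h1 := weighted_mul_self (a := a) (b := b) (h.sub_ne 1 2) (h.sub_ne 3 4) (h.sub_ne 5 6) htr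
  rw [matA_eq, add_sub_cancel_left, add_sub_right_comm, ← sub_smul, mul_add, h1, Matrix.mul_smul,
    Matrix.mul_one, ← add_smul, sub_add_sub_cancel, sub_self, zero_smul]

end ExtraCase

namespace SimpsonType

open ThreeBlocks ExtraCase

theorem hasDistinctEntries_eigC {s : TripleSpace extra.dim} (hs : s ∈ extra.S) :
    HasDistinctEntries (extra.eigC s) :=
  ⟨fun _ hi _ hj hij => sub_ne_zero.2 fun h =>
    hij (eigC_injOn hs (Finset.mem_coe.2 hi) (Finset.mem_coe.2 hj) h)⟩

theorem realizes_extra {s : TripleSpace extra.dim} (hs : s ∈ extra.S) : extra.Realizes s := by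
  have h := hasDistinctEntries_eigC hs
  have hb := eigB_injOn hs
  have hb' : ∀ k ∈ Finset.Icc 1 3, ∀ l ∈ Finset.Icc 1 3, k ≠ l →
      extra.eigB s k ≠ extra.eigB s l := fun k hk l hl hkl h =>
    hkl (hb (Finset.mem_coe.2 hk) (Finset.mem_coe.2 hl) h)
  refine realizes_of_levels hs (fun v => Iff.rfl) (Fin.revPerm : Equiv.Perm (Fin 6)) lev_le_two
    (lev := lev) (x := points (extra.eigC s)) (y := opposite (extra.eigB s))
    (fun i j hij => Fin.rev_lt_rev.2 ?_) lower_eq_zero upper_eq_zero matB_submatrix matC_submatrix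
    (fun i => ?_) (fun i => ?_) (fun i j hij => ?_) (fun i => ?_) (matA_quadratic h (trace_extra hs))
    (fun hs' i j => conj_matB_symm h ?_ ?_ i j) (fun _ => ⟨(0 : Fin 6), ?_⟩)
  · revert i j
    decide
  · rw [specC_of_mem_S]
    fin_cases i <;> rfl
  · refine (specB_extra hs _).trans ?_
    fin_cases i <;> rfl
  · exact opposite_ne (hb' 1 (by decide) 2 (by decide) (by decide))
      (hb' 1 (by decide) 3 (by decide) (by decide)) (hb' 2 (by decide) 3 (by decide) (by decide)) hij
  · have := specA_extra hs i
    split_ifs at this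
    · exact Or.inl this
    · exact Or.inr this
  -- Apart from differences of the `c k`, the argument divides only by `q_{146}` and `q_{156}`; both
  -- are factors of the second denominator.
  · have h1 : ExtraCase.den (extra.eigA s) (extra.eigB s) (extra.eigC s) 1 ≠ 0 := hs'.2 (1 : Fin 6)
    intro h0
    exact h1 (by simp [ExtraCase.den, h0])
  · have h1 : ExtraCase.den (extra.eigA s) (extra.eigB s) (extra.eigC s) 1 ≠ 0 := hs'.2 (1 : Fin 6)
    intro h0
    exact h1 (by simp [ExtraCase.den, h0])
  · exact neg_ne_zero.2 (mul_ne_zero (mul_ne_zero (mul_ne_zero (mul_ne_zero (h.sub_ne 1 2)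
      (h.sub_ne 1 3)) (h.sub_ne 1 4)) (h.sub_ne 1 5)) (h.sub_ne 1 6))

end SimpsonType

end

noncomputable section

/-! ### The sets `S'` and `S''` -/

namespace ExtraCase

variable {a b c : ℕ → ℂ}

theorem num_ne_zero
    (hp : ∀ i ∈ Finset.Icc 1 3, ∀ j ∈ Finset.Icc 1 6, p a b c i j ≠ 0)
    (hq : ∀ i ∈ Finset.Icc 1 6, ∀ j ∈ Finset.Icc 1 6, ∀ k ∈ Finset.Icc 1 6, q c i j k ≠ 0)
    (hd : ∀ i ∈ Finset.Icc 1 6, ∀ j ∈ Finset.Icc 1 6, i ≠ j → c i - c j ≠ 0) (i : Fin 6) :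
    num a b c i ≠ 0 := by
  have hp' (i j : ℕ) (hi : i ∈ Finset.Icc 1 3 := by decide)
    (hj : j ∈ Finset.Icc 1 6 := by decide) := hp i hi j hj
  have hq' (i j k : ℕ) (hi : i ∈ Finset.Icc 1 6 := by decide)
    (hj : j ∈ Finset.Icc 1 6 := by decide) (hk : k ∈ Finset.Icc 1 6 := by decide) :=
      hq i hi j hj k hk
  have hd' (i j : ℕ) (hi : i ∈ Finset.Icc 1 6 := by decide)
    (hj : j ∈ Finset.Icc 1 6 := by decide) (hij : i ≠ j := by decide) := hd i hi j hj hij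
  fin_cases i
  · exact neg_ne_zero.2 (mul_ne_zero (mul_ne_zero (mul_ne_zero (mul_ne_zero (hd' 1 2) (hd' 1 3))
      (hd' 1 4)) (hd' 1 5)) (hd' 1 6))
  · exact mul_ne_zero (mul_ne_zero (mul_ne_zero (mul_ne_zero (hd' 2 3) (hd' 2 4)) (hd' 2 5))
      (hd' 2 6)) (mul_ne_zero (mul_ne_zero (mul_ne_zero (hq' 1 3 4) (hq' 1 3 5)) (hq' 1 3 6))
      (hq' 1 4 5))
  · exact mul_ne_zero (mul_ne_zero (mul_ne_zero (mul_ne_zero (hd' 3 4) (hd' 3 5)) (hd' 3 6))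
      (hp' 3 3)) (mul_ne_zero (mul_ne_zero (mul_ne_zero (hq' 1 2 4) (hq' 1 2 5)) (hq' 1 2 6))
      (hq' 1 4 5))
  · exact mul_ne_zero (mul_ne_zero (mul_ne_zero (hd' 4 5) (hd' 4 6)) (hp' 3 4)) (mul_ne_zero
      (mul_ne_zero (mul_ne_zero (mul_ne_zero (hq' 1 2 3) (hq' 1 2 5)) (hq' 1 2 6)) (hq' 1 3 5))
      (hq' 1 3 6))
  · exact mul_ne_zero (mul_ne_zero (mul_ne_zero (hd' 5 6) (hp' 2 5)) (hp' 3 5)) (mul_ne_zero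
      (mul_ne_zero (mul_ne_zero (mul_ne_zero (hq' 1 2 3) (hq' 1 2 4)) (hq' 1 2 6)) (hq' 1 3 4))
      (hq' 1 3 6))
  · exact mul_ne_zero (mul_ne_zero (hp' 2 6) (hp' 3 6)) (mul_ne_zero (mul_ne_zero (mul_ne_zero
      (mul_ne_zero (mul_ne_zero (hq' 1 2 3) (hq' 1 2 4)) (hq' 1 2 5)) (hq' 1 3 4)) (hq' 1 3 5))
      (hq' 1 4 5))

theorem den_ne_zero
    (hp : ∀ i ∈ Finset.Icc 1 3, ∀ j ∈ Finset.Icc 1 6, p a b c i j ≠ 0)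
    (hq : ∀ i ∈ Finset.Icc 1 6, ∀ j ∈ Finset.Icc 1 6, ∀ k ∈ Finset.Icc 1 6, q c i j k ≠ 0)
    (hd : ∀ i ∈ Finset.Icc 1 6, ∀ j ∈ Finset.Icc 1 6, i ≠ j → c i - c j ≠ 0) (i : Fin 6) :
    den a b c i ≠ 0 := by
  have hp' (i j : ℕ) (hi : i ∈ Finset.Icc 1 3 := by decide)
    (hj : j ∈ Finset.Icc 1 6 := by decide) := hp i hi j hj
  have hq' (i j k : ℕ) (hi : i ∈ Finset.Icc 1 6 := by decide)
    (hj : j ∈ Finset.Icc 1 6 := by decide) (hk : k ∈ Finset.Icc 1 6 := by decide) :=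
      hq i hi j hj k hk
  have hd' (i j : ℕ) (hi : i ∈ Finset.Icc 1 6 := by decide)
    (hj : j ∈ Finset.Icc 1 6 := by decide) (hij : i ≠ j := by decide) := hd i hi j hj hij
  fin_cases i
  · exact mul_ne_zero (mul_ne_zero (hp' 1 1) (hp' 2 1)) (hp' 3 1)
  · exact mul_ne_zero (mul_ne_zero (mul_ne_zero (mul_ne_zero (hd' 2 1) (hp' 1 2)) (hp' 2 2))
      (hp' 3 2)) (mul_ne_zero (hq' 1 4 6) (hq' 1 5 6))
  · exact mul_ne_zero (mul_ne_zero (mul_ne_zero (mul_ne_zero (hd' 3 1) (hd' 3 2)) (hp' 1 3))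
      (hp' 2 3)) (mul_ne_zero (hq' 1 4 6) (hq' 1 5 6))
  · exact mul_ne_zero (mul_ne_zero (mul_ne_zero (mul_ne_zero (mul_ne_zero (hd' 4 1) (hd' 4 2))
      (hd' 4 3)) (hp' 1 4)) (hp' 2 4)) (hq' 1 5 6)
  · exact mul_ne_zero (mul_ne_zero (mul_ne_zero (mul_ne_zero (mul_ne_zero (hd' 5 1) (hd' 5 2))
      (hd' 5 3)) (hd' 5 4)) (hp' 1 5)) (hq' 1 4 6)
  · exact mul_ne_zero (mul_ne_zero (mul_ne_zero (mul_ne_zero (mul_ne_zero (hd' 6 1) (hd' 6 2))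
      (hd' 6 3)) (hd' 6 4)) (hd' 6 5)) (hp' 1 6)

end ExtraCase

namespace SimpsonType

/-- `S''` is cut out by denominators and numerators together, hence the disjoint sum of index sets;
the same point serves `S'` and `S''`. -/
theorem removesHyperplanes_S' {t : SimpsonType}
    (hnum : ∀ i, VanishesOnHyperplanes fun s => t.num s i)
    (hden : ∀ i, VanishesOnHyperplanes fun s => t.den s i)
    (h : ∃ s ∈ t.S, (∀ i, t.num s i ≠ 0) ∧ ∀ i, t.den s i ≠ 0) :
    RemovesHyperplanes t.S t.S' ∧ RemovesHyperplanes t.S t.S'' := by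
  obtain ⟨s, hs, h₁, h₂⟩ := h
  refine ⟨removesHyperplanes_of_vanishesOnHyperplanes hden hs h₂, ?_⟩
  have key := removesHyperplanes_of_vanishesOnHyperplanes (S := t.S)
    (g := Sum.elim (fun i s => t.den s i) fun i s => t.num s i)
    (by rintro (i | i); exacts [hden i, hnum i]) hs (by rintro (i | i); exacts [h₂ i, h₁ i])
  convert key using 1
  ext s
  simp [S'', S', and_assoc]

section VanishesOnHyperplanes

variable (t : SimpsonType)

theorem vanishesOnHyperplanes_eigB_sub (i j : ℕ) :
    VanishesOnHyperplanes fun s => t.eigB s i - t.eigB s j :=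
  ((t.isLinearForm_eigB i).sub (t.isLinearForm_eigB j)).vanishesOnHyperplanes

theorem vanishesOnHyperplanes_eigC_sub (i j : ℕ) :
    VanishesOnHyperplanes fun s => t.eigC s i - t.eigC s j :=
  ((t.isLinearForm_eigC i).sub (t.isLinearForm_eigC j)).vanishesOnHyperplanes

theorem vanishesOnHyperplanes_eigB_add_eigC_sub (i j k : ℕ) :
    VanishesOnHyperplanes fun s => t.eigB s i + t.eigC s j - t.eigA s k :=
  (((t.isLinearForm_eigB i).add (t.isLinearForm_eigC j)).sub
    (t.isLinearForm_eigA k)).vanishesOnHyperplanes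

theorem vanishesOnHyperplanes_pForm (i j k : ℕ) :
    VanishesOnHyperplanes fun s => pForm (t.eigA s) (t.eigB s) (t.eigC s) i j k :=
  (((t.isLinearForm_eigC i).add (t.isLinearForm_eigB j)).sub
    (t.isLinearForm_eigA k)).vanishesOnHyperplanes

theorem vanishesOnHyperplanes_qForm (i j : ℕ) :
    VanishesOnHyperplanes fun s => qForm (t.eigA s) (t.eigB s) (t.eigC s) i j :=
  ((((((t.isLinearForm_eigC i).add (t.isLinearForm_eigC j)).add (t.isLinearForm_eigB 2)).add
    (t.isLinearForm_eigB 3)).sub (t.isLinearForm_eigA 1)).sub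
      (t.isLinearForm_eigA 2)).vanishesOnHyperplanes

theorem vanishesOnHyperplanes_q (i j k : ℕ) :
    VanishesOnHyperplanes fun s => ExtraCase.q (t.eigC s) i j k :=
  ((((t.isLinearForm_eigC i).add (t.isLinearForm_eigC j)).add (t.isLinearForm_eigC k)).sub
    ((IsLinearForm.sum (Finset.Icc 1 6) t.isLinearForm_eigC).const_mul
      (1 / 2))).vanishesOnHyperplanes

end VanishesOnHyperplanes

theorem removesHyperplanes_hypergeometric (m : ℕ) (hm : 2 ≤ m) :
    RemovesHyperplanes (hypergeometric m hm).S (hypergeometric m hm).S' ∧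
      RemovesHyperplanes (hypergeometric m hm).S (hypergeometric m hm).S'' := by
  refine removesHyperplanes_S'
    (fun i => .mul (.prod _ fun _ => vanishesOnHyperplanes_eigB_sub _ _ _)
      (.prod _ fun _ => vanishesOnHyperplanes_eigB_add_eigC_sub _ _ _ _))
    (fun i => .mul (.prod _ fun _ => vanishesOnHyperplanes_eigB_sub _ _ _)
      (.prod _ fun _ => vanishesOnHyperplanes_eigB_add_eigC_sub _ _ _ _)) ?_
  have hI : ∀ x y : ℕ, x ≠ y → (x : ℂ) * Complex.I - y * Complex.I ≠ 0 := fun x y hxy h => by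
    rw [← sub_mul, mul_eq_zero, sub_eq_zero, Nat.cast_inj] at h
    exact h.elim hxy Complex.I_ne_zero
  -- The point has `b_k = k i`, `c_k = k`, `a_2 = 0`, and `a_1` is forced by the trace. Then `b_i +
  -- c_k - a_2` has positive real part.
  refine Exists.elim (exists_mem_S (hypergeometric m hm)
    (fun k => if k = 0 then ∑ k ∈ Finset.range m, ((k + 1 : ℕ) * Complex.I + (k + 1 : ℕ)) else 0)
    (fun k => (k + 1 : ℕ) * Complex.I) (fun k => (k + 1 : ℕ)) ?_
    (fun k _ l _ hkl => by by_contra hne; exact hI (k + 1) (l + 1) (by omega) (sub_eq_zero.2 hkl))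
    (fun k _ l _ hkl => by simpa using hkl) ?_) ?_
  rotate_right
  · rintro s ⟨hs, ha, hb, hc⟩
    have hlen : (hypergeometric m hm).typeB.length = m := Composition.ones_length m
    rw [hlen] at hb
    have ha2 : (hypergeometric m hm).eigA s 2 = 0 := ha 1 Nat.one_lt_two
    have hb' : ∀ k ∈ Finset.Icc 1 m, (hypergeometric m hm).eigB s k = k * Complex.I := fun k hk => by
      obtain ⟨k, rfl⟩ := Nat.exists_eq_add_of_le' (Finset.mem_Icc.1 hk).1
      exact hb k (by have := Finset.mem_Icc.1 hk; omega)
    have hc' : ∀ k ∈ Finset.Icc 1 m, (hypergeometric m hm).eigC s k = k := fun k hk => by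
      obtain ⟨k, rfl⟩ := Nat.exists_eq_add_of_le' (Finset.mem_Icc.1 hk).1
      exact hc k (by have := Finset.mem_Icc.1 hk; change k < m; omega)
    have h1 : ∀ i ∈ Finset.Icc 1 m, ∀ k ∈ Finset.Icc 1 m, i ≠ k →
        (hypergeometric m hm).eigB s i - (hypergeometric m hm).eigB s k ≠ 0 := fun i hi k hk hik => by
      rw [hb' i hi, hb' k hk]
      exact hI i k hik
    have h2 : ∀ i ∈ Finset.Icc 1 m, ∀ k ∈ Finset.Icc 1 m, (hypergeometric m hm).eigB s i +
        (hypergeometric m hm).eigC s k - (hypergeometric m hm).eigA s 2 ≠ 0 := fun i hi k hk h => by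
      rw [hb' i hi, hc' k hk, ha2, sub_zero] at h
      have := congrArg Complex.re h
      simp at this
      have := Finset.mem_Icc.1 hk
      omega
    refine ⟨s, hs, fun i => ?_, fun i => ?_⟩
    · have hi : (i : ℕ) < m := i.2
      refine mul_ne_zero (Finset.prod_ne_zero_iff.2 fun k hk => ?_)
        (Finset.prod_ne_zero_iff.2 fun k hk => ?_)
      all_goals rw [Finset.mem_Icc] at hk
      · exact h1 _ (Finset.mem_Icc.2 (by omega)) _ (Finset.mem_Icc.2 (by omega)) (by omega)
      · exact h2 _ (Finset.mem_Icc.2 (by omega)) _ (Finset.mem_Icc.2 (by omega))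
    · have hi : (i : ℕ) < m := i.2
      refine mul_ne_zero (Finset.prod_ne_zero_iff.2 fun k hk => ?_)
        (Finset.prod_ne_zero_iff.2 fun k hk => ?_)
      all_goals rw [Finset.mem_Icc] at hk
      · exact h1 _ (Finset.mem_Icc.2 (by omega)) _ (Finset.mem_Icc.2 (by omega)) (by omega)
      · exact h2 _ (Finset.mem_Icc.2 (by omega)) _ (Finset.mem_Icc.2 (by omega))
  · have hne : ∑ k ∈ Finset.range m, (((k + 1 : ℕ) : ℂ) * Complex.I + (k + 1 : ℕ)) ≠ 0 := fun h => by
      have h3 := congrArg Complex.re h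
      rw [Complex.re_sum] at h3
      simp only [Complex.add_re, Complex.mul_I_re, Complex.natCast_im, Complex.natCast_re, neg_zero,
        zero_add, Complex.zero_re] at h3
      rw [Finset.sum_eq_zero_iff_of_nonneg fun k _ => by positivity] at h3
      have := h3 0 (Finset.mem_range.2 (by omega))
      simp at this
    intro k hk l hl hkl
    change k < 2 at hk
    change l < 2 at hl
    interval_cases k <;> interval_cases l
    · rfl
    · exact absurd hkl (by simpa using hne)
    · exact absurd hkl.symm (by simpa using hne)
    · rfl
  · have hlA : (hypergeometric m hm).typeA.length = 2 := rfl
    have hlB : (hypergeometric m hm).typeB.length = m := Composition.ones_length m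
    have hB : ∀ k ∈ Finset.range m, (((hypergeometric m hm).typeB.blocks.getD k 0 : ℕ) : ℂ) *
        ((k + 1 : ℕ) * Complex.I) = (k + 1 : ℕ) * Complex.I := fun k hk => by
      have : (hypergeometric m hm).typeB.blocks = List.replicate m 1 := rfl
      simp [this, Finset.mem_range.1 hk]
    rw [hlA, hlB, Finset.sum_congr rfl hB, Finset.sum_range_succ, Finset.sum_range_one, if_pos rfl,
      if_neg one_ne_zero, mul_zero, add_zero, Finset.sum_add_distrib]
    simp [typeA, dim]

/-- The factors of the numerators and denominators in the even and odd families do not vanish at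
the triples with `a_1 = 0`, `a_2 = 1`, `b_2 = 2 i`, `b_3 = 3 i` and `c_k = k`. -/
theorem linearForms_ne_zero {n : ℕ} {a b c : ℕ → ℂ} (ha : a 1 = 0 ∧ a 2 = 1)
    (hb : b 2 = 2 * Complex.I ∧ b 3 = 3 * Complex.I) (hc : ∀ k ∈ Finset.Icc 1 n, c k = k) :
    (∀ i ∈ Finset.Icc 1 n, ∀ k ∈ Finset.Icc 1 n, i ≠ k → c i - c k ≠ 0) ∧
      (∀ i ∈ Finset.Icc 1 n, ∀ k ∈ Finset.Icc 1 n, qForm a b c i k ≠ 0) ∧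
      ∀ i ∈ Finset.Icc 1 n, pForm a b c i 3 1 ≠ 0 ∧ pForm a b c i 3 2 ≠ 0 ∧
        pForm a b c i 2 1 ≠ 0 := by
  refine ⟨fun i hi k hk hik => ?_, fun i hi k hk h => ?_, fun i hi => ⟨fun h => ?_, fun h => ?_,
    fun h => ?_⟩⟩
  · rw [hc i hi, hc k hk, sub_ne_zero]
    exact_mod_cast hik
  -- The imaginary part of `q` is `2 + 3`, that of `p` is `2` or `3`.
  · have := congrArg Complex.im h
    norm_num [qForm, ha, hb, hc i hi, hc k hk] at this
  all_goals
    have := congrArg Complex.im h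
    norm_num [pForm, ha, hb, hc i hi] at this

theorem removesHyperplanes_even (m : ℕ) (hm : 2 ≤ m) :
    RemovesHyperplanes (even m hm).S (even m hm).S' ∧
      RemovesHyperplanes (even m hm).S (even m hm).S'' := by
  refine removesHyperplanes_S' (fun i => ?_) (fun i => ?_) ?_
  · refine .mul (.mul (.prod _ fun _ => vanishesOnHyperplanes_eigC_sub _ _ _)
      (.prod _ fun _ => vanishesOnHyperplanes_qForm _ _ _)) ?_
    split_ifs
    · exact vanishesOnHyperplanes_pForm _ _ _ _
    · exact .mul (vanishesOnHyperplanes_pForm _ _ _ _) (vanishesOnHyperplanes_pForm _ _ _ _)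
  · refine .mul (.mul (.prod _ fun _ => vanishesOnHyperplanes_eigC_sub _ _ _)
      (.prod _ fun _ => vanishesOnHyperplanes_qForm _ _ _)) ?_
    split_ifs
    · exact vanishesOnHyperplanes_pForm _ _ _ _
    · exact .one
  have hsum : ((∑ k ∈ Finset.range (2 * m), ((k + 1 : ℕ) : ℂ))).im = 0 := by
    rw [Complex.im_sum]
    exact Finset.sum_eq_zero fun k _ => Complex.natCast_im _
  -- The value forced by the trace condition. Its imaginary part is negative, so it differs from `2
  -- i` and `3 i`.
  set b₁ : ℂ := m - (m - 1) * (2 * Complex.I) - m * (3 * Complex.I) -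
    ∑ k ∈ Finset.range (2 * m), ((k + 1 : ℕ) : ℂ) with hb₁
  have him : b₁.im < 0 := by
    have : (2 : ℝ) ≤ m := by exact_mod_cast hm
    rw [hb₁, Complex.sub_im, hsum]
    simp
    linarith
  refine Exists.elim (exists_mem_S (even m hm) (fun k => if k = 0 then 0 else 1)
    (fun k => if k = 0 then b₁ else if k = 1 then 2 * Complex.I else 3 * Complex.I)
    (fun k => (k + 1 : ℕ)) ?_ ?_ (fun k _ l _ hkl => by simpa using hkl) ?_) ?_
  rotate_right
  · rintro s ⟨hs, ha, hb, hc⟩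
    obtain ⟨h1, h2, h3⟩ := linearForms_ne_zero (n := 2 * m) (a := (even m hm).eigA s)
      (b := (even m hm).eigB s) (c := (even m hm).eigC s)
      ⟨ha 0 Nat.zero_lt_two, ha 1 Nat.one_lt_two⟩
      ⟨hb 1 (show 1 < 3 by decide), hb 2 (show 2 < 3 by decide)⟩ fun k hk => by
        obtain ⟨k, rfl⟩ := Nat.exists_eq_add_of_le' (Finset.mem_Icc.1 hk).1
        exact hc k (by have := Finset.mem_Icc.1 hk; change k < 2 * m; omega)
    refine ⟨s, hs, fun i => ?_, fun i => ?_⟩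
    · have hi : (i : ℕ) < 2 * m := i.2
      have h3' := h3 _ (Finset.mem_Icc.2 ⟨Nat.le_add_left 1 i, hi⟩)
      refine mul_ne_zero (mul_ne_zero (Finset.prod_ne_zero_iff.2 fun k hk => ?_)
        (Finset.prod_ne_zero_iff.2 fun k hk => ?_)) ?_
      · rw [Finset.mem_Icc] at hk
        exact h1 _ (Finset.mem_Icc.2 (by omega)) _ (Finset.mem_Icc.2 (by omega)) (by omega)
      · rw [Finset.mem_erase, Finset.mem_Icc] at hk
        exact h2 _ (Finset.mem_Icc.2 (by omega)) _ (Finset.mem_Icc.2 (by omega))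
      · split_ifs
        · exact h3'.1
        · exact mul_ne_zero h3'.1 h3'.2.1
    · have hi : (i : ℕ) < 2 * m := i.2
      have h3' := h3 _ (Finset.mem_Icc.2 ⟨Nat.le_add_left 1 i, hi⟩)
      refine mul_ne_zero (mul_ne_zero (Finset.prod_ne_zero_iff.2 fun k hk => ?_)
        (Finset.prod_ne_zero_iff.2 fun k hk => ?_)) ?_
      · rw [Finset.mem_Icc] at hk
        exact h1 _ (Finset.mem_Icc.2 (by omega)) _ (Finset.mem_Icc.2 (by omega)) (by omega)
      · rw [Finset.mem_erase, Finset.mem_Icc] at hk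
        exact h2 _ (Finset.mem_Icc.2 (by omega)) _ (Finset.mem_Icc.2 (by omega))
      · split_ifs
        · exact h3'.2.1
        · exact one_ne_zero
  · intro k hk l hl hkl
    change k < 2 at hk
    change l < 2 at hl
    interval_cases k <;> interval_cases l <;> simp at hkl ⊢
  · intro k hk l hl hkl
    change k < 3 at hk
    change l < 3 at hl
    have h := congrArg Complex.im hkl
    interval_cases k <;> interval_cases l <;> simp at h ⊢ <;> linarith
  · have hlA : (even m hm).typeA.length = 2 := rfl
    have hlB : (even m hm).typeB.length = 3 := rfl
    have h1 : ((m - 1 : ℕ) : ℂ) = m - 1 := by push_cast [show 1 ≤ m by omega]; rfl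
    rw [hlA, hlB]
    simp [Finset.sum_range_succ, typeA, typeB, dim, h1, hb₁]
    ring

theorem removesHyperplanes_odd (m : ℕ) (hm : 2 ≤ m) :
    RemovesHyperplanes (odd m hm).S (odd m hm).S' ∧
      RemovesHyperplanes (odd m hm).S (odd m hm).S'' := by
  refine removesHyperplanes_S' (fun i => ?_) (fun i => ?_) ?_
  · refine .mul (.mul (.prod _ fun _ => vanishesOnHyperplanes_eigC_sub _ _ _)
      (.prod _ fun _ => vanishesOnHyperplanes_qForm _ _ _)) ?_
    split_ifs
    · exact vanishesOnHyperplanes_pForm _ _ _ _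
    · exact .mul (vanishesOnHyperplanes_pForm _ _ _ _) (vanishesOnHyperplanes_pForm _ _ _ _)
  · refine .mul (.mul (.prod _ fun _ => vanishesOnHyperplanes_eigC_sub _ _ _)
      (.prod _ fun _ => vanishesOnHyperplanes_qForm _ _ _)) ?_
    split_ifs
    · exact vanishesOnHyperplanes_pForm _ _ _ _
    · exact .one
  have hsum : ((∑ k ∈ Finset.range (2 * m + 1), ((k + 1 : ℕ) : ℂ))).im = 0 := by
    rw [Complex.im_sum]
    exact Finset.sum_eq_zero fun k _ => Complex.natCast_im _
  -- Again forced by the trace, again with negative imaginary part.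
  set b₁ : ℂ := m - m * (2 * Complex.I) - m * (3 * Complex.I) -
    ∑ k ∈ Finset.range (2 * m + 1), ((k + 1 : ℕ) : ℂ) with hb₁
  have him : b₁.im < 0 := by
    have : (2 : ℝ) ≤ m := by exact_mod_cast hm
    rw [hb₁, Complex.sub_im, hsum]
    simp
    linarith
  refine Exists.elim (exists_mem_S (odd m hm) (fun k => if k = 0 then 0 else 1)
    (fun k => if k = 0 then b₁ else if k = 1 then 2 * Complex.I else 3 * Complex.I)
    (fun k => (k + 1 : ℕ)) ?_ ?_ (fun k _ l _ hkl => by simpa using hkl) ?_) ?_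
  rotate_right
  · rintro s ⟨hs, ha, hb, hc⟩
    obtain ⟨h1, h2, h3⟩ := linearForms_ne_zero (n := 2 * m + 1) (a := (odd m hm).eigA s)
      (b := (odd m hm).eigB s) (c := (odd m hm).eigC s)
      ⟨ha 0 Nat.zero_lt_two, ha 1 Nat.one_lt_two⟩
      ⟨hb 1 (show 1 < 3 by decide), hb 2 (show 2 < 3 by decide)⟩ fun k hk => by
        obtain ⟨k, rfl⟩ := Nat.exists_eq_add_of_le' (Finset.mem_Icc.1 hk).1
        exact hc k (by have := Finset.mem_Icc.1 hk; change k < 2 * m + 1; omega)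
    refine ⟨s, hs, fun i => ?_, fun i => ?_⟩
    · have hi : (i : ℕ) < 2 * m + 1 := i.2
      have h3' := h3 _ (Finset.mem_Icc.2 ⟨Nat.le_add_left 1 i, hi⟩)
      refine mul_ne_zero (mul_ne_zero (Finset.prod_ne_zero_iff.2 fun k hk => ?_)
        (Finset.prod_ne_zero_iff.2 fun k hk => ?_)) ?_
      · rw [Finset.mem_Icc] at hk
        exact h1 _ (Finset.mem_Icc.2 (by omega)) _ (Finset.mem_Icc.2 (by omega)) (by omega)
      · rw [Finset.mem_erase, Finset.mem_Icc] at hk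
        exact h2 _ (Finset.mem_Icc.2 (by omega)) _ (Finset.mem_Icc.2 (by omega))
      · split_ifs
        · exact h3'.1
        · exact mul_ne_zero h3'.1 h3'.2.2
    · have hi : (i : ℕ) < 2 * m + 1 := i.2
      have h3' := h3 _ (Finset.mem_Icc.2 ⟨Nat.le_add_left 1 i, hi⟩)
      refine mul_ne_zero (mul_ne_zero (Finset.prod_ne_zero_iff.2 fun k hk => ?_)
        (Finset.prod_ne_zero_iff.2 fun k hk => ?_)) ?_
      · rw [Finset.mem_Icc] at hk
        exact h1 _ (Finset.mem_Icc.2 (by omega)) _ (Finset.mem_Icc.2 (by omega)) (by omega)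
      · rw [Finset.mem_erase, Finset.mem_Icc] at hk
        exact h2 _ (Finset.mem_Icc.2 (by omega)) _ (Finset.mem_Icc.2 (by omega))
      · split_ifs
        · exact h3'.2.2
        · exact one_ne_zero
  · intro k hk l hl hkl
    change k < 2 at hk
    change l < 2 at hl
    interval_cases k <;> interval_cases l <;> simp at hkl ⊢
  · intro k hk l hl hkl
    change k < 3 at hk
    change l < 3 at hl
    have h := congrArg Complex.im hkl
    interval_cases k <;> interval_cases l <;> simp at h ⊢ <;> linarith
  · have hlA : (odd m hm).typeA.length = 2 := rfl
    have hlB : (odd m hm).typeB.length = 3 := rfl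
    rw [hlA, hlB]
    simp [Finset.sum_range_succ, typeA, typeB, dim, hb₁]
    ring

theorem vanishesOnHyperplanes_num_extra {E : Type*} [AddCommGroup E] [Module ℂ E]
    {a b c : E → ℕ → ℂ}
    (hp : ∀ i j, VanishesOnHyperplanes fun s => ExtraCase.p (a s) (b s) (c s) i j)
    (hq : ∀ i j k, VanishesOnHyperplanes fun s => ExtraCase.q (c s) i j k)
    (hd : ∀ i j, VanishesOnHyperplanes fun s => c s i - c s j) (i : Fin 6) :
    VanishesOnHyperplanes fun s => ExtraCase.num (a s) (b s) (c s) i := by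
  fin_cases i
  · exact .neg (.mul (.mul (.mul (.mul (hd 1 2) (hd 1 3)) (hd 1 4)) (hd 1 5)) (hd 1 6))
  · exact .mul (.mul (.mul (.mul (hd 2 3) (hd 2 4)) (hd 2 5)) (hd 2 6)) (.mul (.mul (.mul (hq 1
      3 4) (hq 1 3 5)) (hq 1 3 6)) (hq 1 4 5))
  · exact .mul (.mul (.mul (.mul (hd 3 4) (hd 3 5)) (hd 3 6)) (hp 3 3)) (.mul (.mul (.mul (hq 1
      2 4) (hq 1 2 5)) (hq 1 2 6)) (hq 1 4 5))
  · exact .mul (.mul (.mul (hd 4 5) (hd 4 6)) (hp 3 4)) (.mul (.mul (.mul (.mul (hq 1 2 3) (hq 1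
      2 5)) (hq 1 2 6)) (hq 1 3 5)) (hq 1 3 6))
  · exact .mul (.mul (.mul (hd 5 6) (hp 2 5)) (hp 3 5)) (.mul (.mul (.mul (.mul (hq 1 2 3) (hq 1
      2 4)) (hq 1 2 6)) (hq 1 3 4)) (hq 1 3 6))
  · exact .mul (.mul (hp 2 6) (hp 3 6)) (.mul (.mul (.mul (.mul (.mul (hq 1 2 3) (hq 1 2 4)) (hq
      1 2 5)) (hq 1 3 4)) (hq 1 3 5)) (hq 1 4 5))

theorem vanishesOnHyperplanes_den_extra {E : Type*} [AddCommGroup E] [Module ℂ E]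
    {a b c : E → ℕ → ℂ}
    (hp : ∀ i j, VanishesOnHyperplanes fun s => ExtraCase.p (a s) (b s) (c s) i j)
    (hq : ∀ i j k, VanishesOnHyperplanes fun s => ExtraCase.q (c s) i j k)
    (hd : ∀ i j, VanishesOnHyperplanes fun s => c s i - c s j) (i : Fin 6) :
    VanishesOnHyperplanes fun s => ExtraCase.den (a s) (b s) (c s) i := by
  fin_cases i
  · exact .mul (.mul (hp 1 1) (hp 2 1)) (hp 3 1)
  · exact .mul (.mul (.mul (.mul (hd 2 1) (hp 1 2)) (hp 2 2)) (hp 3 2)) (.mul (hq 1 4 6) (hq 1 5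
      6))
  · exact .mul (.mul (.mul (.mul (hd 3 1) (hd 3 2)) (hp 1 3)) (hp 2 3)) (.mul (hq 1 4 6) (hq 1 5
      6))
  · exact .mul (.mul (.mul (.mul (.mul (hd 4 1) (hd 4 2)) (hd 4 3)) (hp 1 4)) (hp 2 4)) (hq 1 5
      6)
  · exact .mul (.mul (.mul (.mul (.mul (hd 5 1) (hd 5 2)) (hd 5 3)) (hd 5 4)) (hp 1 5)) (hq 1 4
      6)
  · exact .mul (.mul (.mul (.mul (.mul (hd 6 1) (hd 6 2)) (hd 6 3)) (hd 6 4)) (hd 6 5)) (hp 1 6)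

theorem removesHyperplanes_extra :
    RemovesHyperplanes extra.S extra.S' ∧ RemovesHyperplanes extra.S extra.S'' := by
  have hp : ∀ i j, VanishesOnHyperplanes fun s =>
      ExtraCase.p (extra.eigA s) (extra.eigB s) (extra.eigC s) i j :=
    fun i j => vanishesOnHyperplanes_eigB_add_eigC_sub _ _ _ _
  refine removesHyperplanes_S' (vanishesOnHyperplanes_num_extra hp
    extra.vanishesOnHyperplanes_q extra.vanishesOnHyperplanes_eigC_sub)
    (vanishesOnHyperplanes_den_extra hp
    extra.vanishesOnHyperplanes_q extra.vanishesOnHyperplanes_eigC_sub) ?_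
  -- The point has `a_1 = 0`, `b_k = k i`, `c_k = 2 ^ k`, and the trace forces `2 a_2 = 12 i + 126`.
  -- Then `q_{ijk} = 2 ^ i + 2 ^ j + 2 ^ k - 63` is an odd integer, and each `p_{jk}` has the
  -- imaginary part `j` of `b_j`.
  refine Exists.elim (exists_mem_S extra
    (fun k => if k = 0 then 0 else 6 * Complex.I + 63) (fun k => (k + 1) * Complex.I)
    (fun k => (2 : ℂ) ^ (k + 1)) ?_ ?_ ?_ ?_) ?_
  rotate_right
  · rintro s ⟨hs, ha, hb, hc⟩
    have ha1 : extra.eigA s 1 = 0 := ha 0 (by decide)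
    have hb' : ∀ k ∈ Finset.Icc 1 3, extra.eigB s k = k * Complex.I := fun k hk => by
      obtain ⟨k, rfl⟩ := Nat.exists_eq_add_of_le' (Finset.mem_Icc.1 hk).1
      rw [Nat.cast_add_one]
      exact hb k (by have := Finset.mem_Icc.1 hk; change k < 3; omega)
    have hc' : ∀ k ∈ Finset.Icc 1 6, extra.eigC s k = ((2 ^ k : ℤ) : ℂ) := fun k hk => by
      obtain ⟨k, rfl⟩ := Nat.exists_eq_add_of_le' (Finset.mem_Icc.1 hk).1
      rw [Int.cast_pow, Int.cast_ofNat]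
      exact hc k (by have := Finset.mem_Icc.1 hk; change k < 6; omega)
    have hp : ∀ i ∈ Finset.Icc 1 3, ∀ j ∈ Finset.Icc 1 6,
        ExtraCase.p (extra.eigA s) (extra.eigB s) (extra.eigC s) i j ≠ 0 := fun i hi j hj h => by
      rw [ExtraCase.p, ha1, hb' i hi, hc' j hj] at h
      have := congrArg Complex.im h
      rw [Complex.sub_im, Complex.add_im, Complex.intCast_im] at this
      simp at this
      have := Finset.mem_Icc.1 hi
      omega
    have hq : ∀ i ∈ Finset.Icc 1 6, ∀ j ∈ Finset.Icc 1 6, ∀ k ∈ Finset.Icc 1 6,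
        ExtraCase.q (extra.eigC s) i j k ≠ 0 := fun i hi j hj k hk h => by
      rw [ExtraCase.q_eq, hc' i hi, hc' j hj, hc' k hk, hc' 1 (by decide), hc' 2 (by decide),
        hc' 3 (by decide), hc' 4 (by decide), hc' 5 (by decide), hc' 6 (by decide)] at h
      have h' : ((2 ^ i + 2 ^ j + 2 ^ k - 63 : ℤ) : ℂ) = 0 := by
        rw [← h]
        push_cast
        ring
      have h2 : ∀ i ∈ Finset.Icc 1 6, (2 : ℤ) ^ i % 2 = 0 := by decide
      have := Int.cast_eq_zero.1 h'
      have := h2 i hi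
      have := h2 j hj
      have := h2 k hk
      omega
    have hd : ∀ i ∈ Finset.Icc 1 6, ∀ j ∈ Finset.Icc 1 6, i ≠ j →
        extra.eigC s i - extra.eigC s j ≠ 0 := hasDistinctEntries_eigC hs |>.ne
    refine ⟨s, hs, ExtraCase.num_ne_zero hp hq hd, ExtraCase.den_ne_zero hp hq hd⟩
  · intro k hk l hl hkl
    change k < 2 at hk
    change l < 2 at hl
    have h := congrArg Complex.im hkl
    interval_cases k <;> interval_cases l <;> simp at h ⊢
  · intro k _ l _ hkl
    simpa using hkl
  · intro k _ l _ hkl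
    have h : ((2 ^ (k + 1) : ℕ) : ℂ) = ((2 ^ (l + 1) : ℕ) : ℂ) := by
      push_cast
      exact hkl
    have := Nat.pow_right_injective le_rfl (Nat.cast_injective h)
    omega
  · have hlA : extra.typeA.length = 2 := rfl
    have hlB : extra.typeB.length = 3 := rfl
    rw [hlA, hlB]
    simp [Finset.sum_range_succ, typeA, typeB, dim]
    ring

end SimpsonType

end

/-! ### Assembly of the four cases. -/

namespace SimpsonType

theorem realizes {t : SimpsonType} {s : TripleSpace t.dim} (hs : s ∈ t.S) :
    t.Realizes s := by
  cases t with
  | hypergeometric m hm => exact realizes_hypergeometric hs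
  | even m hm => exact realizes_even hs
  | odd m hm => exact realizes_odd hs
  | extra => exact realizes_extra hs

theorem removesHyperplanes (t : SimpsonType) :
    RemovesHyperplanes t.S t.S' ∧ RemovesHyperplanes t.S t.S'' := by
  cases t with
  | hypergeometric m hm => exact removesHyperplanes_hypergeometric m hm
  | even m hm => exact removesHyperplanes_even m hm
  | odd m hm => exact removesHyperplanes_odd m hm
  | extra => exact removesHyperplanes_extra

end SimpsonType

theorem mainTheorem1 (t : SimpsonType) :
    -- the sets `S'' ⊆ S' ⊆ S`
    (t.S'' ⊆ t.S' ∧ t.S' ⊆ t.S) ∧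
    (RemovesHyperplanes t.S t.S' ∧ RemovesHyperplanes t.S t.S'') ∧
    (IsOpenIn t.S t.S' ∧ IsOpenIn t.S t.S'') ∧
    ∀ s ∈ t.S,
      -- the prescribed spectra
      (DiagonalizableWithSpectrum (t.matA s) s.1 ∧
        DiagonalizableWithSpectrum (t.matB s) s.2.1 ∧
        DiagonalizableWithSpectrum (t.matC s) s.2.2) ∧
      -- the normalized eigenbasis exists and is unique
      ∃ v : Module.Basis (Fin t.dim) ℂ (Fin t.dim → ℂ),
        t.IsEigenbasis s v ∧ (∀ w, t.IsEigenbasis s w → w = v) ∧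
        -- the form that is diagonal in this basis
        (s ∈ t.S' → ∃ Φ : LinearMap.BilinForm ℂ (Fin t.dim → ℂ),
          (∀ i j, Φ (v i) (v j) = if i = j then t.num s i / t.den s i else 0) ∧
          Φ.IsSymm ∧ Φ ≠ 0 ∧
          LinearMap.IsSelfAdjoint Φ (Matrix.toLin' (t.matA s)) ∧
          LinearMap.IsSelfAdjoint Φ (Matrix.toLin' (t.matB s)) ∧
          LinearMap.IsSelfAdjoint Φ (Matrix.toLin' (t.matC s)) ∧
          (s ∈ t.S'' → Φ.Nondegenerate)) := by
  exact ⟨⟨fun s hs => hs.1, fun s hs => hs.1⟩, t.removesHyperplanes,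
    ⟨t.removesHyperplanes.1.isOpenIn, t.removesHyperplanes.2.isOpenIn⟩,
    fun s hs => SimpsonType.realizes hs⟩
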